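/- **Setting.** Let $\mathfrak L$ be the algebra of germs at $0$ of holomorphic functions on punctured discs $\{0<|z|<R\}$, and let $(f)_n$ denote the coefficient of $z^n$ in the Laurent expansion of $f\in\mathfrak L$. Let $L^0=\{e^f : f\in\mathfrak L\}$ (the identity component of the analytic loop group of $GL_1$), and let $\widehat{GL}_1=L^0\times\mathbb C^*\times\mathbb C^*$ be the group with product $$(e^f,\Lambda,\Gamma)(e^g,\Lambda',\Gamma')=\Big(e^{f(z/\Gamma')+g(z\Gamma)},\ \Lambda\Lambda'\exp\Big(\big(\tfrac{d}{dz}(f(z/\Gamma'))\,g(z\Gamma)\big)_{-1}\Big),\ \Gamma\Gamma'\Big).$$ Its Lie algebra (tangent space at the identity) is $\widehat{\mathfrak{gl}}_1=\mathfrak L\oplus\mathbb Cc\oplus\mathbb Cd$, where $f+\lambda c+\mu d$ is the velocity at $t=0$ of $t\mapsto(e^{tf},e^{t\lambda},e^{t\mu})$. It carries the symmetric bilinear form $(f+\lambda c+\mu d,\ g+\lambda'c+\mu'd)=(fg)_0+\lambda\mu'+\mu\lambda'$. Put $\langle a\oplus b,a'\oplus b'\rangle=(a,a')-(b,b')$ on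 $\widetilde{\mathfrak g}=\widehat{\mathfrak{gl}}_1\times\widehat{\mathfrak{gl}}_1$. Let $H\subset\widehat{GL}_1\times\widehat{GL}_1$ be the subgroup of the elements $((f_+,\Lambda,\Gamma),(f_-,\Lambda^{-1},\Gamma^{-1}))$, where $f_\pm\in L^0$, $f_+$ extends to a holomorphic map to $\mathbb C^*$ around $0$, $f_-$ extends to a holomorphic map $\mathbb P^1\setminus\{0\}\to\mathbb C^*$, and $f_+(0)=f_-(\infty)^{-1}$. Let $$\mathfrak h=\{(a+\lambda c+\mu d)\oplus(b-\lambda c-\mu d)\},$$ with $a\in\mathfrak L$ holomorphic around $0$, $b\in\mathfrak L$ holomorphic on $\mathbb P^1\setminus\{0\}$ and $a(0)=-b(\infty)$, be its Lie algebra, and let $\mathfrak K\subset\widetilde{\mathfrak g}$ be the diagonal. The Poisson bracket on $H$ given by the Manin triple $(\widetilde{\mathfrak g},\mathfrak h,\mathfrak K)$ is $$\{F_1,F_2\}(h)=\langle \mathrm{Ad}(h^{-1})\,\pi\,\mathrm{Ad}(h)X_1,\ X_2\rangle ,$$ where $\pi$ is the projection to $\mathfrak h$ along $\mathfrak K$,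 and $X_i\in\mathfrak K$ represents, through $\langle X_i,\cdot\rangle$ on $\mathfrak h$, the pull-back to $\mathfrak h$ of $dF_i(h)$ under the left translation $g\mapsto hg$. Every $h\in H$ is uniquely of the form $((ae^{\sum_{n>0}a_nz^n},\lambda,\gamma),(a^{-1}e^{\sum_{n<0}a_nz^n},\lambda^{-1},\gamma^{-1}))$. Put $k(h)=a$, $\Lambda(h)=\lambda$, $\Gamma(h)=\gamma$, $h_m(h)=a_m$ ($m\in\mathbb Z\setminus\{0\}$), and let $\mathbb C[H]$ be the ring of functions on $H$ generated by $k^{\pm1},\Lambda^{\pm1},\Gamma^{\pm1}$ and all $h_m$. Let $\mathcal U_q(\widehat{\mathfrak{gl}}_1)$ be the $\mathbb C(q)$-algebra with generators $h_m$ ($m\in\mathbb Z\setminus\{0\}$), $\Lambda^{\pm1}$, central $\Gamma^{\pm1},k^{\pm1}$, and relations $$[h_m,h_{n}]=\delta_{m,-n}\frac{[m]_q}{m}\,\frac{\Gamma^{2m}-\Gamma^{-2m}}{q-q^{-1}},\qquad h_m\Lambda=q^{2m}\Lambda h_m,\qquad [m]_q=\frac{q^m-q^{-m}}{q-q^{-1}},$$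 with the Hopf structure for which $\Lambda,\Gamma,k$ are group-like, $\Delta(h_m)=h_m\otimes\Gamma^{-|m|}+\Gamma^{|m|}\otimes h_m$, $S(h_m)=-h_m$, $\varepsilon(h_m)=0$. Let $\mathcal U$ be its $\mathbb C[q^{\pm1}]$-subalgebra generated by $(q-q^{-1})h_m$, $\Lambda^{\pm1},\Gamma^{\pm1},k^{\pm1}$, and let $Z_1=\mathcal U/(q-1)\,\mathcal U$. This is a commutative algebra, with the Hopf structure induced by that of $\mathcal U_q(\widehat{\mathfrak{gl}}_1)$ and with the bracket $\{x,y\}=[\tilde x,\tilde y]/(q-q^{-1}) \bmod (q-1)$, where $\tilde x,\tilde y\in\mathcal U$ are lifts of $x,y$. **Theorem.** The functions $\Lambda,\Gamma,k,h_m$ on $H$ are algebraically independent, so that $\mathbb C[H]=\mathbb C[\Lambda^{\pm1},\Gamma^{\pm1},k^{\pm1},h_m]_{m\ne0}$ is a polynomial ring with $\Lambda,\Gamma,k$ inverted. For $F_1,F_2\in\mathbb C[H]$ the bracket $\{F_1,F_2\}$ of the Manin triple is well defined at every point of $H$ and lies in $\mathbb C[H]$. With this bracket, and with the coproduct, counit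 and antipode given by the group structure of $H$, $\mathbb C[H]$ is a Poisson Hopf algebra (that is, a Hopf algebra with a Poisson bracket such that $\Delta\{f,g\}=\{\Delta f,\Delta g\}$, where $\{f_1\otimes f_2,g_1\otimes g_2\}=f_1g_1\otimes\{f_2,g_2\}+\{f_1,g_1\}\otimes f_2g_2$); so is $Z_1$ with the structure above. There is an algebra isomorphism $\Phi:\mathbb C[H]\to Z_1$ that maps $\Lambda,\Gamma,k$ to the classes of $\Lambda,\Gamma,k$ and $h_m$ to the class of $(q-q^{-1})h_m$, and $\Phi$ is an isomorphism of Poisson Hopf algebras. -/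

import Mathlib

open Filter Topology
open scoped TensorProduct

noncomputable section

namespace GL1Loop

/-- Germs at `0` of functions on punctured neighbourhoods of `0`. -/
abbrev PGerm : Type := Germ (𝓝[≠] (0 : ℂ)) ℂ

instance : Algebra ℂ PGerm :=
  Algebra.ofModule
    (fun r x y => by
      induction x using Germ.inductionOn; induction y using Germ.inductionOn
      rename_i f g
      exact congrArg (fun h : ℂ → ℂ => (h : PGerm)) (by funext z; simp [mul_assoc]))
    (fun r x y => by
      induction x using Germ.inductionOn; induction y using Germ.inductionOn
      rename_i f g
      exact congrArg (fun h : ℂ → ℂ => (h : PGerm)) (by funext z; simp [mul_left_comm]))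

/-- `F` is holomorphic on some punctured disc around `0`. -/
def IsHol (F : ℂ → ℂ) : Prop := ∀ᶠ z in 𝓝[≠] (0 : ℂ), DifferentiableAt ℂ F z

/-- The algebra of germs of holomorphic functions on punctured discs around `0`. -/
def Loop : Subalgebra ℂ PGerm where
  carrier := {f | ∃ F : ℂ → ℂ, IsHol F ∧ f = (F : PGerm)}
  mul_mem' := by
    rintro _ _ ⟨F, hF, rfl⟩ ⟨G, hG, rfl⟩
    exact ⟨F * G, by filter_upwards [hF, hG] with z h1 h2 using h1.mul h2, rfl⟩
  add_mem' := by
    rintro _ _ ⟨F, hF, rfl⟩ ⟨G, hG, rfl⟩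
    exact ⟨F + G, by filter_upwards [hF, hG] with z h1 h2 using h1.add h2, rfl⟩
  algebraMap_mem' := by
    intro r
    refine ⟨fun _ => r, Eventually.of_forall fun z => by fun_prop, ?_⟩
    rw [Algebra.algebraMap_eq_smul_one]
    exact congrArg (fun h : ℂ → ℂ => (h : PGerm)) (by funext z; simp)

/-- The germ in `Loop` of a function that is holomorphic near `0`, away from `0`. -/
def mk (F : ℂ → ℂ) (hF : IsHol F) : Loop := ⟨(F : PGerm), F, hF, rfl⟩

theorem exists_rep (f : Loop) : ∃ (F : ℂ → ℂ) (hF : IsHol F), f = mk F hF := by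
  obtain ⟨_, F, hF, rfl⟩ := f
  exact ⟨F, hF, rfl⟩

theorem mk_eq {F G : ℂ → ℂ} {hF : IsHol F} {hG : IsHol G} :
    mk F hF = mk G hG ↔ F =ᶠ[𝓝[≠] 0] G :=
  Subtype.ext_iff.trans Germ.coe_eq

theorem mk_add {F G : ℂ → ℂ} (hF : IsHol F) (hG : IsHol G) (h : IsHol (F + G)) :
    mk F hF + mk G hG = mk (F + G) h := rfl

theorem mk_mul {F G : ℂ → ℂ} (hF : IsHol F) (hG : IsHol G) (h : IsHol (F * G)) :
    mk F hF * mk G hG = mk (F * G) h := rfl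

theorem smul_mk (c : ℂ) {F : ℂ → ℂ} (hF : IsHol F) (h : IsHol (c • F)) :
    c • mk F hF = mk (c • F) h := rfl

theorem IsHol.add {F G : ℂ → ℂ} (hF : IsHol F) (hG : IsHol G) : IsHol (F + G) := by
  filter_upwards [hF, hG] with z h1 h2 using h1.add h2

theorem IsHol.mul {F G : ℂ → ℂ} (hF : IsHol F) (hG : IsHol G) : IsHol (F * G) := by
  filter_upwards [hF, hG] with z h1 h2 using h1.mul h2

theorem IsHol.smul (c : ℂ) {F : ℂ → ℂ} (hF : IsHol F) : IsHol (c • F) := by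
  filter_upwards [hF] with z h1 using h1.const_smul c

theorem IsHol.exists_radius {F : ℂ → ℂ} (hF : IsHol F) :
    ∃ R : ℝ, 0 < R ∧ ∀ z : ℂ, z ≠ 0 → ‖z‖ < R → DifferentiableAt ℂ F z := by
  rw [IsHol, eventually_nhdsWithin_iff, Metric.eventually_nhds_iff] at hF
  obtain ⟨R, hR, h⟩ := hF
  exact ⟨R, hR, fun z hz hz' => h (by simpa using hz') hz⟩

theorem IsHol.deriv {F : ℂ → ℂ} (hF : IsHol F) : IsHol (deriv F) := by
  obtain ⟨R, hR, h⟩ := hF.exists_radius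
  rw [IsHol, eventually_nhdsWithin_iff, Metric.eventually_nhds_iff]
  refine ⟨R, hR, fun z hz hz0 => ?_⟩
  have hopen : IsOpen {w : ℂ | w ≠ 0 ∧ ‖w‖ < R} :=
    isOpen_ne.inter (isOpen_lt continuous_norm continuous_const)
  have hd : DifferentiableOn ℂ F {w : ℂ | w ≠ 0 ∧ ‖w‖ < R} :=
    fun w hw => (h w hw.1 hw.2).differentiableWithinAt
  exact (hd.deriv hopen).differentiableAt (hopen.mem_nhds ⟨hz0, by simpa using hz⟩)

theorem deriv_congr {F G : ℂ → ℂ} (h : F =ᶠ[𝓝[≠] 0] G) : deriv F =ᶠ[𝓝[≠] 0] deriv G := by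
  have h' := eventually_nhdsNE_eventually_nhds_iff.2 h
  filter_upwards [h'] with z hz using Filter.EventuallyEq.deriv_eq hz

/-- The derivative of a germ. -/
def D : Loop →ₗ[ℂ] Loop where
  toFun f := ⟨Germ.map' deriv (fun _ _ h => deriv_congr h) f.1, by
    obtain ⟨F, hF, rfl⟩ := exists_rep f
    exact ⟨deriv F, hF.deriv, rfl⟩⟩
  map_add' f g := by
    obtain ⟨F, hF, rfl⟩ := exists_rep f
    obtain ⟨G, hG, rfl⟩ := exists_rep g
    refine Subtype.ext (Germ.coe_eq.2 ?_)
    filter_upwards [hF, hG] with z h1 h2 using deriv_add h1 h2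
  map_smul' c f := by
    obtain ⟨F, hF, rfl⟩ := exists_rep f
    refine Subtype.ext (Germ.coe_eq.2 ?_)
    filter_upwards [hF] with z h1 using deriv_const_smul c h1

theorem D_mk {F : ℂ → ℂ} (hF : IsHol F) : D (mk F hF) = mk (deriv F) hF.deriv := rfl

theorem D_mul (f g : Loop) : D (f * g) = D f * g + f * D g := by
  obtain ⟨F, hF, rfl⟩ := exists_rep f
  obtain ⟨G, hG, rfl⟩ := exists_rep g
  refine Subtype.ext (Germ.coe_eq.2 ?_)
  filter_upwards [hF, hG] with z h1 h2 using deriv_mul h1 h2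

/-- The `n`-th Laurent coefficient of a germ at `0` on the punctured plane: the value, for small
`r > 0`, of `(2 π i)⁻¹ ∮_{|z| = r} f(z) z^{-n-1} dz`. -/
def coeffGerm (n : ℤ) (f : PGerm) : ℂ :=
  f.liftOn
    (fun F => limUnder (𝓝[>] (0 : ℝ)) fun r : ℝ =>
      (2 * Real.pi * Complex.I)⁻¹ * ∮ z in C(0, r), F z * z ^ (-n - 1))
    (by
      intro F G h
      have h1 : F =ᶠ[𝓝[≠] 0] G := h
      rw [Filter.EventuallyEq, eventually_nhdsWithin_iff, Metric.eventually_nhds_iff] at h1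
      obtain ⟨R, hR, h2⟩ := h1
      refine congrArg lim (Filter.map_congr ?_)
      filter_upwards [Ioo_mem_nhdsGT hR] with r hr
      congr 1
      refine circleIntegral.integral_congr hr.1.le fun z hz => ?_
      have hz' : ‖z‖ = r := by simpa using hz
      have hz0 : z ≠ 0 := by rintro rfl; simp at hz'; linarith [hr.1]
      simp only [h2 (by simpa [hz'] using hr.2) hz0])

theorem coeffGerm_eq (n : ℤ) {F : ℂ → ℂ} {R : ℝ}
    (hF : ∀ z : ℂ, z ≠ 0 → ‖z‖ < R → DifferentiableAt ℂ F z) {r : ℝ} (h0 : 0 < r) (hr : r < R) :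
    coeffGerm n (F : PGerm) =
      (2 * Real.pi * Complex.I)⁻¹ * ∮ z in C(0, r), F z * z ^ (-n - 1) := by
  have hd : ∀ z : ℂ, z ≠ 0 → ‖z‖ < R → DifferentiableAt ℂ (fun z => F z * z ^ (-n - 1)) z :=
    fun z hz hz' => (hF z hz hz').mul (differentiableAt_zpow.2 (Or.inl hz))
  refine Filter.Tendsto.limUnder_eq (tendsto_const_nhds.congr' ?_)
  filter_upwards [Ioo_mem_nhdsGT h0] with s hs
  congr 1
  refine Complex.circleIntegral_eq_of_differentiable_on_annulus_off_countable hs.1 hs.2.le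
    Set.countable_empty (fun z hz => ?_) (fun z hz => ?_)
  · simp only [Set.mem_sdiff, Metric.mem_closedBall, dist_zero_right, Metric.mem_ball, not_lt] at hz
    refine (hd z ?_ (by linarith)).continuousAt.continuousWithinAt
    rintro rfl; simp at hz; linarith [hs.1]
  · simp only [Set.mem_sdiff, Metric.mem_closedBall, dist_zero_right, Metric.mem_ball, not_le,
      Set.mem_empty_iff_false, not_false_eq_true, and_true] at hz
    refine hd z ?_ (by linarith)
    rintro rfl; simp at hz; linarith [hs.1]

theorem circleIntegrable_aux (n : ℤ) {F : ℂ → ℂ} {R : ℝ}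
    (hF : ∀ z : ℂ, z ≠ 0 → ‖z‖ < R → DifferentiableAt ℂ F z) {r : ℝ} (h0 : 0 < r) (hr : r < R) :
    CircleIntegrable (fun z => F z * z ^ (-n - 1)) 0 r := by
  refine ContinuousOn.circleIntegrable h0.le fun z hz => ?_
  have hz' : ‖z‖ = r := by simpa using hz
  have hz0 : z ≠ 0 := by rintro rfl; simp at hz'; linarith
  exact ((hF z hz0 (by linarith)).mul
    (differentiableAt_zpow.2 (Or.inl hz0))).continuousAt.continuousWithinAt

/-- The `n`-th Laurent coefficient. -/
def coeff (n : ℤ) : Loop →ₗ[ℂ] ℂ where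
  toFun f := coeffGerm n f.1
  map_add' f g := by
    obtain ⟨F, hF, rfl⟩ := exists_rep f
    obtain ⟨G, hG, rfl⟩ := exists_rep g
    obtain ⟨R, hR, h1⟩ := hF.exists_radius
    obtain ⟨S, hS, h2⟩ := hG.exists_radius
    have hT : 0 < min R S / 2 := by positivity
    have hTR : min R S / 2 < R := by have := min_le_left R S; linarith
    have hTS : min R S / 2 < S := by have := min_le_right R S; linarith
    change coeffGerm n ((F + G : ℂ → ℂ) : PGerm) = coeffGerm n (F : PGerm) + coeffGerm n (G : PGerm)
    rw [coeffGerm_eq n h1 hT hTR, coeffGerm_eq n h2 hT hTS,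
      coeffGerm_eq (R := min R S) n (fun z hz hz' => (h1 z hz (hz'.trans_le (min_le_left _ _))).add
        (h2 z hz (hz'.trans_le (min_le_right _ _)))) hT (by linarith), ← mul_add,
      ← circleIntegral.integral_add (circleIntegrable_aux n h1 hT hTR)
        (circleIntegrable_aux n h2 hT hTS)]
    simp [add_mul]
  map_smul' c f := by
    obtain ⟨F, hF, rfl⟩ := exists_rep f
    obtain ⟨R, hR, h1⟩ := hF.exists_radius
    have hT : 0 < R / 2 := by positivity
    change coeffGerm n ((c • F : ℂ → ℂ) : PGerm) = c * coeffGerm n (F : PGerm)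
    rw [coeffGerm_eq n h1 hT (by linarith),
      coeffGerm_eq (R := R) n (fun z hz hz' => (h1 z hz hz').const_smul c) hT (by linarith)]
    simp only [Pi.smul_apply, smul_eq_mul, mul_assoc c]
    rw [circleIntegral.integral_const_mul, mul_left_comm]

/-- The residue at `0`. -/
def res : Loop →ₗ[ℂ] ℂ := coeff (-1)

theorem res_mk {F : ℂ → ℂ} (hF : IsHol F) {R : ℝ}
    (h : ∀ z : ℂ, z ≠ 0 → ‖z‖ < R → DifferentiableAt ℂ F z) {r : ℝ} (h0 : 0 < r) (hr : r < R) :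
    res (mk F hF) = (2 * Real.pi * Complex.I)⁻¹ * ∮ z in C(0, r), F z := by
  refine (coeffGerm_eq (-1) h h0 hr).trans ?_
  simp

theorem res_D (f : Loop) : res (D f) = 0 := by
  obtain ⟨F, hF, rfl⟩ := exists_rep f
  obtain ⟨R, hR, h1⟩ := hF.exists_radius
  obtain ⟨S, hS, h2⟩ := hF.deriv.exists_radius
  have hT : 0 < min R S / 2 := by positivity
  have hTR : min R S / 2 < R := by have := min_le_left R S; linarith
  have hTS : min R S / 2 < S := by have := min_le_right R S; linarith
  rw [D_mk, res_mk _ h2 hT hTS, circleIntegral.integral_eq_zero_of_hasDerivWithinAt hT.le, mul_zero]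
  intro z hz
  have hz' : ‖z‖ = min R S / 2 := by simpa using hz
  have hz0 : z ≠ 0 := by rintro rfl; simp at hz'; linarith
  exact (h1 z hz0 (by linarith)).hasDerivAt.hasDerivWithinAt

theorem tendsto_mul_punctured (γ : ℂˣ) :
    Tendsto (fun z : ℂ => (γ : ℂ) * z) (𝓝[≠] 0) (𝓝[≠] 0) := by
  refine tendsto_nhdsWithin_iff.2 ⟨?_, ?_⟩
  · have : Tendsto (fun z : ℂ => (γ : ℂ) * z) (𝓝 0) (𝓝 ((γ : ℂ) * 0)) :=
      (continuous_const.mul continuous_id).tendsto 0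
    rw [mul_zero] at this
    exact this.mono_left nhdsWithin_le_nhds
  · filter_upwards [self_mem_nhdsWithin] with z hz using mul_ne_zero γ.ne_zero hz

theorem IsHol.rescale {F : ℂ → ℂ} (hF : IsHol F) (γ : ℂˣ) : IsHol fun z => F (γ * z) := by
  filter_upwards [(tendsto_mul_punctured γ).eventually hF] with z hz
  exact DifferentiableAt.comp z hz (by fun_prop)

/-- The rescaling `f(z) ↦ f(γ z)`. -/
def rescale (γ : ℂˣ) : Loop →ₐ[ℂ] Loop where
  toFun f := ⟨f.1.compTendsto (fun z => (γ : ℂ) * z) (tendsto_mul_punctured γ), by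
    obtain ⟨F, hF, rfl⟩ := exists_rep f
    exact ⟨fun z => F (γ * z), hF.rescale γ, rfl⟩⟩
  map_one' := rfl
  map_mul' f g := by
    obtain ⟨F, hF, rfl⟩ := exists_rep f
    obtain ⟨G, hG, rfl⟩ := exists_rep g
    rfl
  map_zero' := rfl
  map_add' f g := by
    obtain ⟨F, hF, rfl⟩ := exists_rep f
    obtain ⟨G, hG, rfl⟩ := exists_rep g
    rfl
  commutes' r := by
    rw [Algebra.algebraMap_eq_smul_one]
    rfl

theorem rescale_mk (γ : ℂˣ) {F : ℂ → ℂ} (hF : IsHol F) :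
    rescale γ (mk F hF) = mk (fun z => F (γ * z)) (hF.rescale γ) := rfl

theorem rescale_one (f : Loop) : rescale 1 f = f := by
  obtain ⟨F, hF, rfl⟩ := exists_rep f
  simp [rescale_mk]

theorem rescale_rescale (γ δ : ℂˣ) (f : Loop) : rescale γ (rescale δ f) = rescale (δ * γ) f := by
  obtain ⟨F, hF, rfl⟩ := exists_rep f
  simp [rescale_mk, mul_assoc]

theorem D_rescale (γ : ℂˣ) (f : Loop) : D (rescale γ f) = (γ : ℂ) • rescale γ (D f) := by
  obtain ⟨F, hF, rfl⟩ := exists_rep f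
  refine Subtype.ext (Germ.coe_eq.2 ?_)
  filter_upwards [(tendsto_mul_punctured γ).eventually hF] with z hz
  have := hz.hasDerivAt.comp z ((hasDerivAt_id z).const_mul (γ : ℂ))
  refine this.deriv.trans ?_
  simp [mul_comm]

theorem res_rescale (γ : ℂˣ) (f : Loop) : res (rescale γ f) = (γ : ℂ)⁻¹ * res f := by
  obtain ⟨F, hF, rfl⟩ := exists_rep f
  obtain ⟨R, hR, h1⟩ := hF.exists_radius
  have hγ : 0 < ‖(γ : ℂ)‖ := norm_pos_iff.2 γ.ne_zero
  have hr : 0 < R / 2 / ‖(γ : ℂ)‖ := by positivity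
  have hr' : R / 2 / ‖(γ : ℂ)‖ < R / ‖(γ : ℂ)‖ := by gcongr; linarith
  have h2 : ∀ z : ℂ, z ≠ 0 → ‖z‖ < R / ‖(γ : ℂ)‖ →
      DifferentiableAt ℂ (fun z => F (γ * z)) z := by
    intro z hz hz'
    rw [lt_div_iff₀ hγ] at hz'
    exact DifferentiableAt.comp z
      (h1 _ (mul_ne_zero γ.ne_zero hz) (by rw [norm_mul]; linarith)) (by fun_prop)
  rw [rescale_mk, res_mk _ h2 hr hr', res_mk hF h1 (r := R / 2) (by positivity) (by linarith),
    mul_left_comm]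
  congr 1
  rw [eq_inv_mul_iff_mul_eq₀ γ.ne_zero, ← circleIntegral.integral_const_mul]
  have key : ∀ θ : ℝ, (γ : ℂ) * circleMap 0 (R / 2 / ‖(γ : ℂ)‖) θ =
      circleMap 0 (R / 2) (θ + Complex.arg γ) := by
    intro θ
    have hn : (‖(γ : ℂ)‖ : ℂ) ≠ 0 := by exact_mod_cast hγ.ne'
    have hp := Complex.norm_mul_exp_arg_mul_I γ
    simp only [circleMap, zero_add]
    push_cast
    rw [add_mul, Complex.exp_add]
    field_simp
    rw [mul_comm Complex.I]
    linear_combination (-(R : ℂ)) * hp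
  simp only [circleIntegral, deriv_circleMap, smul_eq_mul]
  have hper : Function.Periodic
      (fun θ : ℝ => circleMap 0 (R / 2) θ * Complex.I * F (circleMap 0 (R / 2) θ)) (2 * Real.pi) := by
    intro θ; simp only [periodic_circleMap 0 (R / 2) θ]
  have := hper.intervalIntegral_add_eq (Complex.arg γ) 0
  rw [zero_add] at this
  rw [← this]
  have h3 := intervalIntegral.integral_comp_add_right (a := 0) (b := 2 * Real.pi)
    (fun θ : ℝ => circleMap 0 (R / 2) θ * Complex.I * F (circleMap 0 (R / 2) θ)) (Complex.arg γ)
  rw [zero_add, add_comm (2 * Real.pi)] at h3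
  rw [← h3]
  refine intervalIntegral.integral_congr fun θ _ => ?_
  simp only [← key]
  ring

theorem IsHol.exp {F : ℂ → ℂ} (hF : IsHol F) : IsHol fun z => Complex.exp (F z) := by
  filter_upwards [hF] with z hz using hz.cexp

/-- The exponential of a germ, as a homomorphism to the group of germs of holomorphic maps
from punctured discs to `ℂ \ {0}`. -/
def expHom : Multiplicative Loop →* Loopˣ :=
  MonoidHom.toHomUnits
    { toFun := fun f => ⟨(f.toAdd).1.map Complex.exp, by
        obtain ⟨F, hF, h⟩ := exists_rep f.toAdd
        rw [h]
        exact ⟨fun z => Complex.exp (F z), hF.exp, rfl⟩⟩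
      map_one' := Subtype.ext (Germ.coe_eq.2 (Eventually.of_forall fun _ => Complex.exp_zero))
      map_mul' := fun f g => by
        obtain ⟨F, hF, h⟩ := exists_rep f.toAdd
        obtain ⟨G, hG, h'⟩ := exists_rep g.toAdd
        simp only [toAdd_mul, h, h']
        exact Subtype.ext (Germ.coe_eq.2 (Eventually.of_forall fun z => Complex.exp_add _ _)) }

/-- `e ^ f` for a germ `f`. -/
def exp (f : Loop) : Loopˣ := expHom (Multiplicative.ofAdd f)

theorem exp_mk {F : ℂ → ℂ} (hF : IsHol F) :
    (exp (mk F hF) : Loop) = mk (fun z => Complex.exp (F z)) hF.exp := rfl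

theorem exp_add (f g : Loop) : exp (f + g) = exp f * exp g := expHom.map_mul _ _

theorem exp_zero : exp 0 = 1 := expHom.map_one

theorem exp_neg (f : Loop) : exp (-f) = (exp f)⁻¹ := expHom.map_inv _

theorem D_exp (f : Loop) : D (exp f : Loop) = D f * exp f := by
  obtain ⟨F, hF, rfl⟩ := exists_rep f
  refine Subtype.ext (Germ.coe_eq.2 ?_)
  filter_upwards [hF] with z hz
  refine hz.hasDerivAt.cexp.deriv.trans ?_
  simp [mul_comm]

theorem rescale_exp (γ : ℂˣ) (f : Loop) : rescale γ (exp f : Loop) = exp (rescale γ f) := by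
  obtain ⟨F, hF, rfl⟩ := exists_rep f
  rfl

theorem D_eq_of_exp_eq {f g : Loop} (h : exp f = exp g) : D f = D g := by
  have h1 := D_exp f
  rw [h, D_exp g] at h1
  exact ((exp g).isUnit.mul_left_inj.1 h1).symm

/-- The connected component of the identity of the loop group of `GL₁`: the germs `e ^ f`. -/
def L0 : Subgroup Loopˣ := expHom.range

theorem exp_mem_L0 (f : Loop) : exp f ∈ L0 := ⟨_, rfl⟩

/-- A logarithm of an element of `L0`. -/
def log (u : L0) : Loop := Multiplicative.toAdd (Classical.choose u.2)

theorem exp_log (u : L0) : exp (log u) = u := Classical.choose_spec u.2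

theorem D_log {u : L0} {f : Loop} (h : exp f = u) : D (log u) = D f :=
  D_eq_of_exp_eq ((exp_log u).trans h.symm)

/-- The rescaling action on `L0`. -/
def rescaleL0 (γ : ℂˣ) : L0 →* L0 :=
  ((Units.map (rescale γ : Loop →* Loop)).comp L0.subtype).codRestrict L0 (by
    rintro ⟨_, f, rfl⟩
    exact ⟨Multiplicative.ofAdd (rescale γ f.toAdd), Units.ext (rescale_exp γ f.toAdd).symm⟩)

theorem exp_rescale_log (γ : ℂˣ) (u : L0) : exp (rescale γ (log u)) = rescaleL0 γ u := by
  refine Units.ext ((rescale_exp γ (log u)).symm.trans ?_)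
  rw [exp_log]; rfl

theorem rescaleL0_one (u : L0) : rescaleL0 1 u = u :=
  Subtype.ext (Units.ext (rescale_one _))

theorem rescaleL0_rescaleL0 (γ δ : ℂˣ) (u : L0) :
    rescaleL0 γ (rescaleL0 δ u) = rescaleL0 (δ * γ) u :=
  Subtype.ext (Units.ext (rescale_rescale γ δ _))

/-- The residue of `f' g`. -/
def om (f g : Loop) : ℂ := res (D f * g)

theorem om_antisymm (f g : Loop) : om f g = -om g f := by
  have := res_D (f * g)
  rw [D_mul, map_add, mul_comm f] at this
  exact eq_neg_of_add_eq_zero_left this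

theorem om_congr {f f' g g' : Loop} (hf : D f = D f') (hg : D g = D g') : om f g = om f' g' := by
  have h1 : om f g = om f' g := by simp only [om, hf]
  have h2 : om g f' = om g' f' := by simp only [om, hg]
  rw [h1, om_antisymm, h2, ← om_antisymm]

theorem om_add_left (f f' g : Loop) : om (f + f') g = om f g + om f' g := by
  simp [om, add_mul]

theorem om_add_right (f g g' : Loop) : om f (g + g') = om f g + om f g' := by
  simp [om, mul_add]

theorem om_rescale (γ : ℂˣ) (f g : Loop) : om (rescale γ f) (rescale γ g) = om f g := by
  rw [om, D_rescale, smul_mul_assoc, ← map_mul, map_smul, res_rescale, smul_eq_mul,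
    mul_inv_cancel_left₀ γ.ne_zero, om]

theorem om_self (f : Loop) : om f f = 0 := self_eq_neg.1 (om_antisymm f f)

/-- The cocycle `res (d(log u) log v)`; it does not depend on the choice of the logarithms. -/
def cocycle (u v : L0) : ℂ := om (log u) (log v)

theorem cocycle_eq {u v : L0} {f g : Loop} (hf : exp f = u) (hg : exp g = v) :
    cocycle u v = om f g := om_congr (D_log hf) (D_log hg)

theorem cocycle_mul_left (u u' v : L0) : cocycle (u * u') v = cocycle u v + cocycle u' v := by
  rw [cocycle_eq (f := log u + log u') (g := log v) (by rw [exp_add, exp_log, exp_log]; rfl)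
    (exp_log v), om_add_left, cocycle, cocycle]

theorem cocycle_mul_right (u v v' : L0) : cocycle u (v * v') = cocycle u v + cocycle u v' := by
  rw [cocycle_eq (f := log u) (g := log v + log v') (exp_log u)
    (by rw [exp_add, exp_log, exp_log]; rfl), om_add_right, cocycle, cocycle]

theorem cocycle_rescale (γ : ℂˣ) (u v : L0) :
    cocycle (rescaleL0 γ u) (rescaleL0 γ v) = cocycle u v := by
  rw [cocycle_eq (exp_rescale_log γ u) (exp_rescale_log γ v), om_rescale, cocycle]

theorem cocycle_self (u : L0) : cocycle u u = 0 := om_self _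

theorem cocycle_one_left (v : L0) : cocycle 1 v = 0 := by
  have := cocycle_mul_left 1 1 v
  rw [mul_one] at this
  exact left_eq_add.1 this

theorem cocycle_one_right (v : L0) : cocycle v 1 = 0 := by
  have := cocycle_mul_right v 1 1
  rw [mul_one] at this
  exact left_eq_add.1 this

theorem cocycle_inv_left (u v : L0) : cocycle u⁻¹ v = -cocycle u v := by
  have := cocycle_mul_left u⁻¹ u v
  rw [inv_mul_cancel, cocycle_one_left] at this
  exact eq_neg_of_add_eq_zero_left this.symm

/-- The extended loop group `L⁰ × ℂˣ × ℂˣ` of `GL₁`. -/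
@[ext] structure Ghat where
  loop : L0
  Lam : ℂˣ
  Gam : ℂˣ

namespace Ghat

/-- `(u, Λ, Γ) (v, Λ', Γ') = (u(z/Γ') v(zΓ), Λ Λ' exp (res (d(log u(z/Γ')) log v(zΓ))), Γ Γ')`. -/
instance : Mul Ghat where
  mul x y :=
    { loop := rescaleL0 y.Gam⁻¹ x.loop * rescaleL0 x.Gam y.loop
      Lam := x.Lam * y.Lam * Units.mk0
        (Complex.exp (cocycle (rescaleL0 y.Gam⁻¹ x.loop) (rescaleL0 x.Gam y.loop)))
        (Complex.exp_ne_zero _)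
      Gam := x.Gam * y.Gam }

instance : One Ghat := ⟨⟨1, 1, 1⟩⟩

instance : Inv Ghat := ⟨fun x => ⟨x.loop⁻¹, x.Lam⁻¹, x.Gam⁻¹⟩⟩

theorem mul_loop (x y : Ghat) :
    (x * y).loop = rescaleL0 y.Gam⁻¹ x.loop * rescaleL0 x.Gam y.loop := rfl

theorem mul_Lam (x y : Ghat) : ((x * y).Lam : ℂ) = x.Lam * y.Lam *
    Complex.exp (cocycle (rescaleL0 y.Gam⁻¹ x.loop) (rescaleL0 x.Gam y.loop)) := rfl

theorem mul_Gam (x y : Ghat) : (x * y).Gam = x.Gam * y.Gam := rfl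

theorem one_loop : (1 : Ghat).loop = 1 := rfl
theorem one_Lam : (1 : Ghat).Lam = 1 := rfl
theorem one_Gam : (1 : Ghat).Gam = 1 := rfl
theorem inv_loop (x : Ghat) : x⁻¹.loop = x.loop⁻¹ := rfl
theorem inv_Lam (x : Ghat) : x⁻¹.Lam = x.Lam⁻¹ := rfl
theorem inv_Gam (x : Ghat) : x⁻¹.Gam = x.Gam⁻¹ := rfl

protected theorem mul_assoc (x y w : Ghat) : x * y * w = x * (y * w) := by
  obtain ⟨u, a, p⟩ := x
  obtain ⟨v, b, q⟩ := y
  obtain ⟨t, c, r⟩ := w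
  have h1 : rescaleL0 r⁻¹ (rescaleL0 q⁻¹ u) = rescaleL0 (q * r)⁻¹ u := by
    rw [rescaleL0_rescaleL0, mul_inv]
  have h2 : rescaleL0 r⁻¹ (rescaleL0 p v) = rescaleL0 p (rescaleL0 r⁻¹ v) := by
    rw [rescaleL0_rescaleL0, rescaleL0_rescaleL0, mul_comm]
  have h3 : rescaleL0 p (rescaleL0 q t) = rescaleL0 (p * q) t := by
    rw [rescaleL0_rescaleL0, mul_comm]
  refine Ghat.ext ?_ (Units.ext ?_) (mul_assoc p q r)
  · change rescaleL0 r⁻¹ (rescaleL0 q⁻¹ u * rescaleL0 p v) * rescaleL0 (p * q) t =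
      rescaleL0 (q * r)⁻¹ u * rescaleL0 p (rescaleL0 r⁻¹ v * rescaleL0 q t)
    rw [map_mul, map_mul, h1, h2, h3, mul_assoc]
  · change (a : ℂ) * b * Complex.exp (cocycle (rescaleL0 q⁻¹ u) (rescaleL0 p v)) * c *
        Complex.exp (cocycle (rescaleL0 r⁻¹ (rescaleL0 q⁻¹ u * rescaleL0 p v))
          (rescaleL0 (p * q) t)) =
      a * (b * c * Complex.exp (cocycle (rescaleL0 r⁻¹ v) (rescaleL0 q t))) *
        Complex.exp (cocycle (rescaleL0 (q * r)⁻¹ u)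
          (rescaleL0 p (rescaleL0 r⁻¹ v * rescaleL0 q t)))
    have h4 : cocycle (rescaleL0 q⁻¹ u) (rescaleL0 p v) =
        cocycle (rescaleL0 (q * r)⁻¹ u) (rescaleL0 p (rescaleL0 r⁻¹ v)) := by
      rw [← h1, ← h2, cocycle_rescale]
    have h5 : cocycle (rescaleL0 r⁻¹ v) (rescaleL0 q t) =
        cocycle (rescaleL0 p (rescaleL0 r⁻¹ v)) (rescaleL0 (p * q) t) := by
      rw [← h3, cocycle_rescale]
    rw [map_mul, map_mul, h1, h2, h3, cocycle_mul_left, cocycle_mul_right, h4, h5,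
      Complex.exp_add, Complex.exp_add]
    generalize Complex.exp (cocycle (rescaleL0 (q * r)⁻¹ u) (rescaleL0 p (rescaleL0 r⁻¹ v))) = e1
    generalize Complex.exp (cocycle (rescaleL0 p (rescaleL0 r⁻¹ v)) (rescaleL0 (p * q) t)) = e2
    generalize Complex.exp (cocycle (rescaleL0 (q * r)⁻¹ u) (rescaleL0 (p * q) t)) = e3
    ring

protected theorem one_mul (x : Ghat) : 1 * x = x := by
  refine Ghat.ext ?_ (Units.ext ?_) (one_mul _)
  · rw [mul_loop, one_loop, one_Gam, map_one, one_mul, rescaleL0_one]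
  · rw [mul_Lam, one_loop, one_Lam, map_one, cocycle_one_left, Complex.exp_zero, mul_one,
      Units.val_one, one_mul]

protected theorem inv_mul_cancel (x : Ghat) : x⁻¹ * x = 1 := by
  refine Ghat.ext ?_ (Units.ext ?_) (inv_mul_cancel _)
  · rw [mul_loop, inv_loop, inv_Gam, map_inv, inv_mul_cancel, one_loop]
  · rw [mul_Lam, inv_loop, inv_Gam, inv_Lam, map_inv, cocycle_inv_left, cocycle_self, neg_zero,
      Complex.exp_zero, mul_one, ← Units.val_mul, inv_mul_cancel, one_Lam]

instance : Group Ghat :=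
  Group.ofLeftAxioms Ghat.mul_assoc Ghat.one_mul Ghat.inv_mul_cancel

end Ghat

/-- `f` is the germ of the function `F`, holomorphic around `0`. -/
def IsPlus (F : ℂ → ℂ) (f : Loop) : Prop := AnalyticAt ℂ F 0 ∧ (f : PGerm) = (F : PGerm)

/-- `f` is the germ of a function holomorphic on the projective line minus `0`; this function
is `F` in the coordinate `1 / z`, in particular its value at infinity is `F 0`. -/
def IsMinus (F : ℂ → ℂ) (f : Loop) : Prop :=
  Differentiable ℂ F ∧ (f : PGerm) = ((fun z => F z⁻¹ : ℂ → ℂ) : PGerm)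

theorem AnalyticAt.isHol {F : ℂ → ℂ} (h : AnalyticAt ℂ F 0) : IsHol F :=
  (h.eventually_analyticAt.mono fun _ hz => hz.differentiableAt).filter_mono nhdsWithin_le_nhds

theorem isHol_inv {F : ℂ → ℂ} (h : Differentiable ℂ F) : IsHol fun z => F z⁻¹ := by
  filter_upwards [self_mem_nhdsWithin] with z hz
  exact DifferentiableAt.comp z (h _) (differentiableAt_inv hz)

theorem IsPlus.eq_mk {F : ℂ → ℂ} {f : Loop} (h : IsPlus F f) : f = mk F (AnalyticAt.isHol h.1) :=
  Subtype.ext h.2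

theorem IsMinus.eq_mk {F : ℂ → ℂ} {f : Loop} (h : IsMinus F f) :
    f = mk (fun z => F z⁻¹) (isHol_inv h.1) := Subtype.ext h.2

theorem IsPlus.add {F G : ℂ → ℂ} {f g : Loop} (hf : IsPlus F f) (hg : IsPlus G g) :
    IsPlus (F + G) (f + g) := ⟨hf.1.add hg.1, by rw [hf.eq_mk, hg.eq_mk]; rfl⟩

theorem IsPlus.mul {F G : ℂ → ℂ} {f g : Loop} (hf : IsPlus F f) (hg : IsPlus G g) :
    IsPlus (F * G) (f * g) := ⟨hf.1.mul hg.1, by rw [hf.eq_mk, hg.eq_mk]; rfl⟩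

theorem IsPlus.smul {F : ℂ → ℂ} {f : Loop} (c : ℂ) (hf : IsPlus F f) :
    IsPlus (c • F) (c • f) := ⟨hf.1.const_smul, by rw [hf.eq_mk]; rfl⟩

theorem IsPlus.rescale {F : ℂ → ℂ} {f : Loop} (γ : ℂˣ) (hf : IsPlus F f) :
    IsPlus (fun z => F (γ * z)) (rescale γ f) := by
  refine ⟨?_, by rw [hf.eq_mk]; rfl⟩
  refine AnalyticAt.fun_comp (g := F) (f := fun z : ℂ => (γ : ℂ) * z) ?_ (by fun_prop)
  simpa using hf.1

theorem IsPlus.exp {F : ℂ → ℂ} {f : Loop} (hf : IsPlus F f) :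
    IsPlus (fun z => Complex.exp (F z)) (exp f : Loop) := ⟨hf.1.cexp, by rw [hf.eq_mk]; rfl⟩

theorem IsMinus.add {F G : ℂ → ℂ} {f g : Loop} (hf : IsMinus F f) (hg : IsMinus G g) :
    IsMinus (F + G) (f + g) := ⟨hf.1.add hg.1, by rw [hf.eq_mk, hg.eq_mk]; rfl⟩

theorem IsMinus.mul {F G : ℂ → ℂ} {f g : Loop} (hf : IsMinus F f) (hg : IsMinus G g) :
    IsMinus (F * G) (f * g) := ⟨hf.1.mul hg.1, by rw [hf.eq_mk, hg.eq_mk]; rfl⟩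

theorem IsMinus.smul {F : ℂ → ℂ} {f : Loop} (c : ℂ) (hf : IsMinus F f) :
    IsMinus (c • F) (c • f) := ⟨hf.1.const_smul c, by rw [hf.eq_mk]; rfl⟩

theorem IsMinus.rescale {F : ℂ → ℂ} {f : Loop} (γ : ℂˣ) (hf : IsMinus F f) :
    IsMinus (fun z => F ((γ : ℂ)⁻¹ * z)) (rescale γ f) := by
  refine ⟨hf.1.comp (by fun_prop), ?_⟩
  rw [hf.eq_mk]
  exact Germ.coe_eq.2 (Eventually.of_forall fun z => by simp [mul_comm])

theorem IsMinus.exp {F : ℂ → ℂ} {f : Loop} (hf : IsMinus F f) :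
    IsMinus (fun z => Complex.exp (F z)) (exp f : Loop) := ⟨hf.1.cexp, by rw [hf.eq_mk]; rfl⟩

theorem D_log_mul (u : L0) : D (log u) * (u : Loopˣ) = D ((u : Loopˣ) : Loop) := by
  have := D_exp (log u)
  rw [exp_log] at this
  exact this.symm

theorem exists_primitive_plus {G : ℂ → ℂ} (h : AnalyticAt ℂ G 0) :
    ∃ (P : ℂ → ℂ) (hP : AnalyticAt ℂ P 0),
      mk G (AnalyticAt.isHol h) = D (mk P (AnalyticAt.isHol hP)) := by
  obtain ⟨R, hR, hG⟩ := Metric.eventually_nhds_iff.1 h.eventually_analyticAt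
  have hd : DifferentiableOn ℂ G (Metric.ball 0 R) :=
    fun z hz => (hG hz).differentiableAt.differentiableWithinAt
  obtain ⟨P, hP⟩ := hd.isExactOn_ball
  have hmem : Metric.ball (0 : ℂ) R ∈ 𝓝 0 := Metric.ball_mem_nhds _ hR
  refine ⟨P, (DifferentiableOn.analyticAt
    (fun z hz => (hP z hz).differentiableAt.differentiableWithinAt) hmem), ?_⟩
  refine Subtype.ext (Germ.coe_eq.2 ?_)
  filter_upwards [nhdsWithin_le_nhds hmem] with z hz using (hP z hz).deriv.symm

theorem exists_primitive_minus {G : ℂ → ℂ} (h : Differentiable ℂ G) :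
    ∃ (P : ℂ → ℂ) (_ : Differentiable ℂ P), ∀ z, HasDerivAt P (G z) z := by
  obtain ⟨P, hP⟩ := h.isExactOn_univ
  exact ⟨P, fun z => (hP z trivial).differentiableAt, fun z => hP z trivial⟩

theorem D_minus {P G : ℂ → ℂ} (hP : ∀ z, HasDerivAt P (G z) z) (h : IsHol fun z => P z⁻¹)
    (h' : IsHol fun z => -(z ^ 2)⁻¹ * G z⁻¹) :
    D (mk (fun z => P z⁻¹) h) = mk (fun z => -(z ^ 2)⁻¹ * G z⁻¹) h' := by
  refine Subtype.ext (Germ.coe_eq.2 ?_)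
  filter_upwards [self_mem_nhdsWithin] with z hz
  have := (hP z⁻¹).comp z (hasDerivAt_inv hz)
  refine this.deriv.trans (mul_comm _ _)

theorem isHol_aux {G : ℂ → ℂ} (h : Differentiable ℂ G) : IsHol fun z => -(z ^ 2)⁻¹ * G z⁻¹ := by
  filter_upwards [self_mem_nhdsWithin, isHol_inv h] with z hz h1
  refine DifferentiableAt.mul ?_ h1
  exact ((differentiableAt_id.pow 2).inv (pow_ne_zero 2 hz)).neg

theorem D_log_plus {u : L0} {F : ℂ → ℂ} (h : IsPlus F (u : Loopˣ)) (h0 : F 0 ≠ 0) :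
    ∃ (P : ℂ → ℂ) (hP : AnalyticAt ℂ P 0), D (log u) = D (mk P (AnalyticAt.isHol hP)) := by
  have hq : AnalyticAt ℂ (fun z => deriv F z / F z) 0 := h.1.deriv.div h.1 h0
  obtain ⟨P, hP, e⟩ := exists_primitive_plus hq
  refine ⟨P, hP, ?_⟩
  rw [← e]
  refine (u : Loopˣ).isUnit.mul_left_injective ?_
  simp only
  rw [D_log_mul, h.eq_mk, D_mk]
  refine Subtype.ext (Germ.coe_eq.2 ?_)
  filter_upwards [nhdsWithin_le_nhds (h.1.continuousAt.eventually_ne h0)] with z hz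
  exact (div_mul_cancel₀ _ hz).symm

theorem D_log_minus {u : L0} {F : ℂ → ℂ} (h : IsMinus F (u : Loopˣ)) (h0 : ∀ w, F w ≠ 0) :
    ∃ (P : ℂ → ℂ) (hP : Differentiable ℂ P), D (log u) = D (mk (fun z => P z⁻¹) (isHol_inv hP)) := by
  have hq : Differentiable ℂ (fun z => deriv F z / F z) := h.1.deriv.div h.1 h0
  obtain ⟨P, hP, e⟩ := exists_primitive_minus hq
  refine ⟨P, hP, ?_⟩
  rw [D_minus e _ (isHol_aux hq)]
  refine (u : Loopˣ).isUnit.mul_left_injective ?_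
  simp only
  rw [D_log_mul, h.eq_mk, D_minus (fun z => (h.1 z).hasDerivAt) _ (isHol_aux h.1.deriv)]
  refine Subtype.ext (Germ.coe_eq.2 (Eventually.of_forall fun z => ?_))
  change -(z ^ 2)⁻¹ * deriv F z⁻¹ = -(z ^ 2)⁻¹ * (deriv F z⁻¹ / F z⁻¹) * F z⁻¹
  rw [mul_assoc, div_mul_cancel₀ _ (h0 _)]

theorem cocycle_plus {u v : L0} {F G : ℂ → ℂ} (hu : IsPlus F (u : Loopˣ)) (hF : F 0 ≠ 0)
    (hv : IsPlus G (v : Loopˣ)) (hG : G 0 ≠ 0) : cocycle u v = 0 := by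
  obtain ⟨P, hP, e1⟩ := D_log_plus hu hF
  obtain ⟨Q, hQ, e2⟩ := D_log_plus hv hG
  rw [cocycle, om_congr e1 e2, om, D_mk]
  obtain ⟨S, hS, e3⟩ := exists_primitive_plus (hP.deriv.mul hQ)
  exact (congrArg res e3).trans (res_D _)

theorem cocycle_minus {u v : L0} {F G : ℂ → ℂ} (hu : IsMinus F (u : Loopˣ)) (hF : ∀ w, F w ≠ 0)
    (hv : IsMinus G (v : Loopˣ)) (hG : ∀ w, G w ≠ 0) : cocycle u v = 0 := by
  obtain ⟨P, hP, e1⟩ := D_log_minus hu hF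
  obtain ⟨Q, hQ, e2⟩ := D_log_minus hv hG
  rw [cocycle, om_congr e1 e2, om, D_minus (fun z => (hP z).hasDerivAt) _ (isHol_aux hP.deriv)]
  obtain ⟨S, hS, e3⟩ := exists_primitive_minus (hP.deriv.mul hQ)
  have := res_D (mk (fun z => S z⁻¹) (isHol_inv hS))
  rw [D_minus e3 _ (isHol_aux (hP.deriv.mul hQ))] at this
  refine Eq.trans (congrArg res ?_) this
  refine Subtype.ext (Germ.coe_eq.2 (Eventually.of_forall fun z => ?_))
  simp [mul_assoc]

/-- The Lie algebra `𝔏 ⊕ ℂ c ⊕ ℂ d` of `Ghat`; `(f, a, b)` is `f + a c + b d`. -/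
abbrev ghat : Type := Loop × ℂ × ℂ

/-- The group `H` of the pairs `((f₊, Λ, Γ), (f₋, Λ⁻¹, Γ⁻¹))`, where `f₊` and `f₋` lie in the
identity component and are holomorphic maps to `ℂ \ {0}` around `0`, resp. on the projective line
minus `0`, such that `f₊(0) = f₋(∞)⁻¹`. -/
def H : Subgroup (Ghat × Ghat) where
  carrier := {x | x.1.Lam * x.2.Lam = 1 ∧ x.1.Gam * x.2.Gam = 1 ∧
    ∃ F G : ℂ → ℂ, IsPlus F (x.1.loop : Loopˣ) ∧ IsMinus G (x.2.loop : Loopˣ) ∧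
      (∀ w, G w ≠ 0) ∧ F 0 * G 0 = 1}
  mul_mem' := by
    rintro ⟨x, x'⟩ ⟨y, y'⟩ ⟨h1, h2, F, G, hF, hG, h0, h3⟩ ⟨k1, k2, F', G', hF', hG', k0, k3⟩
    have e1 : IsPlus _ ((rescaleL0 y.Gam⁻¹ x.loop : L0) : Loopˣ) := hF.rescale y.Gam⁻¹
    have e2 : IsPlus _ ((rescaleL0 x.Gam y.loop : L0) : Loopˣ) := hF'.rescale x.Gam
    have e3 : IsMinus _ ((rescaleL0 y'.Gam⁻¹ x'.loop : L0) : Loopˣ) := hG.rescale y'.Gam⁻¹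
    have e4 : IsMinus _ ((rescaleL0 x'.Gam y'.loop : L0) : Loopˣ) := hG'.rescale x'.Gam
    refine ⟨?_, ?_, _, _, e1.mul e2, e3.mul e4, fun w => mul_ne_zero (h0 _) (k0 _), ?_⟩
    · have hne : F 0 ≠ 0 := left_ne_zero_of_mul_eq_one h3
      have kne : F' 0 ≠ 0 := left_ne_zero_of_mul_eq_one k3
      have c1 : cocycle (rescaleL0 y.Gam⁻¹ x.loop) (rescaleL0 x.Gam y.loop) = 0 :=
        cocycle_plus e1 (by simpa using hne) e2 (by simpa using kne)
      have c2 : cocycle (rescaleL0 y'.Gam⁻¹ x'.loop) (rescaleL0 x'.Gam y'.loop) = 0 :=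
        cocycle_minus e3 (fun w => h0 _) e4 (fun w => k0 _)
      refine Units.ext ?_
      have h1' : (x.Lam : ℂ) * x'.Lam = 1 := congrArg Units.val h1
      have k1' : (y.Lam : ℂ) * y'.Lam = 1 := congrArg Units.val k1
      change ((x * y).Lam : ℂ) * (x' * y').Lam = 1
      rw [Ghat.mul_Lam, Ghat.mul_Lam, c1, c2, Complex.exp_zero, mul_one, mul_one,
        mul_mul_mul_comm, h1', k1', one_mul]
    · change x.Gam * y.Gam * (x'.Gam * y'.Gam) = 1
      change x.Gam * x'.Gam = 1 at h2
      change y.Gam * y'.Gam = 1 at k2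
      rw [mul_mul_mul_comm, h2, k2, one_mul]
    · simp only [Pi.mul_apply, mul_zero]
      rw [mul_mul_mul_comm, h3, k3, one_mul]
  one_mem' := by
    refine ⟨mul_one _, mul_one _, fun _ => 1, fun _ => 1, ⟨analyticAt_const, rfl⟩,
      ⟨differentiable_const _, rfl⟩, fun _ => one_ne_zero, mul_one _⟩
  inv_mem' := by
    rintro ⟨x, x'⟩ ⟨h1, h2, F, G, hF, hG, h0, h3⟩
    have hne : F 0 ≠ 0 := left_ne_zero_of_mul_eq_one h3
    refine ⟨?_, ?_, F⁻¹, G⁻¹, ⟨hF.1.inv hne, ?_⟩, ⟨hG.1.inv h0, ?_⟩, fun w => inv_ne_zero (h0 w), ?_⟩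
    · change x.Lam⁻¹ * x'.Lam⁻¹ = 1
      change x.Lam * x'.Lam = 1 at h1
      rw [← mul_inv, h1, inv_one]
    · change x.Gam⁻¹ * x'.Gam⁻¹ = 1
      change x.Gam * x'.Gam = 1 at h2
      rw [← mul_inv, h2, inv_one]
    · have hh : IsHol F⁻¹ := AnalyticAt.isHol (hF.1.inv hne)
      have : (((x.loop : Loopˣ)⁻¹ : Loopˣ) : Loop) = mk F⁻¹ hh := by
        refine Units.inv_eq_of_mul_eq_one_right ?_
        rw [hF.eq_mk]
        refine Subtype.ext (Germ.coe_eq.2 ?_)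
        filter_upwards [nhdsWithin_le_nhds (hF.1.continuousAt.eventually_ne hne)] with z hz
        exact mul_inv_cancel₀ hz
      exact congrArg Subtype.val this
    · have hh : IsHol fun z => G⁻¹ z⁻¹ := isHol_inv (hG.1.inv h0)
      have : (((x'.loop : Loopˣ)⁻¹ : Loopˣ) : Loop) = mk (fun z => G⁻¹ z⁻¹) hh := by
        refine Units.inv_eq_of_mul_eq_one_right ?_
        rw [hG.eq_mk]
        exact Subtype.ext (Germ.coe_eq.2 (Eventually.of_forall fun z => mul_inv_cancel₀ (h0 _)))
      exact congrArg Subtype.val this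
    · change (F 0)⁻¹ * (G 0)⁻¹ = 1
      rw [← mul_inv, h3, inv_one]

/-- The Lie algebra of `H`: the pairs `(a + λ c + μ d, b - λ c - μ d)`, where `a` is holomorphic
around `0`, `b` is holomorphic on the projective line minus `0` and `a(0) = -b(∞)`. -/
def hLie : Submodule ℂ (ghat × ghat) where
  carrier := {x | x.2.2 = -x.1.2 ∧
    ∃ F G : ℂ → ℂ, IsPlus F x.1.1 ∧ IsMinus G x.2.1 ∧ F 0 = -G 0}
  add_mem' := by
    rintro x y ⟨h1, F, G, hF, hG, h2⟩ ⟨k1, F', G', hF', hG', k2⟩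
    refine ⟨?_, _, _, hF.add hF', hG.add hG', ?_⟩
    · change x.2.2 + y.2.2 = -(x.1.2 + y.1.2)
      rw [h1, k1, neg_add]
    · change F 0 + F' 0 = -(G 0 + G' 0)
      rw [h2, k2, neg_add]
  zero_mem' := ⟨neg_zero.symm, fun _ => 0, fun _ => 0, ⟨analyticAt_const, rfl⟩,
      ⟨differentiable_const _, rfl⟩, neg_zero.symm⟩
  smul_mem' := by
    rintro c x ⟨h1, F, G, hF, hG, h2⟩
    refine ⟨?_, _, _, hF.smul c, hG.smul c, ?_⟩
    · change c • x.2.2 = -(c • x.1.2)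
      rw [h1, smul_neg]
    · change c • F 0 = -(c • G 0)
      rw [h2, smul_neg]

/-- The diagonal Lie subalgebra. -/
def kLie : Submodule ℂ (ghat × ghat) where
  carrier := {x | x.1 = x.2}
  add_mem' := by
    rintro x y (hx : x.1 = x.2) (hy : y.1 = y.2)
    change x.1 + y.1 = x.2 + y.2
    rw [hx, hy]
  zero_mem' := rfl
  smul_mem' := by
    rintro c x (hx : x.1 = x.2)
    change c • x.1 = c • x.2
    rw [hx]

/-- The invariant form on `ghat`: `(f, g) = res (f g dz / z)`, the constant term of `f g`,
`(c, d) = 1`, and the other pairings vanish. -/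
def form (X Y : ghat) : ℂ := coeff 0 (X.1 * Y.1) + X.2.1 * Y.2.2 + X.2.2 * Y.2.1

/-- The form `⟨a ⊕ b, a' ⊕ b'⟩ = (a, a') - (b, b')` on `ghat × ghat`. -/
def form₂ (X Y : ghat × ghat) : ℂ := form X.1 Y.1 - form X.2 Y.2

/-- The path `t ↦ (e ^ (t f), e ^ (t a), e ^ (t b))` in `Ghat`, whose velocity at `t = 0` is
`f + a c + b d`. -/
def path (X : ghat) (t : ℂ) : Ghat where
  loop := ⟨exp (t • X.1), exp_mem_L0 _⟩
  Lam := Units.mk0 (Complex.exp (t * X.2.1)) (Complex.exp_ne_zero _)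
  Gam := Units.mk0 (Complex.exp (t * X.2.2)) (Complex.exp_ne_zero _)

/-- The path in `H` with velocity `ξ` at `t = 0`. -/
def pathH (ξ : hLie) (t : ℂ) : H :=
  ⟨(path ξ.1.1 t, path ξ.1.2 t), by
    obtain ⟨⟨X, Y⟩, h1, F, G, hF, hG, h2⟩ := ξ
    have a1 : Y.2.1 = -X.2.1 := congrArg Prod.fst h1
    have a2 : Y.2.2 = -X.2.2 := congrArg Prod.snd h1
    have a3 : F 0 = -G 0 := h2
    refine ⟨Units.ext ?_, Units.ext ?_, _, _, (hF.smul t).exp, (hG.smul t).exp,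
      fun w => Complex.exp_ne_zero _, ?_⟩
    · change Complex.exp (t * X.2.1) * Complex.exp (t * Y.2.1) = 1
      rw [← Complex.exp_add, a1, mul_neg, add_neg_cancel, Complex.exp_zero]
    · change Complex.exp (t * X.2.2) * Complex.exp (t * Y.2.2) = 1
      rw [← Complex.exp_add, a2, mul_neg, add_neg_cancel, Complex.exp_zero]
    · change Complex.exp (t • F 0) * Complex.exp (t • G 0) = 1
      rw [← Complex.exp_add, a3, smul_neg, neg_add_cancel, Complex.exp_zero]⟩

/-- The path `p` in `Ghat` starts at the identity with velocity `X` at `t = 0`. The loop component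
is read in the exponential chart, where the derivative is taken on every Laurent coefficient. -/
def HasVelocity (p : ℂ → Ghat) (X : ghat) : Prop :=
  p 0 = 1 ∧
  (∃ f : ℂ → Loop, f 0 = 0 ∧ (∀ t, exp (f t) = (p t).loop) ∧
    ∀ n : ℤ, HasDerivAt (fun t => coeff n (f t)) (coeff n X.1) 0) ∧
  HasDerivAt (fun t => ((p t).Lam : ℂ)) X.2.1 0 ∧
  HasDerivAt (fun t => ((p t).Gam : ℂ)) X.2.2 0

/-- `Y = Ad(x) X` in `ghat`: `Y` is the velocity at `t = 0` of the conjugate by `x` of the path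
with velocity `X`. -/
def IsAd (x : Ghat) (X Y : ghat) : Prop := HasVelocity (fun t => x * path X t * x⁻¹) Y

/-- `Y = Ad(x) X` in `ghat × ghat`. -/
def IsAd₂ (x : Ghat × Ghat) (X Y : ghat × ghat) : Prop := IsAd x.1 X.1 Y.1 ∧ IsAd x.2 X.2 Y.2

/-- The element `X` of the diagonal subalgebra, considered as a linear form on the Lie algebra of
`H` by means of `form₂`, is the differential of `F` at `h`, translated to the identity by the left
translation `g ↦ h g`. -/
def IsDiff (F : H → ℂ) (h : H) (X : ghat × ghat) : Prop :=
  X ∈ kLie ∧ ∀ ξ : hLie, HasDerivAt (fun t => F (h * pathH ξ t)) (form₂ X ξ) 0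

/-- `v` is the value at `h` of the Poisson bracket of `F₁` and `F₂` given by the Manin triple:
`v = ⟨Ad(h⁻¹) π (Ad(h) X₁), X₂⟩`, where `Xᵢ` is the translated differential of `Fᵢ` at `h` and
`π` is the projection to the Lie algebra of `H` along the diagonal (so that `Z = π Y` means that
`Z` is in the Lie algebra of `H` and `Y - Z` is in the diagonal). -/
def IsBracketAt (F₁ F₂ : H → ℂ) (h : H) (v : ℂ) : Prop :=
  ∃ X₁ X₂ Y Z W : ghat × ghat, IsDiff F₁ h X₁ ∧ IsDiff F₂ h X₂ ∧
    IsAd₂ h X₁ Y ∧ Z ∈ hLie ∧ Y - Z ∈ kLie ∧ IsAd₂ (h : Ghat × Ghat)⁻¹ Z W ∧ v = form₂ W X₂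

/-- `k(h) = f₊(0)`. -/
def kFun (h : H) : ℂ := coeff 0 (h.1.1.loop : Loopˣ)

/-- `Λ(h)`. -/
def lamFun (h : H) : ℂ := h.1.1.Lam

/-- `Γ(h)`. -/
def gamFun (h : H) : ℂ := h.1.1.Gam

/-- `h_m(h)`: the coefficient of `z ^ m` in a logarithm of `f₊` if `m > 0`, of `f₋` if `m < 0`. -/
def hFun (m : {m : ℤ // m ≠ 0}) (h : H) : ℂ :=
  if 0 < m.1 then coeff m (log h.1.1.loop) else coeff m (log h.1.2.loop)

/-- The ring `ℂ[H]` of functions on `H` generated by `k^{±1}`, `Λ^{±1}`, `Γ^{±1}` and `h_m`. -/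
def CH : Subalgebra ℂ (H → ℂ) :=
  Algebra.adjoin ℂ ({kFun, kFun⁻¹, lamFun, lamFun⁻¹, gamFun, gamFun⁻¹} ∪ Set.range hFun)

end GL1Loop

namespace Heisenberg

/-- The field `ℂ(q)`. -/
abbrev Kq : Type := RatFunc ℂ

/-- The variable `q`. -/
abbrev q : Kq := RatFunc.X

/-- The generators of the quantum Heisenberg algebra. -/
inductive Gen : Type
  | h (m : {m : ℤ // m ≠ 0})
  | Lam | LamInv | Gam | GamInv | k | kInv

/-- The quantum integer `[m]_q`. -/
def qint (m : ℤ) : Kq := (q ^ m - q ^ (-m)) / (q - q⁻¹)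

/-- The free algebra on the generators. -/
abbrev Free : Type := FreeAlgebra Kq Gen

abbrev gen (x : Gen) : Free := FreeAlgebra.ι Kq x

/-- `x ^ n` for an integer `n`, written with `x` and its inverse `y`. -/
def zp {A : Type*} [Monoid A] (x y : A) (n : ℤ) : A := x ^ n.toNat * y ^ (-n).toNat

/-- The defining relations. -/
inductive Rel : Free → Free → Prop
  | Lam_mul : Rel (gen .Lam * gen .LamInv) 1
  | mul_Lam : Rel (gen .LamInv * gen .Lam) 1
  | Gam_mul : Rel (gen .Gam * gen .GamInv) 1
  | mul_Gam : Rel (gen .GamInv * gen .Gam) 1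
  | k_mul : Rel (gen .k * gen .kInv) 1
  | mul_k : Rel (gen .kInv * gen .k) 1
  | Gam_central (x : Gen) : Rel (gen .Gam * gen x) (gen x * gen .Gam)
  | k_central (x : Gen) : Rel (gen .k * gen x) (gen x * gen .k)
  | h_h (m n : {m : ℤ // m ≠ 0}) : Rel (gen (.h m) * gen (.h n) - gen (.h n) * gen (.h m))
      (if m.1 = -n.1 then (qint m / ((m : ℤ) : Kq) / (q - q⁻¹)) •
        (zp (gen .Gam) (gen .GamInv) (2 * m) - zp (gen .Gam) (gen .GamInv) (-(2 * m))) else 0)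
  | h_Lam (m : {m : ℤ // m ≠ 0}) :
      Rel (gen (.h m) * gen .Lam) (q ^ (2 * m.1) • (gen .Lam * gen (.h m)))

/-- The quantum Heisenberg algebra `U_q(ĝl₁)` over `ℂ(q)`. -/
def Uq : Type := RingQuot Rel

instance : Ring Uq := inferInstanceAs (Ring (RingQuot Rel))
instance : Algebra Kq Uq := inferInstanceAs (Algebra Kq (RingQuot Rel))
instance : Algebra ℂ Uq := inferInstanceAs (Algebra ℂ (RingQuot Rel))
instance : IsScalarTower ℂ Kq Uq := inferInstanceAs (IsScalarTower ℂ Kq (RingQuot Rel))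

/-- The projection from the free algebra. -/
def proj : Free →ₐ[Kq] Uq := RingQuot.mkAlgHom Kq Rel

theorem proj_rel {x y : Free} (h : Rel x y) : proj x = proj y := RingQuot.mkAlgHom_rel Kq h

/-- The generators of `Uq`. -/
def u (x : Gen) : Uq := proj (gen x)

theorem u_Lam_mul : u .Lam * u .LamInv = 1 := by
  simpa [u] using proj_rel Rel.Lam_mul
theorem u_mul_Lam : u .LamInv * u .Lam = 1 := by
  simpa [u] using proj_rel Rel.mul_Lam
theorem u_Gam_mul : u .Gam * u .GamInv = 1 := by
  simpa [u] using proj_rel Rel.Gam_mul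
theorem u_mul_Gam : u .GamInv * u .Gam = 1 := by
  simpa [u] using proj_rel Rel.mul_Gam
theorem u_k_mul : u .k * u .kInv = 1 := by
  simpa [u] using proj_rel Rel.k_mul
theorem u_mul_k : u .kInv * u .k = 1 := by
  simpa [u] using proj_rel Rel.mul_k
theorem u_Gam_comm (x : Gen) : u .Gam * u x = u x * u .Gam := by
  simpa [u] using proj_rel (Rel.Gam_central x)
theorem u_k_comm (x : Gen) : u .k * u x = u x * u .k := by
  simpa [u] using proj_rel (Rel.k_central x)
theorem u_h_h (m n : {m : ℤ // m ≠ 0}) : u (.h m) * u (.h n) - u (.h n) * u (.h m) =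
    if m.1 = -n.1 then (qint m / ((m : ℤ) : Kq) / (q - q⁻¹)) •
        (zp (u .Gam) (u .GamInv) (2 * m) - zp (u .Gam) (u .GamInv) (-(2 * m))) else 0 := by
  have := proj_rel (Rel.h_h m n)
  split_ifs at this ⊢ <;> simpa [u, zp] using this
theorem u_h_Lam (m : {m : ℤ // m ≠ 0}) :
    u (.h m) * u .Lam = q ^ (2 * m.1) • (u .Lam * u (.h m)) := by
  simpa [u] using proj_rel (Rel.h_Lam m)

/-- `Γ` as a unit. -/
def gamU : Uqˣ := ⟨u .Gam, u .GamInv, u_Gam_mul, u_mul_Gam⟩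

theorem zp_eq (n : ℤ) : zp (u .Gam) (u .GamInv) n = ((gamU ^ n : Uqˣ) : Uq) := by
  have h1 : u .Gam = (gamU : Uq) := rfl
  have h2 : u .GamInv = ((gamU⁻¹ : Uqˣ) : Uq) := rfl
  rw [zp, h1, h2, ← Units.val_pow_eq_pow_val, ← Units.val_pow_eq_pow_val, ← Units.val_mul,
    ← zpow_natCast, ← zpow_natCast, inv_zpow', ← zpow_add]
  congr 2
  omega

theorem induction_on {p : Uq → Prop} (hs : ∀ c : Kq, p (algebraMap Kq Uq c)) (hg : ∀ x, p (u x))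
    (hm : ∀ x y, p x → p y → p (x * y)) (ha : ∀ x y, p x → p y → p (x + y)) (x : Uq) : p x := by
  obtain ⟨x, rfl⟩ := RingQuot.mkAlgHom_surjective Kq Rel x
  change p (proj x)
  induction x using FreeAlgebra.induction with
  | grade0 r => rw [AlgHom.commutes]; exact hs r
  | grade1 x => exact hg x
  | mul a b ha hb => rw [map_mul]; exact hm _ _ ha hb
  | add a b h1 h2 => rw [map_add]; exact ha _ _ h1 h2

theorem gamU_comm (x : Uq) : Commute (gamU : Uq) x := by
  induction x using induction_on with
  | hs c => exact (Algebra.commutes c _).symm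
  | hg x => exact u_Gam_comm x
  | hm x y hx hy => exact hx.mul_right hy
  | ha x y hx hy => exact hx.add_right hy

theorem k_comm (x : Uq) : Commute (u .k) x := by
  induction x using induction_on with
  | hs c => exact (Algebra.commutes c _).symm
  | hg x => exact u_k_comm x
  | hm x y hx hy => exact hx.mul_right hy
  | ha x y hx hy => exact hx.add_right hy

theorem gamU_zpow_comm (n : ℤ) (x : Uq) : Commute ((gamU ^ n : Uqˣ) : Uq) x :=
  (gamU_comm x).units_zpow_left n

/-- `Γ ^ n`. -/
def gp (n : ℤ) : Uq := ((gamU ^ n : Uqˣ) : Uq)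

theorem u_h_h' (m n : {m : ℤ // m ≠ 0}) : u (.h m) * u (.h n) - u (.h n) * u (.h m) =
    if m.1 = -n.1 then (qint m / ((m : ℤ) : Kq) / (q - q⁻¹)) •
        (gp (2 * m.1) - gp (-(2 * m.1))) else 0 := by
  rw [u_h_h, zp_eq, zp_eq, gp, gp]

/-- Algebra homomorphisms out of the quantum Heisenberg algebra. -/
def lift {B : Type*} [Ring B] [Algebra Kq B] (f : Gen → B)
    (h1 : f .Lam * f .LamInv = 1) (h2 : f .LamInv * f .Lam = 1)
    (h3 : f .Gam * f .GamInv = 1) (h4 : f .GamInv * f .Gam = 1)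
    (h5 : f .k * f .kInv = 1) (h6 : f .kInv * f .k = 1)
    (h7 : ∀ x, f .Gam * f x = f x * f .Gam) (h8 : ∀ x, f .k * f x = f x * f .k)
    (h9 : ∀ m n : {m : ℤ // m ≠ 0}, f (.h m) * f (.h n) - f (.h n) * f (.h m) =
      if m.1 = -n.1 then (qint m / ((m : ℤ) : Kq) / (q - q⁻¹)) •
        (zp (f .Gam) (f .GamInv) (2 * m) - zp (f .Gam) (f .GamInv) (-(2 * m))) else 0)
    (h10 : ∀ m : {m : ℤ // m ≠ 0}, f (.h m) * f .Lam = q ^ (2 * m.1) • (f .Lam * f (.h m))) :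
    Uq →ₐ[Kq] B :=
  RingQuot.liftAlgHom Kq ⟨FreeAlgebra.lift Kq f, by
    intro x y hxy
    cases hxy with
    | h_h m n =>
      have := h9 m n
      split_ifs at this ⊢ <;> simpa [zp] using this
    | _ => simp [*]⟩

theorem gp_comm (n : ℤ) (x : Uq) : gp n * x = x * gp n := gamU_zpow_comm n x

theorem gp_add (m n : ℤ) : gp m * gp n = gp (m + n) := by
  rw [gp, gp, gp, zpow_add, Units.val_mul]

/-- The values of the coproduct on the generators. -/
def comulGen : Gen → Uq ⊗[Kq] Uq
  | .h m => u (.h m) ⊗ₜ gp (-|m.1|) + gp |m.1| ⊗ₜ u (.h m)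
  | x => u x ⊗ₜ u x

theorem zp_tmul (n : ℤ) : zp (u .Gam ⊗ₜ[Kq] u .Gam) (u .GamInv ⊗ₜ[Kq] u .GamInv) n =
    gp n ⊗ₜ[Kq] gp n := by
  rw [zp, Algebra.TensorProduct.tmul_pow, Algebra.TensorProduct.tmul_pow,
    Algebra.TensorProduct.tmul_mul_tmul, gp, ← zp_eq, zp]

/-- The coproduct. -/
def comul : Uq →ₐ[Kq] Uq ⊗[Kq] Uq :=
  lift comulGen
    (by simp only [comulGen, Algebra.TensorProduct.tmul_mul_tmul, u_Lam_mul]; rfl)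
    (by simp only [comulGen, Algebra.TensorProduct.tmul_mul_tmul, u_mul_Lam]; rfl)
    (by simp only [comulGen, Algebra.TensorProduct.tmul_mul_tmul, u_Gam_mul]; rfl)
    (by simp only [comulGen, Algebra.TensorProduct.tmul_mul_tmul, u_mul_Gam]; rfl)
    (by simp only [comulGen, Algebra.TensorProduct.tmul_mul_tmul, u_k_mul]; rfl)
    (by simp only [comulGen, Algebra.TensorProduct.tmul_mul_tmul, u_mul_k]; rfl)
    (by
      intro x
      have h : ∀ y : Uq, u .Gam * y = y * u .Gam := fun y => gamU_comm y
      cases x <;> simp only [comulGen, Algebra.TensorProduct.tmul_mul_tmul, mul_add, add_mul, h])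
    (by
      intro x
      have h : ∀ y : Uq, u .k * y = y * u .k := fun y => k_comm y
      cases x <;> simp only [comulGen, Algebra.TensorProduct.tmul_mul_tmul, mul_add, add_mul, h])
    (by
      intro m n
      have e := u_h_h' m n
      rw [sub_eq_iff_eq_add] at e
      simp only [comulGen, Algebra.TensorProduct.tmul_mul_tmul, mul_add, add_mul, zp_tmul, e,
        gp_comm _ (u _), gp_add, TensorProduct.add_tmul, TensorProduct.tmul_add]
      split_ifs with h
      · obtain ⟨m, hm⟩ := m
        obtain ⟨n, hn⟩ := n
        simp only at h
        obtain rfl : n = -m := by omega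
        generalize qint m / (m : Kq) / (q - q⁻¹) = c
        simp only [abs_neg, TensorProduct.smul_tmul', TensorProduct.tmul_smul,
          TensorProduct.sub_tmul, TensorProduct.tmul_sub, smul_sub]
        rcases abs_cases m with ⟨h1, _⟩ | ⟨h1, _⟩ <;>
          simp only [h1, neg_neg, ← two_mul, mul_neg] <;> abel
      · rw [add_comm |n.1|, add_comm (-|n.1|)]
        simp only [zero_add, TensorProduct.zero_tmul, TensorProduct.tmul_zero]
        abel)
    (by
      intro m
      simp only [comulGen, Algebra.TensorProduct.tmul_mul_tmul, mul_add, add_mul, u_h_Lam,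
        gp_comm _ (u _), TensorProduct.smul_tmul', TensorProduct.tmul_smul, smul_add])

/-- The counit. -/
def counit : Uq →ₐ[Kq] Kq :=
  lift (fun | .h _ => 0 | _ => 1) (one_mul _) (one_mul _) (one_mul _) (one_mul _) (one_mul _)
    (one_mul _) (fun _ => mul_comm _ _) (fun _ => mul_comm _ _) (by intro m n; simp [zp])
    (by intro m; simp)

/-- The values of the antipode on the generators. -/
def antipodeGen : Gen → Uq
  | .h m => -u (.h m)
  | .Lam => u .LamInv
  | .LamInv => u .Lam
  | .Gam => u .GamInv
  | .GamInv => u .Gam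
  | .k => u .kInv
  | .kInv => u .k

theorem GamInv_comm (x : Uq) : u .GamInv * x = x * u .GamInv :=
  ((gamU_comm x).units_inv_left : Commute ((gamU⁻¹ : Uqˣ) : Uq) x)

theorem kInv_comm (x : Uq) : u .kInv * x = x * u .kInv := by
  have h := (k_comm x).eq
  calc u .kInv * x = u .kInv * (x * u .k) * u .kInv := by
        rw [mul_assoc, mul_assoc, u_k_mul, mul_one]
    _ = x * u .kInv := by rw [← h, ← mul_assoc, u_mul_k, one_mul]

theorem LamInv_h (m : {m : ℤ // m ≠ 0}) :
    u .LamInv * u (.h m) = q ^ (2 * m.1) • (u (.h m) * u .LamInv) := by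
  calc u .LamInv * u (.h m) = u .LamInv * (u (.h m) * u .Lam) * u .LamInv := by
        rw [mul_assoc, mul_assoc, u_Lam_mul, mul_one]
    _ = _ := by
      rw [u_h_Lam, mul_smul_comm, smul_mul_assoc, ← mul_assoc, u_mul_Lam, one_mul]

/-- The antipode, as a homomorphism to the opposite algebra. -/
def antipode : Uq →ₐ[Kq] Uqᵐᵒᵖ :=
  lift (fun x => MulOpposite.op (antipodeGen x))
    (congrArg MulOpposite.op u_Lam_mul) (congrArg MulOpposite.op u_mul_Lam)
    (congrArg MulOpposite.op u_Gam_mul) (congrArg MulOpposite.op u_mul_Gam)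
    (congrArg MulOpposite.op u_k_mul) (congrArg MulOpposite.op u_mul_k)
    (fun x => congrArg MulOpposite.op (GamInv_comm _).symm)
    (fun x => congrArg MulOpposite.op (kInv_comm _).symm)
    (by
      intro m n
      have e := u_h_h m n
      have hz : ∀ k : ℤ, zp (MulOpposite.op (u .GamInv)) (MulOpposite.op (u .Gam)) k =
          MulOpposite.op (zp (u .Gam) (u .GamInv) (-k)) := by
        intro k
        rw [zp, zp, ← MulOpposite.op_pow, ← MulOpposite.op_pow, ← MulOpposite.op_mul, neg_neg]
      have e' : u (.h n) * u (.h m) - u (.h m) * u (.h n) = -(if m.1 = -n.1 then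
          (qint m / ((m : ℤ) : Kq) / (q - q⁻¹)) •
        (zp (u .Gam) (u .GamInv) (2 * m) - zp (u .Gam) (u .GamInv) (-(2 * m))) else 0) := by
        rw [← e, neg_sub]
      simp only [antipodeGen, hz, neg_neg]
      rw [← MulOpposite.op_mul, ← MulOpposite.op_mul, ← MulOpposite.op_sub, neg_mul_neg,
        neg_mul_neg, e']
      split_ifs
      · rw [← MulOpposite.op_sub, ← MulOpposite.op_smul, ← smul_neg, neg_sub]
      · simp)
    (by
      intro m
      change MulOpposite.op (u .LamInv * -u (.h m)) =
        MulOpposite.op (q ^ (2 * m.1) • (-u (.h m) * u .LamInv))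
      rw [mul_neg, LamInv_h, neg_mul, smul_neg])

/-- The element `(q - q⁻¹) h_m`. -/
def hH (m : {m : ℤ // m ≠ 0}) : Uq := (q - q⁻¹) • u (.h m)

/-- The generators of the integral form. -/
def intGen : Set Uq :=
  {algebraMap Kq Uq q, algebraMap Kq Uq q⁻¹, u .Lam, u .LamInv, u .Gam, u .GamInv, u .k, u .kInv} ∪
    Set.range hH

/-- The `ℂ[q, q⁻¹]`-subalgebra of `Uq` generated by `(q - q⁻¹) h_m`, `Λ^{±1}`, `Γ^{±1}`,
`k^{±1}`. -/
def Uint : Subalgebra ℂ Uq := Algebra.adjoin ℂ intGen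

theorem q_sub_ne : (q - q⁻¹ : Kq) ≠ 0 := by
  intro h
  have hq : (q : Kq) ≠ 0 := RatFunc.X_ne_zero
  have h1 : (q : Kq) * q = 1 := by
    rw [sub_eq_zero] at h
    nth_rw 2 [h]
    exact mul_inv_cancel₀ hq
  have h2 := congrArg RatFunc.num h1
  have h3 : (q * q : Kq) = algebraMap (Polynomial ℂ) Kq (Polynomial.X ^ 2) := by
    rw [map_pow, RatFunc.algebraMap_X, sq]
  rw [h3, RatFunc.num_algebraMap, RatFunc.num_one] at h2
  have := congrArg Polynomial.natDegree h2
  simp at this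

theorem q_ne : (q : Kq) ≠ 0 := RatFunc.X_ne_zero

theorem qint_succ (m : ℤ) : qint (m + 1) = q * qint m + q ^ (-m) := by
  have h := q_sub_ne
  have h' := q_ne
  rw [qint, qint, mul_div_assoc', div_add' _ _ _ h, neg_add, zpow_add₀ h', zpow_add₀ h']
  congr 1
  rw [zpow_neg_one, zpow_one]
  ring

theorem qint_zero : qint 0 = 0 := by simp [qint]

theorem mem_gen {x : Uq} (h : x ∈ intGen) : x ∈ Uint := Algebra.subset_adjoin h

theorem q_mem : algebraMap Kq Uq q ∈ Uint := mem_gen (by simp [intGen])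
theorem q_inv_mem : algebraMap Kq Uq q⁻¹ ∈ Uint := mem_gen (by simp [intGen])

theorem q_zpow_mem (n : ℤ) : algebraMap Kq Uq (q ^ n) ∈ Uint := by
  obtain ⟨n, rfl | rfl⟩ := n.eq_nat_or_neg
  · rw [zpow_natCast, map_pow]; exact pow_mem q_mem n
  · rw [zpow_neg, zpow_natCast, ← inv_pow, map_pow]; exact pow_mem q_inv_mem n

theorem qint_mem (n : ℤ) : algebraMap Kq Uq (qint n) ∈ Uint := by
  induction n using Int.induction_on with
  | zero => rw [qint_zero, map_zero]; exact zero_mem _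
  | succ n ih =>
    rw [qint_succ, map_add, map_mul]
    exact add_mem (mul_mem q_mem ih) (q_zpow_mem _)
  | pred n ih =>
    have h : qint (-n - 1) = q⁻¹ * (qint (-n) - q ^ (n + 1 : ℤ)) := by
      have := qint_succ (-n - 1)
      rw [sub_add_cancel, neg_sub, sub_neg_eq_add, add_comm 1] at this
      rw [this, add_sub_cancel_right, inv_mul_cancel_left₀ q_ne]
    rw [h, map_mul, map_sub]
    exact mul_mem q_inv_mem (sub_mem ih (q_zpow_mem _))

theorem smul_mem {c : Kq} (hc : algebraMap Kq Uq c ∈ Uint) {x : Uq} (hx : x ∈ Uint) :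
    c • x ∈ Uint := by
  rw [Algebra.smul_def]; exact mul_mem hc hx

/-- The divided commutator `[x, y] / (q - q⁻¹)` in `Uq`. -/
def dc (x y : Uq) : Uq := (q - q⁻¹)⁻¹ • (x * y - y * x)

theorem dc_comm {x y : Uq} (h : x * y = y * x) : dc x y = 0 := by
  rw [dc, h, sub_self, smul_zero]

theorem dc_swap (x y : Uq) : dc x y = -dc y x := by
  rw [dc, dc, ← smul_neg, neg_sub]

theorem dc_mul (x y z : Uq) : dc x (y * z) = dc x y * z + y * dc x z := by
  simp only [dc, smul_mul_assoc, mul_smul_comm, ← smul_add]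
  congr 1
  noncomm_ring

theorem dc_add (x y z : Uq) : dc x (y + z) = dc x y + dc x z := by
  simp only [dc, ← smul_add]
  congr 1
  noncomm_ring

theorem zpow_mem (n : ℤ) : gp n ∈ Uint := by
  have h1 : u .Gam ∈ Uint := mem_gen (by simp [intGen])
  have h2 : u .GamInv ∈ Uint := mem_gen (by simp [intGen])
  rw [gp, ← zp_eq, zp]
  exact mul_mem (pow_mem h1 _) (pow_mem h2 _)

theorem dc_hH_Lam (m : {m : ℤ // m ≠ 0}) : dc (hH m) (u .Lam) =
    (q ^ m.1 * qint m) • (u .Lam * hH m) := by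
  have h : (q - q⁻¹)⁻¹ * (q ^ (2 * m.1) - 1) = q ^ m.1 * qint m := by
    rw [qint, mul_div_assoc', mul_sub (q ^ m.1), ← zpow_add₀ q_ne, ← zpow_add₀ q_ne, add_neg_cancel, zpow_zero,
      two_mul, div_eq_inv_mul]
  rw [← h, dc, hH, smul_mul_assoc, u_h_Lam, mul_smul_comm, smul_comm, ← mul_smul, ← sub_smul,
    ← mul_smul, ← mul_smul]
  congr 1
  ring

theorem dc_hH_hH (m n : {m : ℤ // m ≠ 0}) : dc (hH m) (hH n) =
    if m.1 = -n.1 then (qint m / ((m : ℤ) : Kq)) • (gp (2 * m.1) - gp (-(2 * m.1))) else 0 := by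
  have h := q_sub_ne
  have e : hH m * hH n - hH n * hH m =
      ((q - q⁻¹) * (q - q⁻¹)) • (u (.h m) * u (.h n) - u (.h n) * u (.h m)) := by
    simp only [hH, smul_mul_assoc, mul_smul_comm, ← mul_smul, ← smul_sub]
  rw [dc, e, u_h_h', ← mul_smul]
  split_ifs
  · rw [← mul_smul]
    congr 1
    generalize (q - q⁻¹ : Kq) = d at h
    field_simp
  · rw [smul_zero]

theorem int_smul_mem (m : {m : ℤ // m ≠ 0}) {x : Uq} (hx : x ∈ Uint) :
    (qint m / ((m : ℤ) : Kq)) • x ∈ Uint := by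
  have e : (qint m / ((m : ℤ) : Kq)) • x = ((m.1 : ℂ)⁻¹) • (qint m • x) := by
    rw [← algebraMap_smul Kq ((m.1 : ℂ)⁻¹) (qint m • x), ← mul_smul, map_inv₀, map_intCast,
      div_eq_inv_mul]
  rw [e]
  exact Subalgebra.smul_mem _ (smul_mem (qint_mem _) hx) _

theorem dc_gen_mem {x y : Uq} (hx : x ∈ intGen) (hy : y ∈ intGen) : dc x y ∈ Uint := by
  have z : ∀ {a b : Uq}, a * b = b * a → dc a b ∈ Uint := fun h => by
    rw [dc_comm h]; exact zero_mem _
  have hL : u .Lam ∈ Uint := mem_gen (by simp [intGen])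
  have hL' : u .LamInv ∈ Uint := mem_gen (by simp [intGen])
  have hH' : ∀ m, hH m ∈ Uint := fun m => mem_gen (by simp [intGen])
  have h1 : ∀ m, dc (hH m) (u .Lam) ∈ Uint := fun m => by
    rw [dc_hH_Lam]
    refine smul_mem ?_ (mul_mem hL (hH' m))
    rw [map_mul]
    exact mul_mem (q_zpow_mem _) (qint_mem _)
  have h2 : ∀ m, dc (hH m) (u .LamInv) ∈ Uint := fun m => by
    have e := dc_mul (hH m) (u .LamInv) (u .Lam)
    rw [u_mul_Lam, dc_comm (by rw [mul_one, one_mul])] at e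
    have e2 : dc (hH m) (u .LamInv) = -(u .LamInv * dc (hH m) (u .Lam)) * u .LamInv := by
      rw [← eq_neg_of_add_eq_zero_left e.symm, mul_assoc, u_Lam_mul, mul_one]
    rw [e2]
    exact mul_mem (neg_mem (mul_mem hL' (h1 m))) hL'
  have c1 : ∀ (c : Kq) (a : Uq), algebraMap Kq Uq c * a = a * algebraMap Kq Uq c :=
    fun c a => Algebra.commutes c a
  have c2 : ∀ a : Uq, u .Gam * a = a * u .Gam := fun a => gamU_comm a
  have c3 : ∀ a : Uq, u .k * a = a * u .k := fun a => k_comm a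
  simp only [intGen, Set.mem_union, Set.mem_insert_iff, Set.mem_singleton_iff, Set.mem_range]
    at hx hy
  rcases hx with (rfl | rfl | rfl | rfl | rfl | rfl | rfl | rfl) | ⟨m, rfl⟩
  · exact z (c1 _ _)
  · exact z (c1 _ _)
  · rcases hy with (rfl | rfl | rfl | rfl | rfl | rfl | rfl | rfl) | ⟨n, rfl⟩
    · exact z (c1 _ _).symm
    · exact z (c1 _ _).symm
    · exact z rfl
    · exact z (u_Lam_mul.trans u_mul_Lam.symm)
    · exact z (c2 _).symm
    · exact z (GamInv_comm _).symm
    · exact z (c3 _).symm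
    · exact z (kInv_comm _).symm
    · rw [dc_swap]; exact neg_mem (h1 n)
  · rcases hy with (rfl | rfl | rfl | rfl | rfl | rfl | rfl | rfl) | ⟨n, rfl⟩
    · exact z (c1 _ _).symm
    · exact z (c1 _ _).symm
    · exact z (u_mul_Lam.trans u_Lam_mul.symm)
    · exact z rfl
    · exact z (c2 _).symm
    · exact z (GamInv_comm _).symm
    · exact z (c3 _).symm
    · exact z (kInv_comm _).symm
    · rw [dc_swap]; exact neg_mem (h2 n)
  · exact z (c2 _)
  · exact z (GamInv_comm _)
  · exact z (c3 _)
  · exact z (kInv_comm _)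
  · rcases hy with (rfl | rfl | rfl | rfl | rfl | rfl | rfl | rfl) | ⟨n, rfl⟩
    · exact z (c1 _ _).symm
    · exact z (c1 _ _).symm
    · exact h1 m
    · exact h2 m
    · exact z (c2 _).symm
    · exact z (GamInv_comm _).symm
    · exact z (c3 _).symm
    · exact z (kInv_comm _).symm
    · rw [dc_hH_hH]
      split_ifs
      · exact int_smul_mem m (sub_mem (zpow_mem _) (zpow_mem _))
      · exact zero_mem _

theorem dc_mem_of_forall {x : Uq} (hx : ∀ y ∈ intGen, dc x y ∈ Uint) {y : Uq} (hy : y ∈ Uint) :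
    dc x y ∈ Uint := by
  induction hy using Algebra.adjoin_induction with
  | mem y hy => exact hx y hy
  | algebraMap r => rw [dc_comm (Algebra.commutes r x).symm]; exact zero_mem _
  | add y z _ _ h1 h2 => rw [dc_add]; exact add_mem h1 h2
  | mul y z hy hz h1 h2 => rw [dc_mul]; exact add_mem (mul_mem h1 hz) (mul_mem hy h2)

theorem dc_mem {x y : Uq} (hx : x ∈ Uint) (hy : y ∈ Uint) : dc x y ∈ Uint := by
  refine dc_mem_of_forall (fun z hz => ?_) hy
  rw [dc_swap]
  refine neg_mem (dc_mem_of_forall (fun w hw => dc_gen_mem hz hw) hx)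

/-- The divided commutator `[x, y] / (q - q⁻¹)` on the integral form. -/
def dcInt (x y : Uint) : Uint := ⟨dc x y, dc_mem x.2 y.2⟩

/-- `q` as an element of the integral form. -/
def qU : Uint := ⟨algebraMap Kq Uq q, q_mem⟩

theorem qU_comm (x : Uint) : qU * x = x * qU := Subtype.ext (Algebra.commutes q x.1)

/-- The two-sided ideal of the integral form generated by `q - 1`. -/
def specIdeal : Ideal Uint := Ideal.span {qU - 1}

theorem mem_specIdeal {x : Uint} : x ∈ specIdeal ↔ ∃ y, y * (qU - 1) = x :=
  Ideal.mem_span_singleton'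

instance : specIdeal.IsTwoSided := ⟨fun {a} b ha => by
  obtain ⟨y, rfl⟩ := mem_specIdeal.1 ha
  refine mem_specIdeal.2 ⟨y * b, ?_⟩
  rw [mul_assoc, mul_assoc, mul_sub, sub_mul, qU_comm, mul_one, one_mul]⟩

theorem mul_sub_mul_eq (x y : Uint) : x * y - y * x =
    (dcInt x y * (⟨algebraMap Kq Uq q⁻¹, q_inv_mem⟩ * (qU + 1))) * (qU - 1) := by
  have h := q_sub_ne
  have h' := q_ne
  refine Subtype.ext ?_
  change x.1 * y.1 - y.1 * x.1 = (dc x.1 y.1 * (algebraMap Kq Uq q⁻¹ *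
    (algebraMap Kq Uq q + 1))) * (algebraMap Kq Uq q - 1)
  rw [← map_one (algebraMap Kq Uq), ← map_add, ← map_sub, ← map_mul, mul_assoc, ← map_mul,
    ← Algebra.commutes, ← Algebra.smul_def, dc, ← mul_smul]
  have : q⁻¹ * (q + 1) * (q - 1) * (q - q⁻¹)⁻¹ = (1 : Kq) := by
    have e : q⁻¹ * (q + 1) * (q - 1) = (q - q⁻¹ : Kq) := by field_simp; ring
    rw [e, mul_inv_cancel₀ h]
  rw [this, one_smul]

/-- The specialization `Z₁` of the quantum Heisenberg algebra at `q = 1`. -/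
abbrev Z1 : Type := Uint ⧸ specIdeal

/-- The specialization map. -/
def sp : Uint →ₐ[ℂ] Z1 := Ideal.Quotient.mkₐ ℂ specIdeal

theorem sp_surjective : Function.Surjective sp := Ideal.Quotient.mk_surjective

theorem sp_eq {x y : Uint} : sp x = sp y ↔ x - y ∈ specIdeal := Ideal.Quotient.eq

theorem Z1_mul_comm (a b : Z1) : a * b = b * a := by
  obtain ⟨x, rfl⟩ := sp_surjective a
  obtain ⟨y, rfl⟩ := sp_surjective b
  rw [← map_mul, ← map_mul, sp_eq]
  exact mem_specIdeal.2 ⟨_, (mul_sub_mul_eq x y).symm⟩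

instance : CommRing Z1 := { (inferInstance : Ring Z1) with mul_comm := Z1_mul_comm }

theorem dcInt_congr {x x' y y' : Uint} (hx : sp x = sp x') (hy : sp y = sp y') :
    sp (dcInt x y) = sp (dcInt x' y') := by
  have key : ∀ {a a' b : Uint}, sp a = sp a' → sp (dcInt b a) = sp (dcInt b a') := by
    intro a a' b h
    obtain ⟨w, hw⟩ := mem_specIdeal.1 (sp_eq.1 h)
    refine sp_eq.2 (mem_specIdeal.2 ⟨dcInt b w, Subtype.ext ?_⟩)
    have h1 : a.1 = w.1 * (algebraMap Kq Uq q - 1) + a'.1 :=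
      sub_eq_iff_eq_add.1 (congrArg Subtype.val hw).symm
    change dc b.1 w.1 * (algebraMap Kq Uq q - 1) = dc b.1 a.1 - dc b.1 a'.1
    rw [h1, dc_add, add_sub_cancel_right, dc_mul,
      dc_comm (x := b.1) (y := algebraMap Kq Uq q - 1), mul_zero, add_zero]
    rw [mul_sub, sub_mul, ← Algebra.commutes, mul_one, one_mul]
  have swap : ∀ a b : Uint, dcInt a b = -dcInt b a := fun a b => Subtype.ext (dc_swap _ _)
  rw [key hy, swap, swap x', map_neg, map_neg, key hx]

/-- The semiclassical bracket on `Z₁`: the class of `[x, y] / (q - q⁻¹)`, where `x` and `y` are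
lifts of the arguments. -/
def bracket (a b : Z1) : Z1 :=
  sp (dcInt (Function.surjInv sp_surjective a) (Function.surjInv sp_surjective b))

theorem bracket_sp (x y : Uint) : bracket (sp x) (sp y) = sp (dcInt x y) :=
  dcInt_congr (Function.surjInv_eq _ _) (Function.surjInv_eq _ _)

/-- The map `x ⊗ y ↦ x ⊗ y` from the tensor square over `ℂ` of the integral form to the tensor
square over `ℂ(q)` of `Uq`. -/
def tens : Uint ⊗[ℂ] Uint →ₗ[ℂ] Uq ⊗[Kq] Uq :=
  TensorProduct.lift (LinearMap.mk₂ ℂ (fun x y : Uint => x.1 ⊗ₜ[Kq] y.1)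
    (fun _ _ _ => TensorProduct.add_tmul _ _ _)
    (fun c x y => (TensorProduct.smul_tmul' c x.1 y.1).symm)
    (fun _ _ _ => TensorProduct.tmul_add _ _ _)
    (fun c x y => TensorProduct.tmul_smul c x.1 y.1))

/-- The class of `Λ` in `Z₁`. -/
def zLam : Z1 := sp ⟨u .Lam, mem_gen (by simp [intGen])⟩

/-- The class of `Γ` in `Z₁`. -/
def zGam : Z1 := sp ⟨u .Gam, mem_gen (by simp [intGen])⟩

/-- The class of `k` in `Z₁`. -/
def zk : Z1 := sp ⟨u .k, mem_gen (by simp [intGen])⟩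

/-- The class of `(q - q⁻¹) h_m` in `Z₁`. -/
def zh (m : {m : ℤ // m ≠ 0}) : Z1 := sp ⟨hH m, mem_gen (by simp [intGen])⟩

end Heisenberg

/-- A Poisson Hopf algebra structure on a commutative `ℂ`-algebra. -/
structure PoissonHopf (A : Type) [CommRing A] [Algebra ℂ A] where
  comul : A →ₐ[ℂ] A ⊗[ℂ] A
  counit : A →ₐ[ℂ] ℂ
  antipode : A →ₗ[ℂ] A
  bracket : A →ₗ[ℂ] A →ₗ[ℂ] A
  coassoc : ∀ a, TensorProduct.assoc ℂ A A A (comul.toLinearMap.rTensor A (comul a)) =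
    comul.toLinearMap.lTensor A (comul a)
  counit_left : ∀ a, counit.toLinearMap.rTensor A (comul a) = 1 ⊗ₜ a
  counit_right : ∀ a, counit.toLinearMap.lTensor A (comul a) = a ⊗ₜ 1
  antipode_left : ∀ a, LinearMap.mul' ℂ A (antipode.rTensor A (comul a)) =
    algebraMap ℂ A (counit a)
  antipode_right : ∀ a, LinearMap.mul' ℂ A (antipode.lTensor A (comul a)) =
    algebraMap ℂ A (counit a)
  bracket_self : ∀ a, bracket a a = 0
  jacobi : ∀ a b c, bracket a (bracket b c) + bracket b (bracket c a) + bracket c (bracket a b) = 0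
  leibniz : ∀ a b c, bracket a (b * c) = bracket a b * c + b * bracket a c
  comul_bracket : ∀ a b, comul (bracket a b) =
    (TensorProduct.map₂ (LinearMap.mul ℂ A) bracket + TensorProduct.map₂ bracket (LinearMap.mul ℂ A))
      (comul a) (comul b)

/-- An algebra isomorphism is an isomorphism of Poisson Hopf algebras. -/
structure PoissonHopf.IsIso {A B : Type} [CommRing A] [Algebra ℂ A] [CommRing B] [Algebra ℂ B]
    (P : PoissonHopf A) (Q : PoissonHopf B) (Φ : A ≃ₐ[ℂ] B) : Prop where
  comul : ∀ a, Q.comul (Φ a) = TensorProduct.map Φ.toLinearMap Φ.toLinearMap (P.comul a)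
  counit : ∀ a, Q.counit (Φ a) = P.counit a
  antipode : ∀ a, Q.antipode (Φ a) = Φ (P.antipode a)
  bracket : ∀ a b, Q.bracket (Φ a) (Φ b) = Φ (P.bracket a b)

namespace GL1Loop

/-- The value at a point, on `ℂ[H]`. -/
def ev (h : H) : CH →ₐ[ℂ] ℂ := (Pi.evalAlgHom ℂ (fun _ : H => ℂ) h).comp CH.val

theorem kFun_mem : kFun ∈ CH := Algebra.subset_adjoin (by simp)
theorem lamFun_mem : lamFun ∈ CH := Algebra.subset_adjoin (by simp)
theorem gamFun_mem : gamFun ∈ CH := Algebra.subset_adjoin (by simp)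
theorem hFun_mem (m : {m : ℤ // m ≠ 0}) : hFun m ∈ CH := Algebra.subset_adjoin (by simp)

/-- The Poisson Hopf structure on `ℂ[H]` is the one of the Poisson group `H`: the coproduct, the
counit and the antipode come from the group structure of `H`, and the bracket is the one of the
Manin triple. -/
structure IsPoissonGroup (P : PoissonHopf CH) : Prop where
  comul : ∀ (F : CH) (h h' : H),
    Algebra.TensorProduct.lift (ev h) (ev h') (fun _ _ => Commute.all _ _) (P.comul F) =
      F.1 (h * h')
  counit : ∀ F : CH, P.counit F = F.1 1
  antipode : ∀ (F : CH) (h : H), (P.antipode F).1 h = F.1 h⁻¹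
  bracket : ∀ (F G : CH) (h : H) (v : ℂ), IsBracketAt F.1 G.1 h v ↔ v = (P.bracket F G).1 h

end GL1Loop

namespace Heisenberg

/-- The Poisson Hopf structure on `Z₁` is the semiclassical limit of the Hopf algebra `Uq`: the
coproduct, the counit and the antipode of `Uq` restrict to the integral form and are reduced at
`q = 1`, and the bracket is the semiclassical one. -/
structure IsSemiclassical (Q : PoissonHopf Z1) : Prop where
  exists_comul : ∀ x : Uint, ∃ t : Uint ⊗[ℂ] Uint, tens t = comul x
  comul : ∀ (x : Uint) (t : Uint ⊗[ℂ] Uint), tens t = comul x →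
    Q.comul (sp x) = TensorProduct.map sp.toLinearMap sp.toLinearMap t
  counit : ∀ x : Uint, ∃ p : ℤ →₀ ℂ,
    counit x = p.sum (fun n c => RatFunc.C c * q ^ n) ∧ Q.counit (sp x) = p.sum (fun _ c => c)
  antipode : ∀ x : Uint, ∃ y : Uint, antipode x = MulOpposite.op (y : Uq) ∧
    Q.antipode (sp x) = sp y
  bracket : ∀ a b : Z1, Q.bracket a b = bracket a b

end Heisenberg

end

/-! On the quantum side the main point is that `Z1` has no relations beyond commutativity and the
invertibility of Λ, Γ, k. This comes from a representation `rho` of `Uq` on polynomials in the h_m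
with coefficients in Laurent polynomials in Λ, Γ, k. There (q - q⁻¹) h_m acts as X_m + d_m ∂_{-m}
followed by the dilation Λ ↦ q^{2m} Λ. The coefficient d_m is a multiple of Γ^{2m} - Γ^{-2m} for m <
0 and vanishes for m > 0. Elements of `Uint` preserve the lattice of polynomials over ℂ[q^{±1}]. The
structure constants (q^m - q^{-m})/m vanish at q = 1, so there each element acts as multiplication
by a polynomial, its symbol. The symbol factors through `Z1`, and it is injective
(`symbol_injective`) because `Z1` is generated by the classes of the generators. Homomorphisms out
of `Z1` can therefore be prescribed on generators (`Z1lift`), and the Poisson Hopf axioms, being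
identities of homomorphisms or of derivations, are checked on generators; the result is `hopfZ`. It
is the limit of the structure of `Uq` because every coproduct lifts to the integral form and its
reduction does not depend on the lift (`map_sp_eq_of_tens_eq`).

On the geometric side the cocycle vanishes on two loops that are both holomorphic at 0, or both
holomorphic on the projective line minus 0. Multiplication in H is thus the addition of rescaled
logarithms, and the product formulas `kFun_mul`, `lamFun_mul`, `hFun_mul` are those of the coproduct
of `Z1`. Points of H realize all invertible values of Λ, Γ, k and all finitely supported values of
the h_m (`exists_point`), which is enough to separate polynomials. Hence the map `ofZ1` is
bijective, and its inverse is `Phi`.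

The Poisson Hopf structure on ℂ[H] is the transport of `hopfZ` along `Phi`; it remains to see that
its bracket is that of the Manin triple. The Manin bracket depends only on differentials, so it is a
derivation at h in each argument, and again generators suffice. The adjoint action is computed
explicitly (`adMap`), and so are the differentials (`genX`) and the projections to the Lie algebra
of H (`genZ`). The resulting table (`form₂_gen`) is {h_m, h_{-m}} = Γ^{2m} - Γ^{-2m}, {h_m, Λ} = m Λ
h_m, all other brackets of generators zero up to antisymmetry. This is the limit of the quantum
relations, as [m]_q becomes m. The bracket is well defined since every ingredient of `IsBracketAt`
is unique: differentials because the form is nondegenerate, adjoint images by `HasVelocity.unique`,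
and projections because the Lie algebra of H meets the diagonal only in 0. -/

noncomputable section

/-! ### Operators on polynomials that satisfy the Heisenberg relations -/

namespace Heisenberg

open MvPolynomial

/-- The nonzero integers. -/
abbrev Idx : Type := {m : ℤ // m ≠ 0}

/-- The opposite of a nonzero integer. -/
def Idx.neg (m : Idx) : Idx := ⟨-m.1, neg_ne_zero.2 m.2⟩

theorem Idx.eq_neg_iff {m n : Idx} : m.1 = -n.1 ↔ m = n.neg :=
  ⟨fun h => Subtype.ext h, fun h => congrArg Subtype.val h⟩

theorem Idx.neg_neg (m : Idx) : m.neg.neg = m := Subtype.ext (_root_.neg_neg m.1)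

/-- Laurent polynomials in `Λ`, `Γ`, `k`. -/
abbrev Lau (R : Type) [CommRing R] : Type := AddMonoidAlgebra R (ℤ × ℤ × ℤ)

/-- Polynomials in the `h_m` over the Laurent polynomials in `Λ`, `Γ`, `k`. -/
abbrev Pol (R : Type) [CommRing R] : Type := MvPolynomial Idx (Lau R)

section Operators

variable {R : Type} [CommRing R]

/-- The Laurent monomial with exponents `g`. -/
def mon (R : Type) [CommRing R] (g : ℤ × ℤ × ℤ) : Pol R := C (AddMonoidAlgebra.single g 1)

theorem mon_mul (g g' : ℤ × ℤ × ℤ) : mon R g * mon R g' = mon R (g + g') := by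
  rw [mon, mon, ← C_mul, AddMonoidAlgebra.single_mul_single, mul_one, mon]

theorem mon_zero : mon R 0 = 1 := C_1

/-- The substitution `Λ ↦ s Λ` in a Laurent polynomial. -/
def scale (s : Rˣ) : Lau R →ₐ[R] Lau R :=
  AddMonoidAlgebra.lift R _ (ℤ × ℤ × ℤ)
    { toFun := fun g => AddMonoidAlgebra.single g.toAdd ((s ^ g.toAdd.1 : Rˣ) : R)
      map_one' := by simp [AddMonoidAlgebra.one_def]
      map_mul' := fun g g' => by
        simp [AddMonoidAlgebra.single_mul_single, zpow_add] }

theorem scale_single (s : Rˣ) (g : ℤ × ℤ × ℤ) (r : R) :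
    scale s (AddMonoidAlgebra.single g r) = AddMonoidAlgebra.single g (r * (s ^ g.1 : Rˣ)) := by
  simp [scale]

/-- The substitution `Λ ↦ s Λ`. -/
def dil (s : Rˣ) : Pol R →ₐ[R] Pol R := mapAlgHom (scale s)

theorem dil_apply (s : Rˣ) (v : Pol R) : dil s v = MvPolynomial.map (scale s : Lau R →+* Lau R) v :=
  rfl

theorem dil_X (s : Rˣ) (m : Idx) : dil s (X m) = X m := by
  rw [dil_apply, map_X]

theorem dil_mon (s : Rˣ) (g : ℤ × ℤ × ℤ) : dil s (mon R g) = ((s ^ g.1 : Rˣ) : R) • mon R g := by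
  rw [dil_apply, mon, map_C]
  change C (scale s _) = _
  have h (r : R) : (AddMonoidAlgebra.single g r : Lau R) = r • AddMonoidAlgebra.single g 1 := by
    rw [AddMonoidAlgebra.smul_single, smul_eq_mul, mul_one]
  rw [scale_single, one_mul, h, ← algebraMap_smul (Lau R) _ (C _), ← C_mul', ← C_mul,
    ← Algebra.smul_def]

theorem scale_scale (s t : Rˣ) (v : Lau R) : scale s (scale t v) = scale (s * t) v := by
  have : (scale s).comp (scale t) = scale (s * t) := by
    ext g
    simp [scale_single, mul_zpow, mul_comm]
  exact DFunLike.congr_fun this v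

theorem dil_dil (s t : Rˣ) (v : Pol R) : dil s (dil t v) = dil (s * t) v := by
  rw [dil_apply, dil_apply, dil_apply, MvPolynomial.map_map]
  have : (scale s : Lau R →+* Lau R).comp (scale t : Lau R →+* Lau R) = scale (s * t) :=
    RingHom.ext (scale_scale s t)
  rw [this]

theorem dil_one (v : Pol R) : dil 1 v = v := by
  have : scale (1 : Rˣ) = AlgHom.id R _ := by
    ext g
    simp [scale_single]
  rw [dil_apply, this]
  exact MvPolynomial.map_id v

theorem dil_pderiv (s : Rˣ) (m : Idx) (v : Pol R) : dil s (pderiv m v) = pderiv m (dil s v) :=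
  pderiv_map.symm

/-- `c_m (Γ ^ (2 m) - Γ ^ (- 2 m))` for negative `m`, and `0` for positive `m`. -/
def dcoef (c : Idx → R) (m : Idx) : Pol R :=
  if 0 < m.1 then 0 else c m • (mon R (0, 2 * m.1, 0) - mon R (0, -(2 * m.1), 0))

theorem dil_dcoef (s : Rˣ) (c : Idx → R) (m : Idx) : dil s (dcoef c m) = dcoef c m := by
  rw [dcoef]
  split_ifs <;> simp [dil_mon]

theorem pderiv_mon (m : Idx) (g : ℤ × ℤ × ℤ) : pderiv m (mon R g) = 0 := by
  rw [mon, pderiv_C]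

theorem pderiv_dcoef (n : Idx) (c : Idx → R) (m : Idx) : pderiv n (dcoef c m) = 0 := by
  rw [dcoef]
  split_ifs
  · exact map_zero _
  · rw [← algebraMap_smul (Lau R), Derivation.map_smul, map_sub, pderiv_mon, pderiv_mon, sub_zero,
      smul_zero]

/-- The commutator of two derivations is a derivation, and this one kills every variable. -/
theorem pderiv_comm (m n : Idx) (v : Pol R) : pderiv m (pderiv n v) = pderiv n (pderiv m v) := by
  have : ⁅(pderiv m : Derivation (Lau R) (Pol R) (Pol R)),
      (pderiv n : Derivation (Lau R) (Pol R) (Pol R))⁆ = 0 := by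
    refine MvPolynomial.derivation_ext fun i => ?_
    rw [Derivation.commutator_apply, pderiv_X, pderiv_X]
    simp [Pi.single_apply, apply_ite]
  have h := DFunLike.congr_fun this v
  rw [Derivation.commutator_apply] at h
  exact sub_eq_zero.1 h

/-- The operator `X_m + d_m ∂_{-m}`. -/
def wop (c : Idx → R) (m : Idx) (v : Pol R) : Pol R :=
  X m * v + dcoef c m * pderiv m.neg v

theorem dil_wop (s : Rˣ) (c : Idx → R) (m : Idx) (v : Pol R) :
    dil s (wop c m v) = wop c m (dil s v) := by
  rw [wop, map_add, map_mul, map_mul, dil_X, dil_dcoef, dil_pderiv, wop]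

/-- Multiplications commute, derivatives commute, and the d_m involve only Γ, so only the terms
where a derivative hits a variable survive. They are nonzero only for n = -m. As d_m vanishes for m
> 0, exactly one of the two carries the structure constant; the symmetry of c makes both cases give
the same formula. -/
theorem wop_comm (c : Idx → R) (hc : ∀ m, c m.neg = c m) (m n : Idx) (v : Pol R) :
    wop c m (wop c n v) - wop c n (wop c m v) = if m.1 = -n.1 then
      c m • ((mon R (0, 2 * m.1, 0) - mon R (0, -(2 * m.1), 0)) * v) else 0 := by
  have e : wop c m (wop c n v) - wop c n (wop c m v) =
      dcoef c m * (pderiv m.neg (X n) * v) - dcoef c n * (pderiv n.neg (X m) * v) := by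
    simp only [wop, map_add, Derivation.leibniz, pderiv_dcoef, pderiv_comm n.neg m.neg, smul_eq_mul]
    ring
  rw [e, pderiv_X, pderiv_X]
  split_ifs with h
  · obtain rfl := Idx.eq_neg_iff.1 h
    rw [Idx.neg_neg, Pi.single_eq_same, Pi.single_eq_same, one_mul, ← sub_mul, ← smul_mul_assoc]
    congr 1
    have hn : n.1 ≠ 0 := n.2
    have e1 : n.neg.1 = -n.1 := rfl
    rcases lt_or_gt_of_ne n.2 with h' | h'
    · rw [dcoef, if_pos (by omega), dcoef, if_neg (by omega), hc, e1, zero_sub, ← smul_neg, neg_sub]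
      simp
    · rw [dcoef, if_neg (by omega), dcoef, if_pos (by omega), e1, sub_zero]
  · have h1 : n ≠ m.neg := by rintro rfl; exact h (_root_.neg_neg m.1).symm
    have h2 : m ≠ n.neg := by rintro rfl; exact h rfl
    rw [Pi.single_eq_of_ne h1, Pi.single_eq_of_ne h2, zero_mul, mul_zero, mul_zero,
      sub_zero]

/-- The operator by which `(q - q⁻¹) h_m` acts. -/
def xop (q : Rˣ) (c : Idx → R) (m : Idx) : Module.End R (Pol R) where
  toFun v := dil (q ^ (2 * m.1)) (wop c m v)
  map_add' v w := by
    rw [← map_add]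
    congr 1
    simp only [wop, map_add, mul_add]
    ring
  map_smul' r v := by
    rw [RingHom.id_apply, ← map_smul]
    congr 1
    rw [wop, wop, ← algebraMap_smul (Lau R) r v, Derivation.map_smul, algebraMap_smul,
      algebraMap_smul, mul_smul_comm, mul_smul_comm, smul_add]

theorem xop_apply (q : Rˣ) (c : Idx → R) (m : Idx) (v : Pol R) :
    xop q c m v = dil (q ^ (2 * m.1)) (wop c m v) := rfl

/-- Dilations commute with `wop`, so the commutator is that of `wop` followed by the dilation by
q^{2(m+n)}. The latter is trivial in the only case n = -m that contributes. -/
theorem xop_comm (q : Rˣ) (c : Idx → R) (hc : ∀ m, c m.neg = c m) (m n : Idx) (v : Pol R) :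
    xop q c m (xop q c n v) - xop q c n (xop q c m v) = if m.1 = -n.1 then
      c m • ((mon R (0, 2 * m.1, 0) - mon R (0, -(2 * m.1), 0)) * v) else 0 := by
  simp only [xop_apply, ← dil_wop, dil_dil]
  rw [mul_comm (q ^ (2 * n.1)), ← map_sub, wop_comm c hc]
  split_ifs with h
  · rw [← zpow_add, h, mul_neg, neg_add_cancel, zpow_zero, dil_one]
  · exact map_zero _

theorem wop_mon_mul (c : Idx → R) (m : Idx) (g : ℤ × ℤ × ℤ) (v : Pol R) :
    wop c m (mon R g * v) = mon R g * wop c m v := by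
  rw [wop, Derivation.leibniz, pderiv_mon, wop, smul_zero, add_zero, smul_eq_mul]
  ring

/-- The dilation is built into `xop` for this purpose: it produces the factor q^{2m} in the relation
h_m Λ = q^{2m} Λ h_m. -/
theorem xop_mon_mul (q : Rˣ) (c : Idx → R) (m : Idx) (g : ℤ × ℤ × ℤ) (v : Pol R) :
    xop q c m (mon R g * v) = ((q ^ (2 * m.1 * g.1) : Rˣ) : R) • (mon R g * xop q c m v) := by
  rw [xop_apply, wop_mon_mul, map_mul, dil_mon, smul_mul_assoc, ← zpow_mul, xop_apply]

end Operators

/-! ### Change of the coefficient ring -/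

section BaseChange

variable {R S : Type} [CommRing R] [CommRing S] (φ : R →+* S)

/-- The change of the coefficient ring. -/
def polMap : Pol R →+* Pol S := MvPolynomial.map (AddMonoidAlgebra.mapRingHom (ℤ × ℤ × ℤ) φ)

theorem polMap_X (m : Idx) : polMap φ (X m) = X m := map_X _ _

theorem polMap_mon (g : ℤ × ℤ × ℤ) : polMap φ (mon R g) = mon S g := by
  rw [polMap, mon, map_C, AddMonoidAlgebra.mapRingHom_single, map_one, mon]

theorem polMap_C_single (g : ℤ × ℤ × ℤ) (r : R) :
    polMap φ (C (AddMonoidAlgebra.single g r)) = C (AddMonoidAlgebra.single g (φ r)) := by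
  rw [polMap, map_C, AddMonoidAlgebra.mapRingHom_single]

theorem polMap_smul (r : R) (v : Pol R) : polMap φ (r • v) = φ r • polMap φ v := by
  rw [Algebra.smul_def, Algebra.smul_def, map_mul]
  congr 1
  exact polMap_C_single φ 0 r

theorem coeff_polMap (v : Pol R) (d : Idx →₀ ℕ) (g : ℤ × ℤ × ℤ) :
    ((polMap φ v).coeff d).coeff g = φ ((v.coeff d).coeff g) := by
  rw [polMap, MvPolynomial.coeff_map, AddMonoidAlgebra.coeff_mapRingHom]

theorem polMap_injective (h : Function.Injective φ) : Function.Injective (polMap φ) :=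
  MvPolynomial.map_injective _ (AddMonoidAlgebra.map_injective _ h)

theorem polMap_dil (s : Rˣ) (v : Pol R) :
    polMap φ (dil s v) = dil (Units.map (φ : R →* S) s) (polMap φ v) := by
  have h : (AddMonoidAlgebra.mapRingHom (ℤ × ℤ × ℤ) φ).comp (scale s : Lau R →+* Lau R) =
      (scale (Units.map (φ : R →* S) s) : Lau S →+* Lau S).comp
        (AddMonoidAlgebra.mapRingHom (ℤ × ℤ × ℤ) φ) := by
    refine AddMonoidAlgebra.ringHom_ext (fun r => ?_) fun g => ?_
    · simp [scale_single]
    · simp [scale_single, ← map_zpow]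
  rw [dil_apply, dil_apply, polMap, MvPolynomial.map_map, MvPolynomial.map_map, h]

/-- It allows one operator over ℂ[q^{±1}] to be compared both with the action over ℂ(q) and with its
specialization at q = 1. -/
theorem polMap_xop (q : Rˣ) (c : Idx → R) (m : Idx) (v : Pol R) :
    polMap φ (xop q c m v) = xop (Units.map (φ : R →* S) q) (fun m => φ (c m)) m (polMap φ v) := by
  have h : polMap φ (dcoef c m) = dcoef (fun m => φ (c m)) m := by
    rw [dcoef, dcoef]
    split_ifs
    · exact map_zero _
    · rw [polMap_smul, map_sub, polMap_mon, polMap_mon]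
  rw [xop_apply, polMap_dil, wop, map_add, map_mul, map_mul, polMap_X, h, map_zpow, xop_apply, wop]
  rw [polMap, pderiv_map]

end BaseChange

end Heisenberg

/-! ### The representation of `Uq`, its lattice over ℂ[q^{±1}] and the symbol at q = 1 -/

namespace Heisenberg

open MvPolynomial

/-- Laurent polynomials in `q`. -/
abbrev Oq : Type := LaurentPolynomial ℂ

/-- The embedding of the Laurent polynomials in `q` in `ℂ(q)`. -/
def oq : Oq →ₐ[ℂ] Kq :=
  AddMonoidAlgebra.lift ℂ Kq ℤ
    { toFun := fun n => q ^ n.toAdd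
      map_one' := zpow_zero _
      map_mul' := fun _ _ => zpow_add₀ q_ne _ _ }

/-- The value at `q = 1`. -/
def oev : Oq →ₐ[ℂ] ℂ := AddMonoidAlgebra.lift ℂ ℂ ℤ 1

theorem oq_T (n : ℤ) : oq (LaurentPolynomial.T n) = q ^ n := by
  rw [oq, LaurentPolynomial.T, AddMonoidAlgebra.lift_single, one_smul]
  rfl

theorem oev_T (n : ℤ) : oev (LaurentPolynomial.T n) = 1 := by
  rw [oev, LaurentPolynomial.T, AddMonoidAlgebra.lift_single, one_smul]
  rfl

theorem oq_sum (p : Oq) : oq p = p.coeff.sum fun n c => RatFunc.C c * q ^ n :=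
  AddMonoidAlgebra.lift_apply' _ _

theorem oev_sum (p : Oq) : oev p = p.coeff.sum fun _ c => c := by
  refine (AddMonoidAlgebra.lift_apply' _ _).trans ?_
  simp

/-- A Laurent polynomial times a suitable power of the variable is a polynomial, and polynomials
embed in ℂ(q). -/
theorem oq_injective : Function.Injective oq := by
  refine (injective_iff_map_eq_zero oq).2 fun f hf => ?_
  obtain ⟨n, g, hg⟩ := LaurentPolynomial.exists_T_pow f
  have h1 : oq (Polynomial.toLaurent g) = algebraMap (Polynomial ℂ) Kq g := by
    have : (oq.comp Polynomial.toLaurentAlg) = IsScalarTower.toAlgHom ℂ (Polynomial ℂ) Kq := by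
      refine Polynomial.algHom_ext ?_
      change oq (Polynomial.toLaurent Polynomial.X) = algebraMap (Polynomial ℂ) Kq Polynomial.X
      rw [Polynomial.toLaurent_X, oq_T, zpow_one, RatFunc.algebraMap_X]
    exact DFunLike.congr_fun this g
  rw [hg, map_mul, hf, zero_mul] at h1
  have h2 : g = 0 := RatFunc.algebraMap_injective ℂ (h1.symm.trans (map_zero _).symm)
  rw [h2, map_zero] at hg
  exact (LaurentPolynomial.isUnit_T (R := ℂ) n).mul_left_eq_zero.1 hg.symm

/-- `q` as a unit in the ring of Laurent polynomials. -/
def qO : Oqˣ where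
  val := LaurentPolynomial.T 1
  inv := LaurentPolynomial.T (-1)
  val_inv := by rw [← LaurentPolynomial.T_add]; rfl
  inv_val := by rw [← LaurentPolynomial.T_add]; rfl

/-- The structure constants `(q ^ m - q ^ (-m)) / m`. -/
def cO (m : Idx) : Oq :=
  ((m.1 : ℂ)⁻¹) • (LaurentPolynomial.T m.1 - LaurentPolynomial.T (-m.1))

theorem cO_neg (m : Idx) : cO m.neg = cO m := by
  have : m.neg.1 = -m.1 := rfl
  rw [cO, cO, this, neg_neg, Int.cast_neg, inv_neg, neg_smul, ← smul_neg, neg_sub]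

theorem oev_cO (m : Idx) : oev (cO m) = 0 := by
  rw [cO, map_smul, map_sub, oev_T, oev_T, sub_self, smul_zero]

theorem oq_cO (m : Idx) : oq (cO m) = (q - q⁻¹) * (qint m / ((m : ℤ) : Kq)) := by
  have h := q_sub_ne
  rw [cO, map_smul, map_sub, oq_T, oq_T, qint, Algebra.smul_def, map_inv₀, map_intCast,
    mul_div_assoc', mul_div_cancel₀ _ h, div_eq_inv_mul]

/-- `q` as a unit of `ℂ(q)`. -/
def qK : Kqˣ := Units.map (oq : Oq →* Kq) qO

theorem qK_val : (qK : Kq) = q := (oq_T 1).trans (zpow_one _)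

theorem qK_zpow (n : ℤ) : ((qK ^ n : Kqˣ) : Kq) = q ^ n := by
  rw [Units.val_zpow_eq_zpow_val, qK_val]

/-- Multiplication by a Laurent monomial. -/
def mulMon (g : ℤ × ℤ × ℤ) : Module.End Kq (Pol Kq) := LinearMap.mulLeft Kq (mon Kq g)

theorem mulMon_apply (g : ℤ × ℤ × ℤ) (v : Pol Kq) : mulMon g v = mon Kq g * v := rfl

theorem mulMon_mul (g g' : ℤ × ℤ × ℤ) : mulMon g * mulMon g' = mulMon (g + g') := by
  refine LinearMap.ext fun v => ?_
  rw [Module.End.mul_apply, mulMon_apply, mulMon_apply, mulMon_apply, ← mul_assoc, mon_mul]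

theorem mulMon_zero : mulMon 0 = 1 := by
  refine LinearMap.ext fun v => ?_
  rw [mulMon_apply, mon_zero, one_mul, Module.End.one_apply]

theorem mulMon_pow (g : ℤ × ℤ × ℤ) (n : ℕ) : mulMon g ^ n = mulMon (n • g) := by
  induction n with
  | zero => rw [pow_zero, zero_smul, mulMon_zero]
  | succ n ih => rw [pow_succ, ih, mulMon_mul, succ_nsmul]

/-- The operator of `(q - q⁻¹) h_m` on polynomials over `ℂ(q)`. -/
def xK (m : Idx) : Module.End Kq (Pol Kq) := xop qK (fun m => oq (cO m)) m

theorem xK_mulMon (m : Idx) (g : ℤ × ℤ × ℤ) :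
    xK m * mulMon g = q ^ (2 * m.1 * g.1) • (mulMon g * xK m) := by
  refine LinearMap.ext fun v => ?_
  have := xop_mon_mul qK (fun m => oq (cO m)) m g v
  rw [qK_zpow] at this
  exact this

theorem xK_comm (m n : Idx) : xK m * xK n - xK n * xK m = if m.1 = -n.1 then
    oq (cO m) • (mulMon (0, 2 * m.1, 0) - mulMon (0, -(2 * m.1), 0)) else 0 := by
  refine LinearMap.ext fun v => ?_
  have := xop_comm qK (fun m => oq (cO m)) (fun m => by rw [cO_neg]) m n v
  rw [LinearMap.sub_apply, Module.End.mul_apply, Module.End.mul_apply]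
  refine this.trans ?_
  split_ifs
  · rw [LinearMap.smul_apply, LinearMap.sub_apply, mulMon_apply, mulMon_apply, sub_mul]
  · rfl

/-- The operators by which the generators act. -/
def opGen : Gen → Module.End Kq (Pol Kq)
  | .h m => (q - q⁻¹)⁻¹ • xK m
  | .Lam => mulMon (1, 0, 0)
  | .LamInv => mulMon (-1, 0, 0)
  | .Gam => mulMon (0, 1, 0)
  | .GamInv => mulMon (0, -1, 0)
  | .k => mulMon (0, 0, 1)
  | .kInv => mulMon (0, 0, -1)

theorem mulMon_comm_opGen (g : ℤ × ℤ × ℤ) (hg : g.1 = 0) (x : Gen) :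
    mulMon g * opGen x = opGen x * mulMon g := by
  cases x with
  | h m =>
    simp only [opGen]
    rw [smul_mul_assoc, xK_mulMon, hg, mul_zero, zpow_zero, one_smul, mul_smul_comm]
  | _ => simp only [opGen]; rw [mulMon_mul, mulMon_mul, add_comm]

theorem zp_mulMon (n : ℤ) :
    zp (mulMon (0, 1, 0)) (mulMon (0, -1, 0)) n = mulMon (0, n, 0) := by
  rw [zp, mulMon_pow, mulMon_pow, mulMon_mul]
  congr 1
  refine Prod.ext (by simp) (Prod.ext ?_ (by simp))
  simp only [Prod.snd_add, Prod.fst_add, Prod.smul_mk, nsmul_eq_mul]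
  omega

/-- The representation of the quantum Heisenberg algebra on polynomials. -/
def rho : Uq →ₐ[Kq] Module.End Kq (Pol Kq) :=
  lift opGen
    (by simp only [opGen]; rw [mulMon_mul, ← mulMon_zero]; rfl)
    (by simp only [opGen]; rw [mulMon_mul, ← mulMon_zero]; rfl)
    (by simp only [opGen]; rw [mulMon_mul, ← mulMon_zero]; rfl)
    (by simp only [opGen]; rw [mulMon_mul, ← mulMon_zero]; rfl)
    (by simp only [opGen]; rw [mulMon_mul, ← mulMon_zero]; rfl)
    (by simp only [opGen]; rw [mulMon_mul, ← mulMon_zero]; rfl)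
    (mulMon_comm_opGen _ rfl) (mulMon_comm_opGen _ rfl)
    (by
      intro m n
      have h := q_sub_ne
      simp only [opGen]
      rw [smul_mul_smul_comm, smul_mul_smul_comm]
      refine (smul_sub ((q - q⁻¹)⁻¹ * (q - q⁻¹)⁻¹) (xK m * xK n) (xK n * xK m)).symm.trans ?_
      rw [xK_comm, zp_mulMon, zp_mulMon]
      split_ifs
      -- Since `xK m` stands for (q - q⁻¹) h_m, its structure constant is (q - q⁻¹)² times that of
      -- the h_m.
      · rw [← mul_smul, oq_cO]
        congr 1
        generalize (q - q⁻¹ : Kq) = d at h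
        field_simp
      · rw [smul_zero])
    (by
      intro m
      simp only [opGen]
      rw [smul_mul_assoc, xK_mulMon, mul_smul_comm, mul_one, smul_comm])

theorem rho_u (x : Gen) : rho (u x) = opGen x := by
  change RingQuot.liftAlgHom Kq _ (RingQuot.mkAlgHom Kq Rel _) = _
  rw [RingQuot.liftAlgHom_mkAlgHom_apply]
  exact FreeAlgebra.lift_ι_apply _ _

theorem rho_hH (m : Idx) : rho (hH m) = xK m := by
  rw [hH, map_smul, rho_u, opGen, smul_inv_smul₀ q_sub_ne]

/-- The inclusion of the lattice. -/
def latK : Pol Oq →+* Pol Kq := polMap (oq : Oq →+* Kq)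

/-- The reduction of the lattice at `q = 1`. -/
def latC : Pol Oq →+* Pol ℂ := polMap (oev : Oq →+* ℂ)

theorem latK_injective : Function.Injective latK := polMap_injective _ oq_injective

/-- The operator by which `x` acts preserves the lattice, and is the multiplication by `a` at
`q = 1`. -/
def Reduces (x : Uq) (a : Pol ℂ) : Prop :=
  ∃ T : Pol Oq → Pol Oq, (∀ v, latK (T v) = rho x (latK v)) ∧ ∀ v, latC (T v) = a * latC v

/-- The vector `T 1` is determined by `x`, because the lattice embeds in the polynomials over ℂ(q),
and its reduction is the multiplier. The multiplier is therefore a function of `x`, which makes the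
symbol an algebra homomorphism. -/
theorem Reduces.unique {x : Uq} {a b : Pol ℂ} (ha : Reduces x a) (hb : Reduces x b) : a = b := by
  obtain ⟨T, h1, h2⟩ := ha
  obtain ⟨S, h3, h4⟩ := hb
  have : T 1 = S 1 := latK_injective ((h1 1).trans (h3 1).symm)
  have h5 := h2 1
  rwa [this, h4, map_one, mul_one, mul_one, eq_comm] at h5

theorem Reduces.add {x y : Uq} {a b : Pol ℂ} (ha : Reduces x a) (hb : Reduces y b) :
    Reduces (x + y) (a + b) := by
  obtain ⟨T, h1, h2⟩ := ha
  obtain ⟨S, h3, h4⟩ := hb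
  refine ⟨fun v => T v + S v, fun v => ?_, fun v => ?_⟩
  · rw [map_add, h1, h3, map_add, LinearMap.add_apply]
  · rw [map_add, h2, h4, add_mul]

theorem Reduces.mul {x y : Uq} {a b : Pol ℂ} (ha : Reduces x a) (hb : Reduces y b) :
    Reduces (x * y) (a * b) := by
  obtain ⟨T, h1, h2⟩ := ha
  obtain ⟨S, h3, h4⟩ := hb
  refine ⟨fun v => T (S v), fun v => ?_, fun v => ?_⟩
  · rw [h1, h3, map_mul, Module.End.mul_apply]
  · rw [h2, h4, mul_assoc]

theorem reduces_scalar (p : Oq) : Reduces (algebraMap Kq Uq (oq p)) (algebraMap ℂ _ (oev p)) := by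
  refine ⟨fun v => p • v, fun v => ?_, fun v => ?_⟩
  · rw [AlgHom.commutes, Module.algebraMap_end_apply]
    exact polMap_smul _ _ _
  · rw [← Algebra.smul_def]
    exact polMap_smul _ _ _

theorem reduces_algebraMap (c : ℂ) : Reduces (algebraMap ℂ Uq c) (algebraMap ℂ _ c) := by
  have := reduces_scalar (algebraMap ℂ Oq c)
  rwa [AlgHom.commutes, AlgHom.commutes, ← IsScalarTower.algebraMap_apply] at this

theorem reduces_mon {x : Gen} {g : ℤ × ℤ × ℤ} (h : opGen x = mulMon g) :
    Reduces (u x) (mon ℂ g) := by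
  refine ⟨fun v => mon Oq g * v, fun v => ?_, fun v => ?_⟩
  · rw [rho_u, h, mulMon_apply, map_mul, latK, polMap_mon]
  · rw [map_mul, latC, polMap_mon]

/-- At q = 1 the dilation is trivial and the structure constants (q^m - q^{-m})/m vanish, so of the
operator only the multiplication by X_m is left. -/
theorem reduces_hH (m : Idx) : Reduces (hH m) (X m) := by
  refine ⟨xop qO cO m, fun v => ?_, fun v => ?_⟩
  · rw [rho_hH]
    exact polMap_xop _ _ _ _ _
  · refine (polMap_xop _ _ _ _ _).trans ?_
    have h1 : Units.map ((oev : Oq →+* ℂ) : Oq →* ℂ) qO = 1 := Units.ext (oev_T 1)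
    have h2 : (fun m => (oev : Oq →+* ℂ) (cO m)) = 0 := funext oev_cO
    have h3 : dcoef (0 : Idx → ℂ) m = 0 := by
      rw [dcoef]
      split_ifs
      · rfl
      · exact zero_smul _ _
    rw [h1, h2, xop_apply, one_zpow, dil_one, wop, h3, zero_mul, add_zero]
    rfl

theorem exists_reduces (x : Uint) : ∃ a, Reduces x a := by
  obtain ⟨x, hx⟩ := x
  change ∃ a, Reduces x a
  induction hx using Algebra.adjoin_induction with
  | mem y hy =>
    simp only [intGen, Set.mem_union, Set.mem_insert_iff, Set.mem_singleton_iff,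
      Set.mem_range] at hy
    rcases hy with (rfl | rfl | rfl | rfl | rfl | rfl | rfl | rfl) | ⟨m, rfl⟩
    · exact ⟨_, by simpa only [oq_T, zpow_one] using reduces_scalar (LaurentPolynomial.T 1)⟩
    · exact ⟨_, by simpa only [oq_T, zpow_neg_one] using reduces_scalar (LaurentPolynomial.T (-1))⟩
    · exact ⟨_, reduces_mon rfl⟩
    · exact ⟨_, reduces_mon rfl⟩
    · exact ⟨_, reduces_mon rfl⟩
    · exact ⟨_, reduces_mon rfl⟩
    · exact ⟨_, reduces_mon rfl⟩
    · exact ⟨_, reduces_mon rfl⟩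
    · exact ⟨_, reduces_hH m⟩
  | algebraMap r => exact ⟨_, reduces_algebraMap r⟩
  | add y z _ _ h1 h2 =>
    obtain ⟨a, ha⟩ := h1
    obtain ⟨b, hb⟩ := h2
    exact ⟨_, ha.add hb⟩
  | mul y z _ _ h1 h2 =>
    obtain ⟨a, ha⟩ := h1
    obtain ⟨b, hb⟩ := h2
    exact ⟨_, ha.mul hb⟩

/-- The multiplier at `q = 1` of an element of the integral form. -/
def symbolInt : Uint →ₐ[ℂ] Pol ℂ where
  toFun x := (exists_reduces x).choose
  map_one' := (exists_reduces 1).choose_spec.unique (by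
    have := reduces_algebraMap 1
    rwa [map_one, map_one] at this)
  map_zero' := (exists_reduces 0).choose_spec.unique (by
    have := reduces_algebraMap 0
    rwa [map_zero, map_zero] at this)
  map_add' x y := (exists_reduces (x + y)).choose_spec.unique
    ((exists_reduces x).choose_spec.add (exists_reduces y).choose_spec)
  map_mul' x y := (exists_reduces (x * y)).choose_spec.unique
    ((exists_reduces x).choose_spec.mul (exists_reduces y).choose_spec)
  commutes' c := (exists_reduces (algebraMap ℂ Uint c)).choose_spec.unique (reduces_algebraMap c)

theorem reduces_symbolInt (x : Uint) : Reduces x (symbolInt x) := (exists_reduces x).choose_spec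

theorem symbolInt_eq {x : Uint} {a : Pol ℂ} (h : Reduces x a) : symbolInt x = a :=
  (reduces_symbolInt x).unique h

theorem symbolInt_qU : symbolInt qU = 1 := by
  refine symbolInt_eq ?_
  have := reduces_scalar (LaurentPolynomial.T 1)
  rwa [oq_T, oev_T, zpow_one, map_one] at this

/-- The isomorphism of `Z₁` with the polynomial ring, as a homomorphism. -/
def symbol : Z1 →ₐ[ℂ] Pol ℂ :=
  Ideal.Quotient.liftₐ specIdeal symbolInt fun x hx => by
    obtain ⟨y, rfl⟩ := mem_specIdeal.1 hx
    rw [map_mul, map_sub, map_one, symbolInt_qU, sub_self, mul_zero]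

theorem symbol_sp (x : Uint) : symbol (sp x) = symbolInt x := rfl

theorem symbol_zLam : symbol zLam = mon ℂ (1, 0, 0) := symbolInt_eq (reduces_mon rfl)
theorem symbol_zGam : symbol zGam = mon ℂ (0, 1, 0) := symbolInt_eq (reduces_mon rfl)
theorem symbol_zk : symbol zk = mon ℂ (0, 0, 1) := symbolInt_eq (reduces_mon rfl)
theorem symbol_zh (m : Idx) : symbol (zh m) = X m := symbolInt_eq (reduces_hH m)

end Heisenberg

/-! ### Generators of `Z1` and homomorphisms out of `Z1` -/

namespace Heisenberg

open MvPolynomial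

/-- The inverse of `Λ` in `Z₁`. -/
def zLamInv : Z1 := sp ⟨u .LamInv, mem_gen (by simp [intGen])⟩

/-- The inverse of `Γ` in `Z₁`. -/
def zGamInv : Z1 := sp ⟨u .GamInv, mem_gen (by simp [intGen])⟩

/-- The inverse of `k` in `Z₁`. -/
def zkInv : Z1 := sp ⟨u .kInv, mem_gen (by simp [intGen])⟩

theorem sp_mul_eq_one {x y : Uint} (h : x.1 * y.1 = 1) : sp x * sp y = 1 := by
  rw [← map_mul, ← map_one sp]
  exact congrArg sp (Subtype.ext h)

/-- `Λ` as a unit of `Z₁`. -/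
def zLamU : Z1ˣ := ⟨zLam, zLamInv, sp_mul_eq_one u_Lam_mul, sp_mul_eq_one u_mul_Lam⟩

/-- `Γ` as a unit of `Z₁`. -/
def zGamU : Z1ˣ := ⟨zGam, zGamInv, sp_mul_eq_one u_Gam_mul, sp_mul_eq_one u_mul_Gam⟩

/-- `k` as a unit of `Z₁`. -/
def zkU : Z1ˣ := ⟨zk, zkInv, sp_mul_eq_one u_k_mul, sp_mul_eq_one u_mul_k⟩

theorem sp_qU : sp qU = 1 := by
  rw [← map_one sp, sp_eq]
  exact Ideal.subset_span rfl

theorem sp_qInv : sp ⟨algebraMap Kq Uq q⁻¹, q_inv_mem⟩ = 1 := by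
  have h : sp qU * sp ⟨algebraMap Kq Uq q⁻¹, q_inv_mem⟩ = 1 := by
    refine sp_mul_eq_one ?_
    change algebraMap Kq Uq q * algebraMap Kq Uq q⁻¹ = 1
    rw [← map_mul, mul_inv_cancel₀ q_ne, map_one]
  rwa [sp_qU, one_mul] at h

/-- The remaining generators q and q⁻¹ of the integral form both reduce to 1. -/
theorem subalgebra_eq_top (S : Subalgebra ℂ Z1) (h1 : zLam ∈ S) (h1' : zLamInv ∈ S)
    (h2 : zGam ∈ S) (h2' : zGamInv ∈ S) (h3 : zk ∈ S) (h3' : zkInv ∈ S) (h4 : ∀ m, zh m ∈ S)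
    (x : Z1) : x ∈ S := by
  obtain ⟨⟨x, hx⟩, rfl⟩ := sp_surjective x
  induction hx using Algebra.adjoin_induction with
  | mem y hy =>
    have hy' := hy
    simp only [intGen, Set.mem_union, Set.mem_insert_iff, Set.mem_singleton_iff,
      Set.mem_range] at hy'
    rcases hy' with (rfl | rfl | rfl | rfl | rfl | rfl | rfl | rfl) | ⟨m, rfl⟩
    · exact (congrArg (· ∈ S) sp_qU).mpr (one_mem S)
    · exact (congrArg (· ∈ S) sp_qInv).mpr (one_mem S)
    · exact h1
    · exact h1'
    · exact h2
    · exact h2'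
    · exact h3
    · exact h3'
    · exact h4 m
  | algebraMap r => exact S.algebraMap_mem r
  | add y z hy hz h1 h2 => exact S.add_mem h1 h2
  | mul y z hy hz h1 h2 => exact S.mul_mem h1 h2

/-- The places where two derivations along φ agree form a subalgebra, and by the quotient rule
agreement on a unit implies agreement on its inverse. Identities between brackets are reduced to
generators in this way. -/
theorem derivation_ext {B : Type*} [CommRing B] [Algebra ℂ B] (φ : Z1 →ₐ[ℂ] B) {D E : Z1 →ₗ[ℂ] B}
    (hD : ∀ x y, D (x * y) = D x * φ y + φ x * D y) (hE : ∀ x y, E (x * y) = E x * φ y + φ x * E y)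
    (h1 : D zLam = E zLam) (h2 : D zGam = E zGam) (h3 : D zk = E zk) (h4 : ∀ m, D (zh m) = E (zh m)) :
    D = E := by
  have one : ∀ F : Z1 →ₗ[ℂ] B, (∀ x y, F (x * y) = F x * φ y + φ x * F y) → F 1 = 0 := by
    intro F hF
    have := hF 1 1
    rwa [map_one φ, mul_one, mul_one, one_mul, left_eq_add] at this
  have inv : ∀ F : Z1 →ₗ[ℂ] B, (∀ x y, F (x * y) = F x * φ y + φ x * F y) → ∀ u : Z1ˣ,
      F (u⁻¹ : Z1ˣ) = -(φ (u⁻¹ : Z1ˣ) * F u * φ (u⁻¹ : Z1ˣ)) := by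
    intro F hF u
    have e := hF u (u⁻¹ : Z1ˣ)
    rw [Units.mul_inv, one F hF] at e
    have e' : φ (u⁻¹ : Z1ˣ) * φ u = 1 := by rw [← map_mul, Units.inv_mul, map_one]
    linear_combination (-(φ (u⁻¹ : Z1ˣ))) * e - F (u⁻¹ : Z1ˣ) * e'
  have unit : ∀ u : Z1ˣ, D u = E u → D (u⁻¹ : Z1ˣ) = E (u⁻¹ : Z1ˣ) := by
    intro u h
    rw [inv D hD, inv E hE, h]
  let S : Subalgebra ℂ Z1 :=
    { carrier := {x | D x = E x}
      mul_mem' := by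
        intro x y (hx : D x = E x) (hy : D y = E y)
        change D (x * y) = E (x * y)
        rw [hD, hE, hx, hy]
      add_mem' := by
        intro x y (hx : D x = E x) (hy : D y = E y)
        change D (x + y) = E (x + y)
        rw [map_add, map_add, hx, hy]
      algebraMap_mem' := by
        intro r
        change D (algebraMap ℂ Z1 r) = E (algebraMap ℂ Z1 r)
        rw [Algebra.algebraMap_eq_smul_one, map_smul, map_smul, one D hD, one E hE] }
  exact LinearMap.ext fun x => subalgebra_eq_top S h1 (unit zLamU h1) h2 (unit zGamU h2) h3
    (unit zkU h3) h4 x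

theorem Z1_algHom_ext {B : Type*} [Semiring B] [Algebra ℂ B] {φ ψ : Z1 →ₐ[ℂ] B}
    (h1 : φ zLam = ψ zLam) (h2 : φ zGam = ψ zGam) (h3 : φ zk = ψ zk)
    (h4 : ∀ m, φ (zh m) = ψ (zh m)) : φ = ψ := by
  have unit : ∀ u : Z1ˣ, φ u = ψ u → φ (u⁻¹ : Z1ˣ) = ψ (u⁻¹ : Z1ˣ) := by
    intro u h
    have : Units.map (φ : Z1 →* B) u = Units.map (ψ : Z1 →* B) u := Units.ext h
    have := congrArg (fun v : Bˣ => ((v⁻¹ : Bˣ) : B)) this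
    simp only [← map_inv, Units.coe_map] at this
    exact this
  exact AlgHom.ext fun x => subalgebra_eq_top (AlgHom.equalizer φ ψ) h1 (unit zLamU h1) h2
    (unit zGamU h2) h3 (unit zkU h3) h4 x

section Lift

variable {B : Type*} [CommRing B] [Algebra ℂ B]

/-- Algebra homomorphisms out of the Laurent polynomials. -/
def lauLift (l g k : Bˣ) : Lau ℂ →ₐ[ℂ] B :=
  AddMonoidAlgebra.lift ℂ B (ℤ × ℤ × ℤ)
    { toFun := fun e => ((l ^ e.toAdd.1 * g ^ e.toAdd.2.1 * k ^ e.toAdd.2.2 : Bˣ) : B)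
      map_one' := by simp
      map_mul' := fun e e' => by
        rw [← Units.val_mul]
        congr 1
        simp only [toAdd_mul, Prod.fst_add, Prod.snd_add, zpow_add]
        simp only [mul_assoc, mul_left_comm] }

theorem lauLift_single (l g k : Bˣ) (e : ℤ × ℤ × ℤ) (c : ℂ) :
    lauLift l g k (AddMonoidAlgebra.single e c) =
      c • ((l ^ e.1 * g ^ e.2.1 * k ^ e.2.2 : Bˣ) : B) :=
  AddMonoidAlgebra.lift_single _ _ _

/-- Algebra homomorphisms out of the polynomial ring. -/
def polLift (l g k : Bˣ) (h : Idx → B) : Pol ℂ →ₐ[ℂ] B :=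
  { eval₂Hom (lauLift l g k : Lau ℂ →+* B) h with
    commutes' := fun r => by
      change eval₂Hom (lauLift l g k : Lau ℂ →+* B) h (C (algebraMap ℂ (Lau ℂ) r)) = _
      rw [eval₂Hom_C]
      exact (lauLift l g k).commutes r }

variable (l g k : Bˣ) (h : Idx → B)

theorem polLift_X (m : Idx) : polLift l g k h (X m) = h m := eval₂Hom_X' _ _ _

theorem polLift_C (s : Lau ℂ) : polLift l g k h (C s) = lauLift l g k s := eval₂Hom_C _ _ _

theorem polLift_mon (e : ℤ × ℤ × ℤ) :
    polLift l g k h (mon ℂ e) = ((l ^ e.1 * g ^ e.2.1 * k ^ e.2.2 : Bˣ) : B) :=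
  (polLift_C l g k h _).trans ((lauLift_single l g k e 1).trans (one_smul _ _))

/-- Algebra homomorphisms out of `Z₁`. -/
def Z1lift : Z1 →ₐ[ℂ] B := (polLift l g k h).comp symbol

theorem Z1lift_zLam : Z1lift l g k h zLam = l := by
  rw [Z1lift, AlgHom.comp_apply, symbol_zLam, polLift_mon]
  simp

theorem Z1lift_zGam : Z1lift l g k h zGam = g := by
  rw [Z1lift, AlgHom.comp_apply, symbol_zGam, polLift_mon]
  simp

theorem Z1lift_zk : Z1lift l g k h zk = k := by
  rw [Z1lift, AlgHom.comp_apply, symbol_zk, polLift_mon]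
  simp

theorem Z1lift_zh (m : Idx) : Z1lift l g k h (zh m) = h m := by
  rw [Z1lift, AlgHom.comp_apply, symbol_zh, polLift_X]

theorem map_zpow_unit {A B : Type*} [Ring A] [Algebra ℂ A] [Ring B] [Algebra ℂ B] (φ : A →ₐ[ℂ] B) {v : Aˣ} {w : Bˣ}
    (e : φ v = w) (n : ℤ) : φ ((v ^ n : Aˣ) : A) = ((w ^ n : Bˣ) : B) := by
  have : Units.map (φ : A →* B) v = w := Units.ext e
  rw [← this, ← map_zpow]
  rfl

theorem Z1lift_zGamU_zpow (n : ℤ) : Z1lift l g k h ((zGamU ^ n : Z1ˣ) : Z1) = ((g ^ n : Bˣ) : B) :=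
  map_zpow_unit _ (Z1lift_zGam l g k h) n

end Lift

/-- Sending the variables of the polynomial ring to the generators of `Z1` gives a left inverse,
since the composite fixes generators. With this, `Z1` is seen to have no hidden relations, and
elements of `Z1` can be compared through their symbols. -/
theorem symbol_injective : Function.Injective symbol := by
  have : (polLift zLamU zGamU zkU zh).comp symbol = AlgHom.id ℂ Z1 :=
    Z1_algHom_ext (Z1lift_zLam _ _ _ _) (Z1lift_zGam _ _ _ _) (Z1lift_zk _ _ _ _)
      (Z1lift_zh _ _ _ _)
  exact Function.LeftInverse.injective (g := polLift zLamU zGamU zkU zh) (DFunLike.congr_fun this)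

end Heisenberg

/-! ### The Poisson bracket on a tensor square -/

section TensorBracket

variable {A : Type} [CommRing A] [Algebra ℂ A]

theorem eq_zero_of_eq_neg {M : Type*} [AddCommGroup M] [Module ℂ M] {x : M} (h : x = -x) :
    x = 0 := by
  have h2 : (2 : ℂ) • x = 0 := by
    rw [two_smul]
    nth_rw 1 [h]
    exact neg_add_cancel x
  exact (smul_eq_zero.1 h2).resolve_left two_ne_zero

/-- The bracket on the tensor square of a Poisson algebra. -/
def tensorBracket (br : A →ₗ[ℂ] A →ₗ[ℂ] A) : A ⊗[ℂ] A →ₗ[ℂ] A ⊗[ℂ] A →ₗ[ℂ] A ⊗[ℂ] A :=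
  TensorProduct.map₂ (LinearMap.mul ℂ A) br + TensorProduct.map₂ br (LinearMap.mul ℂ A)

variable (br : A →ₗ[ℂ] A →ₗ[ℂ] A)

theorem tensorBracket_tmul (a b c d : A) : tensorBracket br (a ⊗ₜ b) (c ⊗ₜ d) =
    (a * c) ⊗ₜ br b d + br a c ⊗ₜ (b * d) := rfl

theorem tensorBracket_mul (hbr : ∀ a b c, br a (b * c) = br a b * c + b * br a c)
    (s t t' : A ⊗[ℂ] A) :
    tensorBracket br s (t * t') = tensorBracket br s t * t' + t * tensorBracket br s t' := by
  induction s with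
  | zero => simp
  | add x y hx hy => rw [map_add, LinearMap.add_apply, hx, hy]; simp only [LinearMap.add_apply]; ring
  | tmul a b =>
    induction t with
    | zero => simp
    | add x y hx hy => rw [add_mul, map_add, hx, hy, map_add]; ring
    | tmul c d =>
      induction t' with
      | zero => simp
      | add x y hx hy => rw [mul_add, map_add, hx, hy, map_add]; ring
      | tmul e f =>
        simp only [Algebra.TensorProduct.tmul_mul_tmul, tensorBracket_tmul, hbr, add_mul, mul_add,
          TensorProduct.add_tmul, TensorProduct.tmul_add]
        rw [mul_assoc a, mul_assoc b, mul_left_comm a, mul_left_comm b]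
        abel

theorem tensorBracket_swap (hbr : ∀ a b, br a b = -br b a) (s t : A ⊗[ℂ] A) :
    tensorBracket br s t = -tensorBracket br t s := by
  induction s with
  | zero => simp
  | add x y hx hy => rw [map_add, LinearMap.add_apply, hx, hy, map_add, neg_add]
  | tmul a b =>
    induction t with
    | zero => simp
    | add x y hx hy => rw [map_add, hx, hy, map_add, LinearMap.add_apply, neg_add]
    | tmul c d =>
      rw [tensorBracket_tmul, tensorBracket_tmul, hbr b d, hbr a c, mul_comm a, mul_comm b,
        TensorProduct.tmul_neg, TensorProduct.neg_tmul, neg_add]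

theorem tensorBracket_central {g : A} (hg : ∀ a, br g a = 0) (t : A ⊗[ℂ] A) :
    tensorBracket br (g ⊗ₜ g) t = 0 := by
  induction t with
  | zero => exact map_zero _
  | add x y hx hy => rw [map_add, hx, hy, add_zero]
  | tmul a b =>
    rw [tensorBracket_tmul, hg, hg, TensorProduct.tmul_zero, TensorProduct.zero_tmul, add_zero]

end TensorBracket

/-! ### The Poisson Hopf structure of `Z1` -/

namespace Heisenberg

abbrev semiringZ : Semiring Z1 := inferInstance
abbrev commSemiringZ : CommSemiring Z1 := inferInstance
abbrev ringZ : Ring Z1 := inferInstance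
abbrev addCommMonoidZ : AddCommMonoid Z1 := inferInstance
abbrev addCommGroupZ : AddCommGroup Z1 := inferInstance
abbrev algebraZ : Algebra ℂ Z1 := inferInstance
abbrev moduleZ : Module ℂ Z1 := inferInstance
abbrev semiringZZ : Semiring (Z1 ⊗[ℂ] Z1) := inferInstance
abbrev commRingZZ : CommRing (Z1 ⊗[ℂ] Z1) := inferInstance
abbrev addCommMonoidZZ : AddCommMonoid (Z1 ⊗[ℂ] Z1) := inferInstance
abbrev addCommGroupZZ : AddCommGroup (Z1 ⊗[ℂ] Z1) := inferInstance
abbrev algebraZZ : Algebra ℂ (Z1 ⊗[ℂ] Z1) := inferInstance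
abbrev moduleZZ : Module ℂ (Z1 ⊗[ℂ] Z1) := inferInstance

attribute [local instance] semiringZ commSemiringZ ringZ addCommMonoidZ addCommGroupZ algebraZ moduleZ
  semiringZZ commRingZZ addCommMonoidZZ addCommGroupZZ algebraZZ moduleZZ

theorem dc_smul (c : ℂ) (x y : Uq) : dc x (c • y) = c • dc x y := by
  rw [dc, dc, mul_smul_comm, smul_mul_assoc, ← smul_sub, smul_comm]

theorem bracket_swap (a b : Z1) : bracket a b = -bracket b a := by
  obtain ⟨x, rfl⟩ := sp_surjective a
  obtain ⟨y, rfl⟩ := sp_surjective b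
  rw [bracket_sp, bracket_sp, ← map_neg]
  exact congrArg sp (Subtype.ext (dc_swap _ _))

theorem bracket_add (a b c : Z1) : bracket a (b + c) = bracket a b + bracket a c := by
  obtain ⟨x, rfl⟩ := sp_surjective a
  obtain ⟨y, rfl⟩ := sp_surjective b
  obtain ⟨z, rfl⟩ := sp_surjective c
  rw [← map_add, bracket_sp, bracket_sp, bracket_sp, ← map_add]
  exact congrArg sp (Subtype.ext (dc_add _ _ _))

theorem bracket_smul (r : ℂ) (a b : Z1) : bracket a (r • b) = r • bracket a b := by
  obtain ⟨x, rfl⟩ := sp_surjective a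
  obtain ⟨y, rfl⟩ := sp_surjective b
  rw [← map_smul, bracket_sp, bracket_sp, ← map_smul]
  exact congrArg sp (Subtype.ext (dc_smul _ _ _))

theorem bracket_mul (a b c : Z1) : bracket a (b * c) = bracket a b * c + b * bracket a c := by
  obtain ⟨x, rfl⟩ := sp_surjective a
  obtain ⟨y, rfl⟩ := sp_surjective b
  obtain ⟨z, rfl⟩ := sp_surjective c
  rw [← map_mul, bracket_sp, bracket_sp, bracket_sp, ← map_mul, ← map_mul, ← map_add]
  exact congrArg sp (Subtype.ext (dc_mul _ _ _))

/-- The identity holds before reduction: on lifts the iterated bracket is a scalar times an iterated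
commutator in an associative algebra. -/
theorem bracket_jacobi (a b c : Z1) :
    bracket a (bracket b c) + bracket b (bracket c a) + bracket c (bracket a b) = 0 := by
  obtain ⟨x, rfl⟩ := sp_surjective a
  obtain ⟨y, rfl⟩ := sp_surjective b
  obtain ⟨z, rfl⟩ := sp_surjective c
  simp only [bracket_sp, ← map_add]
  rw [← map_zero sp]
  refine congrArg sp (Subtype.ext ?_)
  change dc x.1 (dc y.1 z.1) + dc y.1 (dc z.1 x.1) + dc z.1 (dc x.1 y.1) = 0
  simp only [dc, mul_smul_comm, smul_mul_assoc, ← smul_sub, ← smul_add]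
  rw [smul_eq_zero]
  refine Or.inr ?_
  rw [smul_eq_zero]
  refine Or.inr ?_
  noncomm_ring

/-- The semiclassical bracket as a bilinear map. -/
def bracketL : Z1 →ₗ[ℂ] Z1 →ₗ[ℂ] Z1 :=
  LinearMap.mk₂ ℂ bracket
    (fun a b c => by rw [bracket_swap, bracket_add, neg_add, ← bracket_swap, ← bracket_swap])
    (fun r a b => by rw [bracket_swap, bracket_smul, ← smul_neg, ← bracket_swap])
    bracket_add (fun r a b => bracket_smul r a b)

theorem bracket_self (a : Z1) : bracket a a = 0 := eq_zero_of_eq_neg (bracket_swap a a)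

theorem bracket_mul_left (a b c : Z1) : bracket (a * b) c = bracket a c * b + a * bracket b c := by
  rw [bracket_swap, bracket_mul, bracket_swap c, bracket_swap c]
  ring

theorem bracket_zGam (a : Z1) : bracket zGam a = 0 := by
  obtain ⟨x, rfl⟩ := sp_surjective a
  rw [zGam, bracket_sp, ← map_zero sp]
  exact congrArg sp (Subtype.ext (dc_comm (gamU_comm x.1)))

theorem bracket_zk (a : Z1) : bracket zk a = 0 := by
  obtain ⟨x, rfl⟩ := sp_surjective a
  rw [zk, bracket_sp, ← map_zero sp]
  exact congrArg sp (Subtype.ext (dc_comm (k_comm x.1)))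

/-- `q ^ n` as an element of the integral form. -/
def qpow (n : ℤ) : Uint := ⟨algebraMap Kq Uq (q ^ n), q_zpow_mem n⟩

/-- `[m]_q` as an element of the integral form. -/
def qintU (m : ℤ) : Uint := ⟨algebraMap Kq Uq (qint m), qint_mem m⟩

theorem sp_qpow (n : ℤ) : sp (qpow n) = 1 := by
  refine symbol_injective ?_
  rw [symbol_sp, map_one]
  refine symbolInt_eq ?_
  have := reduces_scalar (LaurentPolynomial.T n)
  rwa [oq_T, oev_T, map_one] at this

/-- At q = 1 the recursion [m+1]_q = q [m]_q + q^{-m} becomes that of the integers. -/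
theorem sp_qintU (m : ℤ) : sp (qintU m) = algebraMap ℂ Z1 m := by
  have succ : ∀ m, sp (qintU (m + 1)) = sp (qintU m) + 1 := by
    intro m
    have : qintU (m + 1) = qU * qintU m + qpow (-m) := by
      refine Subtype.ext ?_
      change algebraMap Kq Uq _ = algebraMap Kq Uq _ * algebraMap Kq Uq _ + algebraMap Kq Uq _
      rw [← map_mul, ← map_add, qint_succ]
    rw [this, map_add, map_mul, sp_qU, sp_qpow, one_mul]
  induction m using Int.induction_on with
  | zero =>
    have : qintU 0 = 0 := Subtype.ext (by
      change algebraMap Kq Uq _ = 0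
      rw [qint_zero, map_zero])
    rw [this, map_zero, Int.cast_zero, map_zero]
  | succ n ih => rw [succ, ih, Int.cast_add, Int.cast_one, map_add, map_one]
  | pred n ih =>
    have := succ (-n - 1)
    rw [sub_add_cancel, ih] at this
    rw [← sub_eq_iff_eq_add.2 this, Int.cast_sub, map_sub, Int.cast_one, map_one]

/-- `Γ` as a unit of the integral form. -/
def gamInt : Uintˣ where
  val := ⟨u .Gam, mem_gen (by simp [intGen])⟩
  inv := ⟨u .GamInv, mem_gen (by simp [intGen])⟩
  val_inv := Subtype.ext u_Gam_mul
  inv_val := Subtype.ext u_mul_Gam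

theorem val_gamInt_zpow (n : ℤ) : ((gamInt ^ n : Uintˣ) : Uint).1 = gp n :=
  map_zpow_unit (w := gamU) Uint.val rfl n

theorem sp_gamInt_zpow (n : ℤ) : sp ((gamInt ^ n : Uintˣ) : Uint) = ((zGamU ^ n : Z1ˣ) : Z1) :=
  map_zpow_unit sp rfl n

/-- The divided commutator has the coefficient [m]_q / m, which becomes 1 at q = 1. -/
theorem bracket_zh_zh (m n : Idx) : bracket (zh m) (zh n) = if m.1 = -n.1 then
    ((zGamU ^ (2 * m.1) : Z1ˣ) : Z1) - ((zGamU ^ (-(2 * m.1)) : Z1ˣ) : Z1) else 0 := by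
  rw [zh, zh, bracket_sp]
  split_ifs with h
  · have : dcInt ⟨hH m, mem_gen (by simp [intGen])⟩ ⟨hH n, mem_gen (by simp [intGen])⟩ =
        ((m.1 : ℂ)⁻¹) • (qintU m * (((gamInt ^ (2 * m.1) : Uintˣ) : Uint) -
          ((gamInt ^ (-(2 * m.1)) : Uintˣ) : Uint))) := by
      refine Subtype.ext ?_
      change dc (hH m) (hH n) = ((m.1 : ℂ)⁻¹) • (algebraMap Kq Uq (qint m) *
        (((gamInt ^ (2 * m.1) : Uintˣ) : Uint).1 - ((gamInt ^ (-(2 * m.1)) : Uintˣ) : Uint).1))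
      rw [val_gamInt_zpow, val_gamInt_zpow, dc_hH_hH, if_pos h, ← Algebra.smul_def,
        ← algebraMap_smul Kq ((m.1 : ℂ)⁻¹), ← mul_smul, map_inv₀, map_intCast, div_eq_inv_mul]
    rw [this, map_smul, map_mul, map_sub, sp_qintU, sp_gamInt_zpow, sp_gamInt_zpow,
      ← Algebra.smul_def, inv_smul_smul₀ (Int.cast_ne_zero.2 m.2)]
  · rw [← map_zero sp]
    refine congrArg sp (Subtype.ext ?_)
    exact (dc_hH_hH m n).trans (if_neg h)

/-- The factor (q^{2m} - 1)/(q - q⁻¹) = q^m [m]_q becomes m. -/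
theorem bracket_zh_zLam (m : Idx) : bracket (zh m) zLam = (m.1 : ℂ) • (zLam * zh m) := by
  have : dcInt ⟨hH m, mem_gen (by simp [intGen])⟩ ⟨u .Lam, mem_gen (by simp [intGen])⟩ =
      qpow m * (qintU m *
        (⟨u .Lam, mem_gen (by simp [intGen])⟩ * ⟨hH m, mem_gen (by simp [intGen])⟩)) := by
    refine Subtype.ext ?_
    change dc (hH m) (u .Lam) = algebraMap Kq Uq (q ^ m.1) * (algebraMap Kq Uq (qint m) *
        (u .Lam * hH m))
    rw [dc_hH_Lam, Algebra.smul_def, map_mul, mul_assoc]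
  rw [zh, zLam, bracket_sp, this, map_mul, map_mul, map_mul, sp_qintU, sp_qpow, one_mul,
    Algebra.smul_def]

/-- The group-like element `u ⊗ u`. -/
def dblU (v : Z1ˣ) : (Z1 ⊗[ℂ] Z1)ˣ :=
  ⟨(v : Z1) ⊗ₜ (v : Z1), ((v⁻¹ : Z1ˣ) : Z1) ⊗ₜ ((v⁻¹ : Z1ˣ) : Z1),
    by rw [Algebra.TensorProduct.tmul_mul_tmul, Units.mul_inv]; rfl,
    by rw [Algebra.TensorProduct.tmul_mul_tmul, Units.inv_mul]; rfl⟩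

theorem dblU_zpow (v : Z1ˣ) (n : ℤ) :
    ((dblU v ^ n : (Z1 ⊗[ℂ] Z1)ˣ) : Z1 ⊗[ℂ] Z1) = ((v ^ n : Z1ˣ) : Z1) ⊗ₜ ((v ^ n : Z1ˣ) : Z1) := by
  let f : Z1ˣ →* (Z1 ⊗[ℂ] Z1)ˣ :=
    { toFun := dblU
      map_one' := rfl
      map_mul' := fun a b => Units.ext (Algebra.TensorProduct.tmul_mul_tmul _ _ _ _).symm }
  exact congrArg Units.val (map_zpow f v n).symm

/-- `Γ ^ n` in `Z₁`. -/
def zG (n : ℤ) : Z1 := ((zGamU ^ n : Z1ˣ) : Z1)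

theorem zG_mul (m n : ℤ) : zG m * zG n = zG (m + n) := by
  rw [zG, zG, zG, zpow_add, Units.val_mul]

/-- The coproduct of `Z₁`. -/
def comulZ : Z1 →ₐ[ℂ] Z1 ⊗[ℂ] Z1 :=
  Z1lift (dblU zLamU) (dblU zGamU) (dblU zkU)
    fun m => zh m ⊗ₜ zG (-|m.1|) + zG |m.1| ⊗ₜ zh m

theorem comulZ_zLam : comulZ zLam = zLam ⊗ₜ zLam := Z1lift_zLam _ _ _ _
theorem comulZ_zGam : comulZ zGam = zGam ⊗ₜ zGam := Z1lift_zGam _ _ _ _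
theorem comulZ_zk : comulZ zk = zk ⊗ₜ zk := Z1lift_zk _ _ _ _
theorem comulZ_zh (m : Idx) : comulZ (zh m) = zh m ⊗ₜ zG (-|m.1|) + zG |m.1| ⊗ₜ zh m :=
  Z1lift_zh _ _ _ _ m
theorem comulZ_zG (n : ℤ) : comulZ (zG n) = zG n ⊗ₜ zG n :=
  (Z1lift_zGamU_zpow _ _ _ _ n).trans (dblU_zpow _ _)

/-- The counit of `Z₁`. -/
def counitZ : Z1 →ₐ[ℂ] ℂ := Z1lift 1 1 1 fun _ => 0

theorem counitZ_zLam : counitZ zLam = 1 := Z1lift_zLam _ _ _ _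
theorem counitZ_zGam : counitZ zGam = 1 := Z1lift_zGam _ _ _ _
theorem counitZ_zk : counitZ zk = 1 := Z1lift_zk _ _ _ _
theorem counitZ_zh (m : Idx) : counitZ (zh m) = 0 := Z1lift_zh _ _ _ _ m
theorem counitZ_zG (n : ℤ) : counitZ (zG n) = 1 :=
  (Z1lift_zGamU_zpow _ _ _ _ n).trans (by rw [one_zpow, Units.val_one])

/-- The antipode of `Z₁`. -/
def antipodeZ : Z1 →ₐ[ℂ] Z1 := Z1lift zLamU⁻¹ zGamU⁻¹ zkU⁻¹ fun m => -zh m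

theorem antipodeZ_zLam : antipodeZ zLam = zLamInv := Z1lift_zLam _ _ _ _
theorem antipodeZ_zGam : antipodeZ zGam = zGamInv := Z1lift_zGam _ _ _ _
theorem antipodeZ_zk : antipodeZ zk = zkInv := Z1lift_zk _ _ _ _
theorem antipodeZ_zh (m : Idx) : antipodeZ (zh m) = -zh m := Z1lift_zh _ _ _ _ m
theorem antipodeZ_zG (n : ℤ) : antipodeZ (zG n) = zG (-n) :=
  (Z1lift_zGamU_zpow _ _ _ _ n).trans (by rw [inv_zpow']; rfl)

theorem comulZ_coassoc (a : Z1) :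
    TensorProduct.assoc ℂ Z1 Z1 Z1 (comulZ.toLinearMap.rTensor Z1 (comulZ a)) =
      comulZ.toLinearMap.lTensor Z1 (comulZ a) := by
  have : ((Algebra.TensorProduct.assoc ℂ ℂ ℂ Z1 Z1 Z1).toAlgHom.comp
      (Algebra.TensorProduct.map comulZ (AlgHom.id ℂ Z1))).comp comulZ =
      (Algebra.TensorProduct.map (AlgHom.id ℂ Z1) comulZ).comp comulZ := by
    refine Z1_algHom_ext ?_ ?_ ?_ fun m => ?_ <;>
    simp [comulZ_zLam, comulZ_zGam, comulZ_zk, comulZ_zh, comulZ_zG, TensorProduct.add_tmul,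
      TensorProduct.tmul_add, add_assoc]
  exact DFunLike.congr_fun this a

theorem counitZ_left (a : Z1) : counitZ.toLinearMap.rTensor Z1 (comulZ a) = 1 ⊗ₜ a := by
  have : (Algebra.TensorProduct.map counitZ (AlgHom.id ℂ Z1)).comp comulZ =
      Algebra.TensorProduct.includeRight := by
    refine Z1_algHom_ext ?_ ?_ ?_ fun m => ?_ <;>
    simp [comulZ_zLam, comulZ_zGam, comulZ_zk, comulZ_zh, counitZ_zLam, counitZ_zGam, counitZ_zk,
      counitZ_zh, counitZ_zG]
  exact DFunLike.congr_fun this a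

theorem counitZ_right (a : Z1) : counitZ.toLinearMap.lTensor Z1 (comulZ a) = a ⊗ₜ 1 := by
  have : (Algebra.TensorProduct.map (AlgHom.id ℂ Z1) counitZ).comp comulZ =
      Algebra.TensorProduct.includeLeft := by
    refine Z1_algHom_ext ?_ ?_ ?_ fun m => ?_ <;>
    simp [comulZ_zLam, comulZ_zGam, comulZ_zk, comulZ_zh, counitZ_zLam, counitZ_zGam, counitZ_zk,
      counitZ_zh, counitZ_zG]
  exact DFunLike.congr_fun this a

theorem zLamInv_mul : zLamInv * zLam = 1 := zLamU.inv_mul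
theorem zGamInv_mul : zGamInv * zGam = 1 := zGamU.inv_mul
theorem zkInv_mul : zkInv * zk = 1 := zkU.inv_mul

theorem antipodeZ_left (a : Z1) : LinearMap.mul' ℂ Z1 (antipodeZ.toLinearMap.rTensor Z1 (comulZ a)) =
    algebraMap ℂ Z1 (counitZ a) := by
  have : ((Algebra.TensorProduct.lmul' ℂ).comp
      (Algebra.TensorProduct.map antipodeZ (AlgHom.id ℂ Z1))).comp comulZ =
      (Algebra.ofId ℂ Z1).comp counitZ := by
    refine Z1_algHom_ext ?_ ?_ ?_ fun m => ?_ <;>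
    simp [comulZ_zLam, comulZ_zGam, comulZ_zk, comulZ_zh, counitZ_zLam, counitZ_zGam, counitZ_zk,
      counitZ_zh, antipodeZ_zLam, antipodeZ_zGam, antipodeZ_zk, antipodeZ_zh, antipodeZ_zG,
      zLamInv_mul, zGamInv_mul, zkInv_mul, mul_comm (zG _)]
  exact DFunLike.congr_fun this a

theorem antipodeZ_right (a : Z1) :
    LinearMap.mul' ℂ Z1 (antipodeZ.toLinearMap.lTensor Z1 (comulZ a)) =
      algebraMap ℂ Z1 (counitZ a) := by
  have : ((Algebra.TensorProduct.lmul' ℂ).comp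
      (Algebra.TensorProduct.map (AlgHom.id ℂ Z1) antipodeZ)).comp comulZ =
      (Algebra.ofId ℂ Z1).comp counitZ := by
    refine Z1_algHom_ext ?_ ?_ ?_ fun m => ?_ <;>
    simp [comulZ_zLam, comulZ_zGam, comulZ_zk, comulZ_zh, counitZ_zLam, counitZ_zGam, counitZ_zk,
      counitZ_zh, antipodeZ_zLam, antipodeZ_zGam, antipodeZ_zk, antipodeZ_zh, antipodeZ_zG,
      mul_comm _ zLamInv, mul_comm _ zGamInv, mul_comm _ zkInv,
      zLamInv_mul, zGamInv_mul, zkInv_mul, mul_comm (zG _)]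
  exact DFunLike.congr_fun this a

/-- The bracket on the tensor square. -/
def bracket₂ : Z1 ⊗[ℂ] Z1 →ₗ[ℂ] Z1 ⊗[ℂ] Z1 →ₗ[ℂ] Z1 ⊗[ℂ] Z1 :=
  tensorBracket bracketL

theorem bracket₂_tmul (a b c d : Z1) : bracket₂ (a ⊗ₜ b) (c ⊗ₜ d) =
    (a * c) ⊗ₜ bracket b d + bracket a c ⊗ₜ (b * d) := rfl

theorem bracket₂_mul (s t t' : Z1 ⊗[ℂ] Z1) :
    bracket₂ s (t * t') = bracket₂ s t * t' + t * bracket₂ s t' :=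
  tensorBracket_mul bracketL bracket_mul s t t'

theorem bracket₂_swap (s t : Z1 ⊗[ℂ] Z1) : bracket₂ s t = -bracket₂ t s :=
  tensorBracket_swap bracketL bracket_swap s t

theorem bracket₂_mul_left (s s' t : Z1 ⊗[ℂ] Z1) :
    bracket₂ (s * s') t = bracket₂ s t * s' + s * bracket₂ s' t := by
  rw [bracket₂_swap, bracket₂_mul, bracket₂_swap t, bracket₂_swap t, neg_add, neg_mul, mul_neg,
    neg_neg, neg_neg]

theorem bracket₂_central {g : Z1} (hg : ∀ a, bracket g a = 0) (t : Z1 ⊗[ℂ] Z1) :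
    bracket₂ (g ⊗ₜ g) t = 0 := tensorBracket_central bracketL hg t

theorem bracket_zG (n : ℤ) (a : Z1) : bracket (zG n) a = 0 := by
  obtain ⟨x, rfl⟩ := sp_surjective a
  rw [zG, ← sp_gamInt_zpow, bracket_sp, ← map_zero sp]
  refine congrArg sp (Subtype.ext (dc_comm ?_))
  rw [val_gamInt_zpow]
  exact gp_comm n x.1

theorem bracket_zG_right (n : ℤ) (a : Z1) : bracket a (zG n) = 0 := by
  rw [bracket_swap, bracket_zG, neg_zero]

/-- The cross terms vanish because the powers of Γ are Poisson central. For n = -m what remains is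
(Γ^{2m} - Γ^{-2m}) ⊗ Γ^{-2|m|} + Γ^{2|m|} ⊗ (Γ^{2m} - Γ^{-2m}). It telescopes to the coproduct of
Γ^{2m} - Γ^{-2m}, the cancelling pair depending on the sign of m. -/
theorem comulZ_bracket_zh_zh (m n : Idx) :
    comulZ (bracket (zh m) (zh n)) = bracket₂ (comulZ (zh m)) (comulZ (zh n)) := by
  rw [comulZ_zh, comulZ_zh, map_add, map_add, LinearMap.add_apply, LinearMap.add_apply]
  simp only [bracket₂_tmul, bracket_zG, bracket_zG_right, TensorProduct.tmul_zero,
    TensorProduct.zero_tmul, zG_mul, zero_add, add_zero]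
  rw [bracket_zh_zh]
  split_ifs with h
  · change comulZ (zG _ - zG _) = (zG _ - zG _) ⊗ₜ _ + _ ⊗ₜ (zG _ - zG _)
    obtain rfl : n = m.neg := by rw [Idx.eq_neg_iff.1 h, Idx.neg_neg]
    have e : m.neg.1 = -m.1 := rfl
    rw [map_sub, comulZ_zG, comulZ_zG, e, abs_neg, TensorProduct.sub_tmul, TensorProduct.tmul_sub]
    rcases abs_cases m.1 with ⟨h1, _⟩ | ⟨h1, _⟩ <;>
      simp only [h1, neg_neg, ← two_mul, mul_neg] <;> abel
  · rw [map_zero, TensorProduct.zero_tmul, TensorProduct.tmul_zero, add_zero]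

theorem comulZ_bracket_zh_zLam (m : Idx) :
    comulZ (bracket (zh m) zLam) = bracket₂ (comulZ (zh m)) (comulZ zLam) := by
  rw [comulZ_zh, comulZ_zLam, map_add, LinearMap.add_apply]
  simp only [bracket₂_tmul, bracket_zG, TensorProduct.tmul_zero, TensorProduct.zero_tmul, zero_add,
    add_zero, bracket_zh_zLam, map_smul, map_mul, comulZ_zLam, comulZ_zh, mul_add,
    Algebra.TensorProduct.tmul_mul_tmul, TensorProduct.tmul_smul, TensorProduct.smul_tmul', smul_add]
  rw [mul_comm (zG (-|m.1|)), mul_comm (zG |m.1|)]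

/-- In each argument both sides are derivations along the coproduct, so `derivation_ext`, applied
first to one argument and then to the other, leaves only pairs of generators. The pairs that involve
Γ or k are trivial by centrality. -/
theorem comulZ_bracket (a b : Z1) : comulZ (bracket a b) = bracket₂ (comulZ a) (comulZ b) := by
  have right : ∀ a, comulZ (bracket a zLam) = bracket₂ (comulZ a) (comulZ zLam) →
      (∀ m, comulZ (bracket a (zh m)) = bracket₂ (comulZ a) (comulZ (zh m))) →
      ∀ b, comulZ (bracket a b) = bracket₂ (comulZ a) (comulZ b) := by
    intro a h1 h2 b
    have := derivation_ext comulZ (D := comulZ.toLinearMap ∘ₗ bracketL a)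
      (E := bracket₂ (comulZ a) ∘ₗ comulZ.toLinearMap)
      (fun x y => by
        change comulZ (bracket a (x * y)) = comulZ (bracket a x) * _ + _ * comulZ (bracket a y)
        rw [bracket_mul, map_add, map_mul, map_mul])
      (fun x y => by
        change bracket₂ (comulZ a) (comulZ (x * y)) = bracket₂ (comulZ a) (comulZ x) * _ +
          _ * bracket₂ (comulZ a) (comulZ y)
        rw [map_mul, bracket₂_mul])
      h1
      (by
        change comulZ (bracket a zGam) = bracket₂ (comulZ a) (comulZ zGam)
        rw [bracket_swap, bracket_zGam, neg_zero, map_zero, comulZ_zGam, bracket₂_swap,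
          bracket₂_central bracket_zGam, neg_zero])
      (by
        change comulZ (bracket a zk) = bracket₂ (comulZ a) (comulZ zk)
        rw [bracket_swap, bracket_zk, neg_zero, map_zero, comulZ_zk, bracket₂_swap,
          bracket₂_central bracket_zk, neg_zero])
      h2
    exact DFunLike.congr_fun this b
  have := derivation_ext comulZ (D := comulZ.toLinearMap ∘ₗ bracketL.flip b)
    (E := bracket₂.flip (comulZ b) ∘ₗ comulZ.toLinearMap)
    (fun x y => by
      change comulZ (bracket (x * y) b) = comulZ (bracket x b) * _ + _ * comulZ (bracket y b)
      rw [bracket_mul_left, map_add, map_mul, map_mul])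
    (fun x y => by
      change bracket₂ (comulZ (x * y)) (comulZ b) = bracket₂ (comulZ x) (comulZ b) * _ +
        _ * bracket₂ (comulZ y) (comulZ b)
      rw [map_mul, bracket₂_mul_left])
    -- For Λ in the first slot, {Λ, Λ} vanishes by antisymmetry on both sides, and {Λ, h_m} is the
    -- negative of a case already known.
    (right zLam
      (by rw [bracket_self, map_zero, eq_zero_of_eq_neg (bracket₂_swap (comulZ zLam) _)])
      (fun m => by
        rw [bracket_swap, map_neg, comulZ_bracket_zh_zLam, ← bracket₂_swap]) b)
    (by
      change comulZ (bracket zGam b) = bracket₂ (comulZ zGam) (comulZ b)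
      rw [bracket_zGam, map_zero, comulZ_zGam, bracket₂_central bracket_zGam])
    (by
      change comulZ (bracket zk b) = bracket₂ (comulZ zk) (comulZ b)
      rw [bracket_zk, map_zero, comulZ_zk, bracket₂_central bracket_zk])
    (fun m => right (zh m) (comulZ_bracket_zh_zLam m) (comulZ_bracket_zh_zh m) b)
  exact DFunLike.congr_fun this a

/-- The Poisson Hopf algebra `Z₁`. -/
def hopfZ : PoissonHopf Z1 where
  comul := comulZ
  counit := counitZ
  antipode := antipodeZ.toLinearMap
  bracket := bracketL
  coassoc := comulZ_coassoc
  counit_left := counitZ_left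
  counit_right := counitZ_right
  antipode_left := antipodeZ_left
  antipode_right := antipodeZ_right
  bracket_self := bracket_self
  jacobi := bracket_jacobi
  leibniz := bracket_mul
  comul_bracket := comulZ_bracket

end Heisenberg

/-! ### The Hopf structure of `Uq` reduced at q = 1 -/

/-- Contracting the right factor with one functional gives an element of A killed by all
functionals, hence zero. Expanding the left factor in a basis, each coefficient, an element of A, is
then killed by all functionals as well. -/
theorem tensor_eq_zero_of_functionals {A ι : Type*} [AddCommGroup A] [Module ℂ A]
    (f : ι → A →ₗ[ℂ] ℂ) (hf : ∀ a, (∀ i, f i a = 0) → a = 0) (t : A ⊗[ℂ] A)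
    (ht : ∀ i j, LinearMap.mul' ℂ ℂ (TensorProduct.map (f i) (f j) t) = 0) : t = 0 := by
  classical
  have h1 : ∀ j, TensorProduct.rid ℂ A ((f j).lTensor A t) = 0 := by
    refine fun j => hf _ fun i => (ht i j ▸ ?_ : f i _ = 0)
    generalize t = s
    induction s with
    | zero => simp
    | add x y hx hy => rw [map_add, map_add, map_add, hx, hy, map_add, map_add]
    | tmul a b => simp [mul_comm]
  let b := Module.Basis.ofVectorSpace ℂ A
  refine (TensorProduct.equivFinsuppOfBasisLeft (N := A) b).injective ?_
  rw [map_zero]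
  ext1 k
  refine hf _ fun j => ?_
  -- Applying a functional to a basis coefficient on the left is the same as contracting the right
  -- factor first and taking the coordinate afterwards.
  have h2 : ∀ s : A ⊗[ℂ] A, f j (TensorProduct.equivFinsuppOfBasisLeft b s k) =
      b.repr (TensorProduct.rid ℂ A ((f j).lTensor A s)) k := by
    intro s
    induction s with
    | zero => simp
    | add x y hx hy =>
      rw [map_add, Finsupp.add_apply, map_add, hx, hy, map_add, map_add, map_add, Finsupp.add_apply]
    | tmul a c => simp [mul_comm]
  rw [h2, h1, map_zero]
  rfl

namespace Heisenberg

attribute [local instance] semiringZ commSemiringZ ringZ addCommMonoidZ addCommGroupZ algebraZ moduleZ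
  semiringZZ commRingZZ addCommMonoidZZ addCommGroupZZ algebraZZ moduleZZ

open MvPolynomial

/-- A coefficient of a polynomial. -/
def polCoeff (R : Type) [CommRing R] (i : (Idx →₀ ℕ) × (ℤ × ℤ × ℤ)) : Pol R →ₗ[R] R where
  toFun v := (v.coeff i.1).coeff i.2
  map_add' v w := by simp
  map_smul' r v := by simp

theorem polCoeff_polMap {R S : Type} [CommRing R] [CommRing S] (φ : R →+* S) (v : Pol R)
    (i : (Idx →₀ ℕ) × (ℤ × ℤ × ℤ)) : polCoeff S i (polMap φ v) = φ (polCoeff R i v) :=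
  coeff_polMap φ v i.1 i.2

theorem eq_zero_of_polCoeff {R : Type} [CommRing R] (v : Pol R) (h : ∀ i, polCoeff R i v = 0) :
    v = 0 := by
  refine MvPolynomial.ext _ _ fun d => AddMonoidAlgebra.ext (Finsupp.ext fun g => ?_)
  exact h (d, g)

/-- A coefficient of the value at `1` of the operator of an element of `Uq`. -/
def matCoeff (i : (Idx →₀ ℕ) × (ℤ × ℤ × ℤ)) : Uq →ₗ[Kq] Kq :=
  polCoeff Kq i ∘ₗ (LinearMap.applyₗ (1 : Pol Kq)) ∘ₗ rho.toLinearMap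

/-- The coefficients of the action on the vector 1 are Laurent polynomials in q because the lattice
is preserved; at q = 1 they become the coefficients of the symbol. -/
theorem exists_matCoeff (i : (Idx →₀ ℕ) × (ℤ × ℤ × ℤ)) (x : Uint) :
    ∃ o : Oq, matCoeff i x = oq o ∧ polCoeff ℂ i (symbol (sp x)) = oev o := by
  obtain ⟨T, h1, h2⟩ := reduces_symbolInt x
  refine ⟨polCoeff Oq i (T 1), ?_, ?_⟩
  · refine Eq.trans ?_ (polCoeff_polMap (oq : Oq →+* Kq) (T 1) i)
    change polCoeff Kq i (rho x.1 1) = _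
    rw [← map_one latK, ← h1]
    rfl
  · refine Eq.trans ?_ (polCoeff_polMap (oev : Oq →+* ℂ) (T 1) i)
    change _ = polCoeff ℂ i (latC (T 1))
    rw [h2, map_one, mul_one, symbol_sp]

theorem exists_matCoeff_tens (i j : (Idx →₀ ℕ) × (ℤ × ℤ × ℤ)) (t : Uint ⊗[ℂ] Uint) :
    ∃ o : Oq, LinearMap.mul' Kq Kq (TensorProduct.map (matCoeff i) (matCoeff j) (tens t)) = oq o ∧
      LinearMap.mul' ℂ ℂ (TensorProduct.map (polCoeff ℂ i ∘ₗ symbol.toLinearMap)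
        (polCoeff ℂ j ∘ₗ symbol.toLinearMap)
        (TensorProduct.map sp.toLinearMap sp.toLinearMap t)) = oev o := by
  induction t with
  | zero => exact ⟨0, by simp, by simp⟩
  | add x y hx hy =>
    obtain ⟨o, h1, h2⟩ := hx
    obtain ⟨o', h3, h4⟩ := hy
    refine ⟨o + o', ?_, ?_⟩
    · rw [map_add, map_add, map_add, h1, h3, map_add]
    · rw [map_add, map_add, map_add, h2, h4, map_add]
  | tmul x y =>
    obtain ⟨o, h1, h2⟩ := exists_matCoeff i x
    obtain ⟨o', h3, h4⟩ := exists_matCoeff j y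
    refine ⟨o * o', ?_, ?_⟩
    · rw [map_mul, ← h1, ← h3]
      rfl
    · rw [map_mul, ← h2, ← h4]
      rfl

/-- The map `tens` passes from tensors over ℂ to tensors over ℂ(q), so it identifies qx ⊗ y with x ⊗
qy, and the reduction must be shown not to depend on the chosen preimage. Products of two matrix
coefficients factor through `tens` and have values in ℂ[q^{±1}]. At q = 1 they become products of
coefficients of symbols, and these separate the tensors over `Z1`. -/
theorem map_sp_eq_of_tens_eq {s t : Uint ⊗[ℂ] Uint} (h : tens s = tens t) :
    TensorProduct.map sp.toLinearMap sp.toLinearMap s =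
      TensorProduct.map sp.toLinearMap sp.toLinearMap t := by
  rw [← sub_eq_zero, ← map_sub]
  refine tensor_eq_zero_of_functionals (fun i => polCoeff ℂ i ∘ₗ symbol.toLinearMap)
    (fun a ha => ?_) _ fun i j => ?_
  · exact symbol_injective ((eq_zero_of_polCoeff _ ha).trans (map_zero symbol).symm)
  · obtain ⟨o, h1, h2⟩ := exists_matCoeff_tens i j (s - t)
    rw [map_sub, h, sub_self, map_zero, map_zero] at h1
    rw [h2, ← oq_injective ((map_zero oq).trans h1), map_zero]

theorem tens_mul (s t : Uint ⊗[ℂ] Uint) : tens (s * t) = tens s * tens t := by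
  induction s with
  | zero => rw [zero_mul, map_zero, zero_mul]
  | add x y hx hy => rw [add_mul, map_add, hx, hy, map_add, add_mul]
  | tmul a b =>
    induction t with
    | zero => rw [mul_zero, map_zero, mul_zero]
    | add x y hx hy => rw [mul_add, map_add, hx, hy, map_add, mul_add]
    | tmul c d =>
      rw [Algebra.TensorProduct.tmul_mul_tmul]
      exact (Algebra.TensorProduct.tmul_mul_tmul (R := Kq) a.1 c.1 b.1 d.1).symm

theorem comul_u (x : Gen) : comul (u x) = comulGen x := by
  change RingQuot.liftAlgHom Kq _ (RingQuot.mkAlgHom Kq Rel _) = _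
  rw [RingQuot.liftAlgHom_mkAlgHom_apply]
  exact FreeAlgebra.lift_ι_apply _ _

theorem counit_u (x : Gen) : counit (u x) = (match x with | .h _ => 0 | _ => 1) := by
  change RingQuot.liftAlgHom Kq _ (RingQuot.mkAlgHom Kq Rel _) = _
  rw [RingQuot.liftAlgHom_mkAlgHom_apply]
  exact FreeAlgebra.lift_ι_apply _ _

theorem antipode_u (x : Gen) : antipode (u x) = MulOpposite.op (antipodeGen x) := by
  change RingQuot.liftAlgHom Kq _ (RingQuot.mkAlgHom Kq Rel _) = _
  rw [RingQuot.liftAlgHom_mkAlgHom_apply]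
  exact FreeAlgebra.lift_ι_apply _ _

theorem comulZ_inv {v w : Z1} (h : w * v = 1) (hv : comulZ v = v ⊗ₜ v) : comulZ w = w ⊗ₜ w := by
  have h1 : (w ⊗ₜ[ℂ] w) * (v ⊗ₜ[ℂ] v) = 1 := by
    rw [Algebra.TensorProduct.tmul_mul_tmul, h]
    rfl
  have h2 : (v ⊗ₜ[ℂ] v) * comulZ w = 1 := by rw [← hv, ← map_mul, mul_comm, h, map_one]
  exact (left_inv_eq_right_inv h1 h2).symm

/-- The lift of the coproduct and the identification of its reduction are built together, since both
conditions are preserved by sums and products; only the generators need explicit lifts. -/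
theorem exists_tens_comul (x : Uint) : ∃ t : Uint ⊗[ℂ] Uint, tens t = comul x ∧
    TensorProduct.map sp.toLinearMap sp.toLinearMap t = comulZ (sp x) := by
  obtain ⟨x, hx⟩ := x
  induction hx using Algebra.adjoin_induction with
  | mem y hy =>
    have hy' := hy
    simp only [intGen, Set.mem_union, Set.mem_insert_iff, Set.mem_singleton_iff,
      Set.mem_range] at hy'
    rcases hy' with (rfl | rfl | rfl | rfl | rfl | rfl | rfl | rfl) | ⟨m, rfl⟩
    · refine ⟨qU ⊗ₜ 1, ?_, ?_⟩
      · exact (comul.commutes q).symm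
      · refine Eq.trans ?_ ((congrArg comulZ sp_qU).trans (map_one _)).symm
        exact congrArg₂ (· ⊗ₜ ·) sp_qU (map_one sp)
    · refine ⟨⟨algebraMap Kq Uq q⁻¹, q_inv_mem⟩ ⊗ₜ 1, ?_, ?_⟩
      · exact (comul.commutes q⁻¹).symm
      · refine Eq.trans ?_ ((congrArg comulZ sp_qInv).trans (map_one _)).symm
        exact congrArg₂ (· ⊗ₜ ·) sp_qInv (map_one sp)
    · exact ⟨⟨u .Lam, mem_gen hy⟩ ⊗ₜ ⟨u .Lam, mem_gen hy⟩, (comul_u .Lam).symm, comulZ_zLam.symm⟩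
    · exact ⟨⟨u .LamInv, mem_gen hy⟩ ⊗ₜ ⟨u .LamInv, mem_gen hy⟩, (comul_u .LamInv).symm,
        (comulZ_inv zLamInv_mul comulZ_zLam).symm⟩
    · exact ⟨⟨u .Gam, mem_gen hy⟩ ⊗ₜ ⟨u .Gam, mem_gen hy⟩, (comul_u .Gam).symm, comulZ_zGam.symm⟩
    · exact ⟨⟨u .GamInv, mem_gen hy⟩ ⊗ₜ ⟨u .GamInv, mem_gen hy⟩, (comul_u .GamInv).symm,
        (comulZ_inv zGamInv_mul comulZ_zGam).symm⟩
    · exact ⟨⟨u .k, mem_gen hy⟩ ⊗ₜ ⟨u .k, mem_gen hy⟩, (comul_u .k).symm, comulZ_zk.symm⟩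
    · exact ⟨⟨u .kInv, mem_gen hy⟩ ⊗ₜ ⟨u .kInv, mem_gen hy⟩, (comul_u .kInv).symm,
        (comulZ_inv zkInv_mul comulZ_zk).symm⟩
    · refine ⟨⟨hH m, mem_gen hy⟩ ⊗ₜ ((gamInt ^ (-|m.1|) : Uintˣ) : Uint) +
        ((gamInt ^ |m.1| : Uintˣ) : Uint) ⊗ₜ ⟨hH m, mem_gen hy⟩, ?_, ?_⟩
      · rw [map_add]
        change hH m ⊗ₜ[Kq] ((gamInt ^ (-|m.1|) : Uintˣ) : Uint).1 +
          ((gamInt ^ |m.1| : Uintˣ) : Uint).1 ⊗ₜ[Kq] hH m = comul (hH m)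
        rw [val_gamInt_zpow, val_gamInt_zpow, hH, map_smul, comul_u, comulGen, smul_add,
          TensorProduct.smul_tmul', TensorProduct.tmul_smul]
      · rw [map_add]
        change zh m ⊗ₜ[ℂ] sp ((gamInt ^ (-|m.1|) : Uintˣ) : Uint) +
          sp ((gamInt ^ |m.1| : Uintˣ) : Uint) ⊗ₜ[ℂ] zh m = comulZ (zh m)
        rw [sp_gamInt_zpow, sp_gamInt_zpow, comulZ_zh, zG, zG]
  | algebraMap r =>
    refine ⟨algebraMap ℂ Uint r ⊗ₜ 1, ?_, ?_⟩
    · have h : algebraMap ℂ Uq r = algebraMap Kq Uq (algebraMap ℂ Kq r) :=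
        IsScalarTower.algebraMap_apply _ _ _ _
      refine Eq.trans ?_ ((congrArg comul h).trans (comul.commutes _)).symm
      exact congrArg (· ⊗ₜ[Kq] (1 : Uq)) h
    · refine Eq.trans ?_ ((congrArg comulZ (sp.commutes r)).trans (comulZ.commutes r)).symm
      exact congrArg₂ (· ⊗ₜ ·) (sp.commutes r) (map_one sp)
  | add y z hy hz h1 h2 =>
    obtain ⟨s, h3, h4⟩ := h1
    obtain ⟨t, h5, h6⟩ := h2
    refine ⟨s + t, ?_, ?_⟩
    · rw [map_add, h3, h5, ← map_add]
    · rw [map_add, h4, h6, ← map_add, ← map_add]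
      rfl
  | mul y z hy hz h1 h2 =>
    obtain ⟨s, h3, h4⟩ := h1
    obtain ⟨t, h5, h6⟩ := h2
    refine ⟨s * t, ?_, ?_⟩
    · rw [tens_mul, h3, h5, ← map_mul]
    · refine (map_mul (Algebra.TensorProduct.map sp sp) s t).trans ?_
      refine (congrArg₂ (· * ·) h4 h6).trans ?_
      exact (map_mul (comulZ.comp sp) _ _).symm

theorem exists_counit (x : Uint) : ∃ p : Oq, counit x = oq p ∧ counitZ (sp x) = oev p := by
  obtain ⟨x, hx⟩ := x
  have inv : ∀ {v w : Z1}, w * v = 1 → counitZ v = 1 → counitZ w = 1 := by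
    intro v w h hv
    have := map_mul counitZ w v
    rwa [h, hv, map_one, mul_one, eq_comm] at this
  induction hx using Algebra.adjoin_induction with
  | mem y hy =>
    have one : ∀ x : Gen, counit (u x) = 1 → ∀ h : u x ∈ Uint, counitZ (sp ⟨u x, h⟩) = 1 →
        ∃ p : Oq, counit (u x) = oq p ∧ counitZ (sp ⟨u x, h⟩) = oev p := by
      intro x h1 h h2
      exact ⟨1, h1.trans (map_one oq).symm, h2.trans (map_one oev).symm⟩
    have hy' := hy
    simp only [intGen, Set.mem_union, Set.mem_insert_iff, Set.mem_singleton_iff,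
      Set.mem_range] at hy'
    rcases hy' with (rfl | rfl | rfl | rfl | rfl | rfl | rfl | rfl) | ⟨m, rfl⟩
    · refine ⟨LaurentPolynomial.T 1, ?_, ?_⟩
      · rw [oq_T, zpow_one]
        exact counit.commutes q
      · rw [oev_T]
        exact (congrArg counitZ sp_qU).trans (map_one _)
    · refine ⟨LaurentPolynomial.T (-1), ?_, ?_⟩
      · rw [oq_T, zpow_neg_one]
        exact counit.commutes q⁻¹
      · rw [oev_T]
        exact (congrArg counitZ sp_qInv).trans (map_one _)
    · exact one _ (counit_u _) _ counitZ_zLam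
    · exact one _ (counit_u _) _ (inv zLamInv_mul counitZ_zLam)
    · exact one _ (counit_u _) _ counitZ_zGam
    · exact one _ (counit_u _) _ (inv zGamInv_mul counitZ_zGam)
    · exact one _ (counit_u _) _ counitZ_zk
    · exact one _ (counit_u _) _ (inv zkInv_mul counitZ_zk)
    · refine ⟨0, ?_, ?_⟩
      · change counit (hH m) = _
        rw [hH, map_smul, counit_u, smul_zero, map_zero]
      · exact (counitZ_zh m).trans (map_zero oev).symm
  | algebraMap r =>
    refine ⟨algebraMap ℂ Oq r, ?_, ?_⟩
    · rw [oq.commutes]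
      have h : algebraMap ℂ Uq r = algebraMap Kq Uq (algebraMap ℂ Kq r) :=
        IsScalarTower.algebraMap_apply _ _ _ _
      exact (congrArg counit h).trans (counit.commutes _)
    · rw [oev.commutes]
      exact (congrArg counitZ (sp.commutes r)).trans (counitZ.commutes r)
  | add y z hy hz h1 h2 =>
    obtain ⟨p, h3, h4⟩ := h1
    obtain ⟨p', h5, h6⟩ := h2
    refine ⟨p + p', ?_, ?_⟩
    · rw [map_add oq, ← h3, ← h5, ← map_add]
    · rw [map_add oev, ← h4, ← h6, ← map_add, ← map_add]
      rfl
  | mul y z hy hz h1 h2 =>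
    obtain ⟨p, h3, h4⟩ := h1
    obtain ⟨p', h5, h6⟩ := h2
    refine ⟨p * p', ?_, ?_⟩
    · rw [map_mul oq, ← h3, ← h5, ← map_mul]
    · rw [map_mul oev, ← h4, ← h6, ← map_mul, ← map_mul]
      rfl

theorem exists_antipode (x : Uint) : ∃ y : Uint, antipode x = MulOpposite.op (y : Uq) ∧
    antipodeZ (sp x) = sp y := by
  obtain ⟨x, hx⟩ := x
  have inv : ∀ {v w : Z1}, w * v = 1 → antipodeZ v = w → antipodeZ w = v := by
    intro v w h hv
    have h1 : antipodeZ w * w = 1 := by rw [← hv, ← map_mul, hv, h, map_one]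
    exact left_inv_eq_right_inv h1 h
  induction hx using Algebra.adjoin_induction with
  | mem y hy =>
    have hy' := hy
    simp only [intGen, Set.mem_union, Set.mem_insert_iff, Set.mem_singleton_iff,
      Set.mem_range] at hy'
    rcases hy' with (rfl | rfl | rfl | rfl | rfl | rfl | rfl | rfl) | ⟨m, rfl⟩
    · refine ⟨qU, antipode.commutes q, ?_⟩
      exact (congrArg antipodeZ sp_qU).trans ((map_one _).trans sp_qU.symm)
    · refine ⟨⟨algebraMap Kq Uq q⁻¹, q_inv_mem⟩, antipode.commutes q⁻¹, ?_⟩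
      exact (congrArg antipodeZ sp_qInv).trans ((map_one _).trans sp_qInv.symm)
    · exact ⟨_, antipode_u .Lam, antipodeZ_zLam⟩
    · exact ⟨_, antipode_u .LamInv, inv zLamInv_mul antipodeZ_zLam⟩
    · exact ⟨_, antipode_u .Gam, antipodeZ_zGam⟩
    · exact ⟨_, antipode_u .GamInv, inv zGamInv_mul antipodeZ_zGam⟩
    · exact ⟨_, antipode_u .k, antipodeZ_zk⟩
    · exact ⟨_, antipode_u .kInv, inv zkInv_mul antipodeZ_zk⟩
    · refine ⟨-⟨hH m, mem_gen hy⟩, ?_, (antipodeZ_zh m).trans (map_neg sp _).symm⟩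
      change antipode (hH m) = MulOpposite.op (-hH m)
      rw [hH, map_smul, antipode_u, antipodeGen, ← MulOpposite.op_smul, smul_neg]
  | algebraMap r =>
    refine ⟨algebraMap ℂ Uint r, ?_, ?_⟩
    · have h : algebraMap ℂ Uq r = algebraMap Kq Uq (algebraMap ℂ Kq r) :=
        IsScalarTower.algebraMap_apply _ _ _ _
      exact (congrArg antipode h).trans ((antipode.commutes _).trans
        (congrArg MulOpposite.op h.symm))
    · exact (congrArg antipodeZ (sp.commutes r)).trans
        ((antipodeZ.commutes r).trans (sp.commutes r).symm)
  | add y z hy hz h1 h2 =>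
    obtain ⟨s, h3, h4⟩ := h1
    obtain ⟨t, h5, h6⟩ := h2
    refine ⟨s + t, ?_, ?_⟩
    · exact (map_add antipode y z).trans (congrArg₂ (· + ·) h3 h5)
    · rw [map_add sp, ← h4, ← h6, ← map_add, ← map_add]
      rfl
  | mul y z hy hz h1 h2 =>
    obtain ⟨s, h3, h4⟩ := h1
    obtain ⟨t, h5, h6⟩ := h2
    -- The antipode of `Uq` reverses products; after reduction the order is irrelevant because `Z1`
    -- is commutative.
    refine ⟨t * s, ?_, ?_⟩
    · exact (map_mul antipode y z).trans (congrArg₂ (· * ·) h3 h5)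
    · rw [map_mul sp, ← h4, ← h6, mul_comm, ← map_mul, ← map_mul]
      rfl

theorem isSemiclassical_hopfZ : IsSemiclassical hopfZ where
  exists_comul x := by
    obtain ⟨t, h, _⟩ := exists_tens_comul x
    exact ⟨t, h⟩
  comul x t ht := by
    obtain ⟨s, h1, h2⟩ := exists_tens_comul x
    exact h2.symm.trans (map_sp_eq_of_tens_eq (h1.trans ht.symm))
  counit x := by
    obtain ⟨p, h1, h2⟩ := exists_counit x
    exact ⟨p.coeff, h1.trans (oq_sum p), h2.trans (oev_sum p)⟩
  antipode x := exists_antipode x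
  bracket _ _ := rfl

end Heisenberg

/-! ### Transport of a Poisson Hopf structure along an algebra isomorphism -/

namespace PoissonHopf

variable {A B : Type} [CommRing A] [Algebra ℂ A] [CommRing B] [Algebra ℂ B]

section

variable (Q : PoissonHopf B) (e : A ≃ₐ[ℂ] B)

/-- The coproduct transported along an isomorphism. -/
def transportComul : A →ₐ[ℂ] A ⊗[ℂ] A :=
  ((Algebra.TensorProduct.map (e.symm : B →ₐ[ℂ] A) (e.symm : B →ₐ[ℂ] A)).comp Q.comul).comp
    (e : A →ₐ[ℂ] B)

/-- The map of tensor squares induced by the inverse of an isomorphism. -/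
def symm₂ : B ⊗[ℂ] B →ₗ[ℂ] A ⊗[ℂ] A :=
  TensorProduct.map e.symm.toLinearMap e.symm.toLinearMap

theorem transportComul_apply (a : A) : transportComul Q e a = symm₂ e (Q.comul (e a)) := rfl

theorem transportComul_symm (b : B) : transportComul Q e (e.symm b) = symm₂ e (Q.comul b) := by
  rw [transportComul_apply, e.apply_symm_apply]

/-- The transport of a Poisson Hopf structure along an algebra isomorphism. -/
def transport : PoissonHopf A where
  comul := transportComul Q e
  counit := Q.counit.comp (e : A →ₐ[ℂ] B)
  antipode := e.symm.toLinearMap ∘ₗ Q.antipode ∘ₗ e.toLinearMap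
  bracket := (Q.bracket.compl₁₂ e.toLinearMap e.toLinearMap).compr₂ e.symm.toLinearMap
  coassoc a := by
    -- Each axiom is first moved across `symm₂` for an arbitrary tensor, where it is enough to look
    -- at pure tensors; the axiom of `Q` is then applied to the coproduct of `e a`.
    have h1 : ∀ t : B ⊗[ℂ] B, TensorProduct.assoc ℂ A A A
        ((transportComul Q e).toLinearMap.rTensor A (symm₂ e t)) =
        TensorProduct.map e.symm.toLinearMap (symm₂ e)
          (TensorProduct.assoc ℂ B B B (Q.comul.toLinearMap.rTensor B t)) := by
      intro t
      induction t with
      | zero => simp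
      | add x y hx hy => simp only [map_add, hx, hy]
      | tmul x y =>
        change TensorProduct.assoc ℂ A A A (transportComul Q e (e.symm x) ⊗ₜ e.symm y) =
          TensorProduct.map _ _ (TensorProduct.assoc ℂ B B B (Q.comul x ⊗ₜ y))
        rw [transportComul_symm]
        generalize Q.comul x = s
        induction s with
        | zero => simp
        | add x y hx hy => simp only [map_add, TensorProduct.add_tmul, hx, hy]
        | tmul x z => rfl
    have h2 : ∀ t : B ⊗[ℂ] B, (transportComul Q e).toLinearMap.lTensor A (symm₂ e t) =
        TensorProduct.map e.symm.toLinearMap (symm₂ e) (Q.comul.toLinearMap.lTensor B t) := by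
      intro t
      induction t with
      | zero => simp
      | add x y hx hy => simp only [map_add, hx, hy]
      | tmul x y => exact congrArg (e.symm x ⊗ₜ[ℂ] ·) (transportComul_symm Q e y)
    rw [transportComul_apply, h1, h2, Q.coassoc]
  counit_left a := by
    have h : ∀ t : B ⊗[ℂ] B, (Q.counit.comp (e : A →ₐ[ℂ] B)).toLinearMap.rTensor A (symm₂ e t) =
        e.symm.toLinearMap.lTensor ℂ (Q.counit.toLinearMap.rTensor B t) := by
      intro t
      induction t with
      | zero => simp
      | add x y hx hy => simp only [map_add, hx, hy]
      | tmul x y =>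
        exact congrArg (fun w => Q.counit w ⊗ₜ[ℂ] e.symm y) (e.apply_symm_apply x)
    rw [transportComul_apply, h, Q.counit_left]
    exact congrArg (1 ⊗ₜ[ℂ] ·) (e.symm_apply_apply a)
  counit_right a := by
    have h : ∀ t : B ⊗[ℂ] B, (Q.counit.comp (e : A →ₐ[ℂ] B)).toLinearMap.lTensor A (symm₂ e t) =
        e.symm.toLinearMap.rTensor ℂ (Q.counit.toLinearMap.lTensor B t) := by
      intro t
      induction t with
      | zero => simp
      | add x y hx hy => simp only [map_add, hx, hy]
      | tmul x y =>
        exact congrArg (fun w => e.symm x ⊗ₜ[ℂ] Q.counit w) (e.apply_symm_apply y)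
    rw [transportComul_apply, h, Q.counit_right]
    exact congrArg (· ⊗ₜ[ℂ] 1) (e.symm_apply_apply a)
  antipode_left a := by
    have h : ∀ t : B ⊗[ℂ] B, LinearMap.mul' ℂ A
        ((e.symm.toLinearMap ∘ₗ Q.antipode ∘ₗ e.toLinearMap).rTensor A (symm₂ e t)) =
        e.symm (LinearMap.mul' ℂ B (Q.antipode.rTensor B t)) := by
      intro t
      induction t with
      | zero => simp
      | add x y hx hy => simp only [map_add, hx, hy]
      | tmul x y =>
        change e.symm (Q.antipode (e (e.symm x))) * e.symm y = e.symm (Q.antipode x * y)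
        rw [e.apply_symm_apply, map_mul]
    rw [transportComul_apply, h, Q.antipode_left]
    exact e.symm.commutes _
  antipode_right a := by
    have h : ∀ t : B ⊗[ℂ] B, LinearMap.mul' ℂ A
        ((e.symm.toLinearMap ∘ₗ Q.antipode ∘ₗ e.toLinearMap).lTensor A (symm₂ e t)) =
        e.symm (LinearMap.mul' ℂ B (Q.antipode.lTensor B t)) := by
      intro t
      induction t with
      | zero => simp
      | add x y hx hy => simp only [map_add, hx, hy]
      | tmul x y =>
        change e.symm x * e.symm (Q.antipode (e (e.symm y))) = e.symm (x * Q.antipode y)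
        rw [e.apply_symm_apply, map_mul]
    rw [transportComul_apply, h, Q.antipode_right]
    exact e.symm.commutes _
  bracket_self a := by
    change e.symm (Q.bracket (e a) (e a)) = 0
    rw [Q.bracket_self, map_zero]
  jacobi a b c := by
    change e.symm (Q.bracket (e a) (e (e.symm (Q.bracket (e b) (e c))))) +
      e.symm (Q.bracket (e b) (e (e.symm (Q.bracket (e c) (e a))))) +
      e.symm (Q.bracket (e c) (e (e.symm (Q.bracket (e a) (e b))))) = 0
    simp only [e.apply_symm_apply, ← map_add]
    rw [Q.jacobi, map_zero]
  leibniz a b c := by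
    change e.symm (Q.bracket (e a) (e (b * c))) =
      e.symm (Q.bracket (e a) (e b)) * c + b * e.symm (Q.bracket (e a) (e c))
    rw [map_mul, Q.leibniz, map_add, map_mul, map_mul, e.symm_apply_apply, e.symm_apply_apply]
  comul_bracket a b := by
    have h : ∀ s t : B ⊗[ℂ] B, tensorBracket
        ((Q.bracket.compl₁₂ e.toLinearMap e.toLinearMap).compr₂ e.symm.toLinearMap)
        (symm₂ e s) (symm₂ e t) = symm₂ e (tensorBracket Q.bracket s t) := by
      intro s t
      induction s with
      | zero => simp
      | add x y hx hy => simp only [map_add, LinearMap.add_apply, hx, hy]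
      | tmul x y =>
        induction t with
        | zero => simp
        | add x y hx hy => simp only [map_add, hx, hy]
        | tmul x' y' =>
          change (e.symm x * e.symm x') ⊗ₜ e.symm (Q.bracket (e (e.symm y)) (e (e.symm y'))) +
            e.symm (Q.bracket (e (e.symm x)) (e (e.symm x'))) ⊗ₜ (e.symm y * e.symm y') =
            symm₂ e ((x * x') ⊗ₜ Q.bracket y y' + Q.bracket x x' ⊗ₜ (y * y'))
          simp only [e.apply_symm_apply, ← map_mul, map_add]
          rfl
    change transportComul Q e (e.symm (Q.bracket (e a) (e b))) = tensorBracket _ _ _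
    rw [transportComul_symm, transportComul_apply, transportComul_apply, h, Q.comul_bracket]
    rfl

theorem transport_isIso : (Q.transport e).IsIso Q e where
  comul a := by
    change _ = TensorProduct.map _ _ (symm₂ e (Q.comul (e a)))
    generalize Q.comul (e a) = t
    induction t with
    | zero => simp
    | add x y hx hy => simp only [map_add, ← hx, ← hy]
    | tmul x y =>
      exact (congrArg₂ (· ⊗ₜ[ℂ] ·) (e.apply_symm_apply x) (e.apply_symm_apply y)).symm
  counit _ := rfl
  antipode a := (e.apply_symm_apply _).symm
  bracket a b := (e.apply_symm_apply _).symm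

end

end PoissonHopf

/-! ### Laurent coefficients of germs -/

namespace GL1Loop

theorem isHol_zpow (n : ℤ) : IsHol fun z => z ^ n := by
  filter_upwards [self_mem_nhdsWithin] with z hz using differentiableAt_zpow.2 (Or.inl hz)

/-- The germ of `z ^ n`. -/
def zp (n : ℤ) : Loop := mk (fun z => z ^ n) (isHol_zpow n)

theorem zp_zero : zp 0 = 1 :=
  Subtype.ext (Germ.coe_eq.2 (Eventually.of_forall fun z => zpow_zero z))

theorem zp_mul (m n : ℤ) : zp m * zp n = zp (m + n) := by
  refine Subtype.ext (Germ.coe_eq.2 ?_)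
  filter_upwards [self_mem_nhdsWithin] with z hz using (zpow_add₀ hz m n).symm

theorem D_zp (n : ℤ) : D (zp n) = (n : ℂ) • zp (n - 1) := by
  refine Subtype.ext (Germ.coe_eq.2 ?_)
  filter_upwards [self_mem_nhdsWithin] with z hz
  exact (hasDerivAt_zpow n z (Or.inl hz)).deriv

theorem rescale_zp (γ : ℂˣ) (n : ℤ) : rescale γ (zp n) = ((γ ^ n : ℂˣ) : ℂ) • zp n := by
  refine Subtype.ext (Germ.coe_eq.2 (Eventually.of_forall fun z => ?_))
  change ((γ : ℂ) * z) ^ n = ((γ ^ n : ℂˣ) : ℂ) * z ^ n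
  rw [mul_zpow, Units.val_zpow_eq_zpow_val]

theorem coeff_eq_res (n : ℤ) (f : Loop) : coeff n f = res (f * zp (-n - 1)) := by
  obtain ⟨F, hF, rfl⟩ := exists_rep f
  refine congrArg lim (congrArg (fun g => Filter.map g _) (funext fun r => ?_))
  congr 2
  funext z
  change _ = F z * z ^ (-n - 1) * z ^ (-(-1) - 1 : ℤ)
  rw [neg_neg, sub_self, zpow_zero, mul_one]

theorem res_eq_coeff (f : Loop) : res f = coeff (-1) f := rfl

theorem coeff_zp_mul (n k : ℤ) (f : Loop) : coeff n (zp k * f) = coeff (n - k) f := by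
  rw [coeff_eq_res, coeff_eq_res, mul_comm (zp k), mul_assoc, zp_mul]
  congr 3
  ring

theorem res_zp (n : ℤ) : res (zp n) = if n = -1 then 1 else 0 := by
  split_ifs with h
  · subst h
    rw [zp, res_mk _ (R := 2) (r := 1) (fun z hz _ => differentiableAt_zpow.2 (Or.inl hz)) one_pos
      one_lt_two]
    have := circleIntegral.integral_sub_center_inv 0 (R := 1) one_ne_zero
    simp only [sub_zero] at this
    simp only [zpow_neg_one, this]
    exact inv_mul_cancel₀ Complex.two_pi_I_ne_zero
  · have h1 : ((n + 1 : ℤ) : ℂ) ≠ 0 := Int.cast_ne_zero.2 (by omega)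
    have := res_D (zp (n + 1))
    rw [D_zp, map_smul, add_sub_cancel_right, smul_eq_mul] at this
    exact (mul_eq_zero.1 this).resolve_left h1

theorem coeff_zp (n k : ℤ) : coeff n (zp k) = if n = k then 1 else 0 := by
  rw [coeff_eq_res, zp_mul, res_zp]
  congr 1
  exact propext (by omega)

theorem coeff_one (n : ℤ) : coeff n 1 = if n = 0 then 1 else 0 := by
  rw [← zp_zero, coeff_zp]

/-- Integration by parts: the residue of the derivative of f z^{-n-1} vanishes. -/
theorem coeff_D (n : ℤ) (f : Loop) : coeff n (D f) = (n + 1 : ℂ) * coeff (n + 1) f := by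
  have := res_D (f * zp (-n - 1))
  rw [D_mul, map_add, ← coeff_eq_res, D_zp, mul_smul_comm, map_smul, smul_eq_mul] at this
  rw [coeff_eq_res (n + 1), show -(n + 1) - 1 = -n - 1 - 1 by ring]
  push_cast at this
  linear_combination this

theorem coeff_rescale (γ : ℂˣ) (n : ℤ) (f : Loop) :
    coeff n (rescale γ f) = ((γ ^ n : ℂˣ) : ℂ) * coeff n f := by
  have h := res_rescale γ (f * zp (-n - 1))
  rw [map_mul, rescale_zp, mul_smul_comm, map_smul, ← coeff_eq_res, ← coeff_eq_res,
    smul_eq_mul] at h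
  have e : ((γ ^ n : ℂˣ) : ℂ) * (γ : ℂ)⁻¹ = (((γ ^ (-n - 1))⁻¹ : ℂˣ) : ℂ) * (γ : ℂ)⁻¹ * (γ : ℂ)⁻¹ := by
    rw [← Units.val_inv_eq_inv_val, ← Units.val_mul, ← Units.val_mul, ← Units.val_mul]
    congr 1
    group
  have e2 : ((γ ^ n : ℂˣ) : ℂ) = (((γ ^ (-n - 1))⁻¹ : ℂˣ) : ℂ) * (γ : ℂ)⁻¹ := by
    have := mul_right_cancel₀ (inv_ne_zero γ.ne_zero) e
    exact this
  rw [e2, mul_assoc, ← h, ← mul_assoc, ← Units.val_mul, inv_mul_cancel, Units.val_one, one_mul]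

/-- On a circle |z| = r inside the domain, the Laurent coefficients are nonzero multiples of the
Fourier coefficients of a continuous function, and a continuous function without Fourier
coefficients is zero. The circle is chosen through the point z at which f is to vanish. -/
theorem eq_zero_of_coeff (f : Loop) (h : ∀ n, coeff n f = 0) : f = 0 := by
  obtain ⟨F, hF, rfl⟩ := exists_rep f
  obtain ⟨R, hR, hd⟩ := hF.exists_radius
  refine Subtype.ext (Germ.coe_eq.2 ?_)
  rw [Filter.EventuallyEq, eventually_nhdsWithin_iff, Metric.eventually_nhds_iff]
  refine ⟨R, hR, fun z hz hz0 => ?_⟩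
  have hz1 : ‖z‖ < R := by simpa using hz
  have hr : 0 < ‖z‖ := norm_pos_iff.2 hz0
  obtain ⟨r, hrdef⟩ : ∃ r, r = ‖z‖ := ⟨_, rfl⟩
  rw [← hrdef] at hz1 hr
  have : Fact (0 < 2 * Real.pi) := ⟨Real.two_pi_pos⟩
  have hcont : Continuous fun t : AddCircle (2 * Real.pi) => F (r * (AddCircle.toCircle t : ℂ)) := by
    rw [continuous_iff_continuousAt]
    intro t
    have hn : ‖(r : ℂ) * (AddCircle.toCircle t : ℂ)‖ = r := by
      rw [norm_mul, Circle.norm_coe, mul_one, Complex.norm_real, Real.norm_of_nonneg hr.le]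
    have hd' := (hd (r * (AddCircle.toCircle t : ℂ)) (norm_pos_iff.1 (by rw [hn]; exact hr))
      (by rw [hn]; exact hz1)).continuousAt
    refine ContinuousAt.comp (g := F) hd' ?_
    have := AddCircle.continuous_toCircle (T := 2 * Real.pi)
    fun_prop
  let g : C(AddCircle (2 * Real.pi), ℂ) := ⟨_, hcont⟩
  have htc : ∀ θ : ℝ, (r : ℂ) * (AddCircle.toCircle (θ : AddCircle (2 * Real.pi)) : ℂ) =
      circleMap 0 r θ := by
    intro θ
    rw [AddCircle.toCircle_apply_mk, div_self Real.two_pi_pos.ne', one_mul, Circle.coe_exp,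
      circleMap, zero_add]
  have hcoef : ∀ n, fourierCoeff g n = 0 := by
    intro n
    rw [fourierCoeff_eq_intervalIntegral g n 0, zero_add]
    have h1 := h n
    change coeffGerm n (F : PGerm) = 0 at h1
    rw [coeffGerm_eq n hd hr hz1] at h1
    have h2 := (mul_eq_zero.1 h1).resolve_left (inv_ne_zero Complex.two_pi_I_ne_zero)
    -- With z = r e^{iθ} one has z^{-n-1} dz = i r^{-n} e^{-inθ} dθ.
    have h3 : ∀ θ : ℝ, deriv (circleMap 0 r) θ • (F (circleMap 0 r θ) * circleMap 0 r θ ^ (-n - 1)) =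
        (Complex.I * (r : ℂ) ^ (-n)) *
          (@fourier (2 * Real.pi) (-n) θ • g (θ : AddCircle (2 * Real.pi))) := by
      intro θ
      have hg : g (θ : AddCircle (2 * Real.pi)) = F (circleMap 0 r θ) := congrArg F (htc θ)
      have hne : circleMap 0 r θ ≠ 0 := circleMap_ne_center hr.ne'
      have hpi : (2 * (Real.pi : ℂ)) ≠ 0 := by exact_mod_cast Real.two_pi_pos.ne'
      rw [hg, fourier_coe_apply, deriv_circleMap, smul_eq_mul, smul_eq_mul, zpow_sub_one₀ hne]
      have h4 : circleMap 0 r θ ^ (-n) = (r : ℂ) ^ (-n) *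
          Complex.exp (2 * Real.pi * Complex.I * ((-n : ℤ) : ℂ) * θ / (2 * Real.pi : ℝ)) := by
        rw [circleMap, zero_add, mul_zpow, ← Complex.exp_int_mul]
        congr 2
        push_cast
        field_simp
      generalize Complex.exp (2 * Real.pi * Complex.I * ((-n : ℤ) : ℂ) * θ / (2 * Real.pi : ℝ)) = E
        at h4 ⊢
      rw [h4]
      field_simp
    rw [circleIntegral] at h2
    simp only [h3] at h2
    rw [intervalIntegral.integral_const_mul] at h2
    have h5 : (Complex.I * (r : ℂ) ^ (-n)) ≠ 0 :=
      mul_ne_zero Complex.I_ne_zero (zpow_ne_zero _ (by exact_mod_cast hr.ne'))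
    rw [(mul_eq_zero.1 h2).resolve_left h5, smul_zero]
  -- The zero family is summable, so the Fourier series converges pointwise to the continuous
  -- function `g` without any regularity estimate.
  have hsum : Summable (fourierCoeff g) := by
    rw [show fourierCoeff g = fun _ => 0 from funext hcoef]
    exact summable_zero
  have key := has_pointwise_sum_fourier_series_of_summable hsum
    ((Complex.arg z : ℝ) : AddCircle (2 * Real.pi))
  simp only [hcoef, zero_smul] at key
  have h6 := key.unique hasSum_zero
  have h7 : g ((Complex.arg z : ℝ) : AddCircle (2 * Real.pi)) = F z := by
    refine congrArg F ((htc _).trans ?_)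
    rw [circleMap, zero_add, hrdef, Complex.norm_mul_exp_arg_mul_I]
  rw [h7] at h6
  exact h6

theorem ext_coeff {f g : Loop} (h : ∀ n, coeff n f = coeff n g) : f = g :=
  sub_eq_zero.1 (eq_zero_of_coeff _ fun n => by rw [map_sub, h, sub_self])

theorem coeff_eq_of_D_eq {f g : Loop} (h : D f = D g) {n : ℤ} (hn : n ≠ 0) :
    coeff n f = coeff n g := by
  have h1 := coeff_D (n - 1) f
  rw [h, coeff_D (n - 1) g, sub_add_cancel] at h1
  have h2 : (((n - 1 : ℤ) : ℂ) + 1) ≠ 0 := by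
    push_cast
    rw [sub_add_cancel]
    exact Int.cast_ne_zero.2 hn
  exact (mul_left_cancel₀ h2 h1).symm

theorem eq_add_of_D_eq {f g : Loop} (h : D f = D g) : f = g + (coeff 0 f - coeff 0 g) • (1 : Loop) := by
  refine ext_coeff fun n => ?_
  rw [map_add, map_smul, coeff_one, smul_eq_mul]
  split_ifs with hn
  · rw [hn]; ring
  · rw [coeff_eq_of_D_eq h hn, mul_zero, add_zero]

theorem IsPlus.const (c : ℂ) : IsPlus (fun _ => c) (c • (1 : Loop)) :=
  ⟨analyticAt_const, Germ.coe_eq.2 (Eventually.of_forall fun _ => mul_one c)⟩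

theorem IsMinus.const (c : ℂ) : IsMinus (fun _ => c) (c • (1 : Loop)) :=
  ⟨differentiable_const _, Germ.coe_eq.2 (Eventually.of_forall fun _ => mul_one c)⟩

theorem isPlus_zp (n : ℕ) : IsPlus (fun z => z ^ n) (zp n) :=
  ⟨by fun_prop, Germ.coe_eq.2 (Eventually.of_forall fun z => zpow_natCast z n)⟩

theorem isMinus_zp (n : ℕ) : IsMinus (fun z => z ^ n) (zp (-n)) :=
  ⟨by fun_prop, Germ.coe_eq.2 (Eventually.of_forall fun z => by
    change z ^ (-(n : ℤ)) = z⁻¹ ^ n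
    rw [inv_pow, zpow_neg, zpow_natCast])⟩

theorem IsPlus.res_eq_zero {F : ℂ → ℂ} {f : Loop} (hf : IsPlus F f) : res f = 0 := by
  obtain ⟨P, hP, e⟩ := exists_primitive_plus hf.1
  rw [hf.eq_mk, e, res_D]

theorem IsPlus.coeff_neg {F : ℂ → ℂ} {f : Loop} (hf : IsPlus F f) {n : ℤ} (hn : n < 0) :
    coeff n f = 0 := by
  rw [coeff_eq_res]
  obtain ⟨k, hk⟩ := Int.eq_ofNat_of_zero_le (show 0 ≤ -n - 1 by omega)
  rw [hk]
  exact (hf.mul (isPlus_zp k)).res_eq_zero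

/-- Write F = F(0) + z G with G holomorphic at 0; the constant term of z G is the coefficient of
index -1 of G, which vanishes. -/
theorem IsPlus.coeff_zero {F : ℂ → ℂ} {f : Loop} (hf : IsPlus F f) : coeff 0 f = F 0 := by
  obtain ⟨p, hp⟩ := hf.1
  have hd : AnalyticAt ℂ (dslope F 0) 0 := hp.has_fpower_series_dslope_fslope.analyticAt
  have e : f = F 0 • (1 : Loop) + zp 1 * mk _ (AnalyticAt.isHol hd) := by
    rw [hf.eq_mk]
    refine Subtype.ext (Germ.coe_eq.2 (Eventually.of_forall fun z => ?_))
    change F z = F 0 * 1 + z ^ (1 : ℤ) * dslope F 0 z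
    have := sub_smul_dslope F 0 z
    rw [sub_zero, smul_eq_mul] at this
    rw [zpow_one, this]
    ring
  have hg : IsPlus (dslope F 0) (mk _ (AnalyticAt.isHol hd)) := ⟨hd, rfl⟩
  rw [e, map_add, map_smul, coeff_one, if_pos rfl, coeff_zp_mul, hg.coeff_neg (by norm_num),
    smul_eq_mul, mul_one, add_zero]

/-- In the coordinate w = 1/z one has z^{-2} dz = -dw, and an entire function of w has a primitive.
-/
theorem IsMinus.res_zp_mul {F : ℂ → ℂ} {f : Loop} (hf : IsMinus F f) : res (zp (-2) * f) = 0 := by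
  obtain ⟨P, hP, e⟩ := exists_primitive_minus hf.1
  have h := res_D (mk (fun z => P z⁻¹) (isHol_inv hP))
  rw [D_minus e _ (isHol_aux hf.1)] at h
  have h2 : zp (-2) * f = -mk (fun z => -(z ^ 2)⁻¹ * F z⁻¹) (isHol_aux hf.1) := by
    refine (congrArg (zp (-2) * ·) hf.eq_mk).trans ?_
    refine Subtype.ext (Germ.coe_eq.2 (Eventually.of_forall fun z => ?_))
    change z ^ (-2 : ℤ) * F z⁻¹ = -(-(z ^ 2)⁻¹ * F z⁻¹)
    rw [neg_mul, neg_neg, zpow_neg]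
    rfl
  rw [h2, map_neg, h, neg_zero]

theorem IsMinus.coeff_pos {F : ℂ → ℂ} {f : Loop} (hf : IsMinus F f) {n : ℤ} (hn : 0 < n) :
    coeff n f = 0 := by
  obtain ⟨k, hk⟩ := Int.eq_ofNat_of_zero_le (show 0 ≤ n - 1 by omega)
  have := (hf.mul (isMinus_zp k)).res_zp_mul
  rw [mul_left_comm, zp_mul] at this
  rwa [coeff_eq_res, show -n - 1 = -2 + -(k : ℤ) by omega]

theorem IsMinus.coeff_zero {F : ℂ → ℂ} {f : Loop} (hf : IsMinus F f) : coeff 0 f = F 0 := by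
  have hd : Differentiable ℂ (dslope F 0) := by
    rw [← differentiableOn_univ]
    exact (Complex.differentiableOn_dslope Filter.univ_mem).2 hf.1.differentiableOn
  have hg : IsMinus (dslope F 0) (mk _ (isHol_inv hd)) := ⟨hd, rfl⟩
  have e : f = F 0 • (1 : Loop) + zp (-1) * mk _ (isHol_inv hd) := by
    rw [hf.eq_mk]
    refine Subtype.ext (Germ.coe_eq.2 (Eventually.of_forall fun z => ?_))
    change F z⁻¹ = F 0 * 1 + z ^ (-1 : ℤ) * dslope F 0 z⁻¹
    have := sub_smul_dslope F 0 z⁻¹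
    rw [sub_zero, smul_eq_mul] at this
    rw [zpow_neg_one, this]
    ring
  rw [e, map_add, map_smul, coeff_one, if_pos rfl, coeff_zp_mul, hg.coeff_pos (by norm_num),
    smul_eq_mul, mul_one, add_zero]

/-- The chosen logarithm is arbitrary, but its derivative is that of a germ holomorphic at 0, from
which it can differ only by a constant. -/
theorem exists_isPlus_log {u : L0} {F : ℂ → ℂ} (h : IsPlus F (u : Loopˣ)) (h0 : F 0 ≠ 0) :
    ∃ P : ℂ → ℂ, IsPlus P (log u) := by
  obtain ⟨P, hP, e⟩ := D_log_plus h h0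
  have hp : IsPlus P (mk P (AnalyticAt.isHol hP)) := ⟨hP, rfl⟩
  rw [eq_add_of_D_eq e]
  exact ⟨_, hp.add (IsPlus.const _)⟩

theorem exists_isMinus_log {u : L0} {F : ℂ → ℂ} (h : IsMinus F (u : Loopˣ)) (h0 : ∀ w, F w ≠ 0) :
    ∃ P : ℂ → ℂ, IsMinus P (log u) := by
  obtain ⟨P, hP, e⟩ := D_log_minus h h0
  have hp : IsMinus P (mk (fun z => P z⁻¹) (isHol_inv hP)) := ⟨hP, rfl⟩
  rw [eq_add_of_D_eq e]
  exact ⟨_, hp.add (IsMinus.const _)⟩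

theorem om_eq_zero_of_plus {f g : Loop} {F G : ℂ → ℂ} (hf : IsPlus F f) (hg : IsPlus G g) :
    om f g = 0 := by
  have : IsPlus (deriv F) (D f) := ⟨hf.1.deriv, by rw [hf.eq_mk]; rfl⟩
  exact (this.mul hg).res_eq_zero

theorem IsMinus.exists_D_eq {F : ℂ → ℂ} {f : Loop} (hf : IsMinus F f) :
    ∃ (G : ℂ → ℂ) (g : Loop), IsMinus G g ∧ D f = (-1 : ℂ) • (zp (-2) * g) := by
  refine ⟨deriv F, mk (fun z => deriv F z⁻¹) (isHol_inv hf.1.deriv), ⟨hf.1.deriv, rfl⟩, ?_⟩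
  refine ((congrArg D hf.eq_mk).trans
    (D_minus (fun z => (hf.1 z).hasDerivAt) _ (isHol_aux hf.1.deriv))).trans ?_
  refine Subtype.ext (Germ.coe_eq.2 (Eventually.of_forall fun z => ?_))
  change -(z ^ 2)⁻¹ * deriv F z⁻¹ = -1 * (z ^ (-2 : ℤ) * deriv F z⁻¹)
  rw [neg_mul, neg_one_mul, zpow_neg]
  rfl

theorem om_eq_zero_of_minus {f g : Loop} {F G : ℂ → ℂ} (hf : IsMinus F f) (hg : IsMinus G g) :
    om f g = 0 := by
  obtain ⟨E, e, he, h⟩ := hf.exists_D_eq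
  rw [om, h, smul_mul_assoc, mul_assoc, map_smul, (he.mul hg).res_zp_mul, smul_zero]

theorem om_zp (f : Loop) (k : ℤ) : om f (zp k) = -(k : ℂ) * coeff (-k) f := by
  rw [om, mul_comm, res_eq_coeff, coeff_zp_mul, coeff_D]
  rw [show -1 - k + 1 = -k by ring]
  push_cast
  ring

end GL1Loop

/-! ### Coordinates and product formulas on `H` -/

namespace GL1Loop

/-- `Γ(h)` as a unit. -/
def gamU (h : H) : ℂˣ := h.1.1.Gam

theorem gamFun_eq (h : H) : gamFun h = gamU h := rfl

theorem gam_snd (h : H) : h.1.2.Gam = (gamU h)⁻¹ := (inv_eq_of_mul_eq_one_right h.2.2.1).symm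

theorem gamU_mul (h h' : H) : gamU (h * h') = gamU h * gamU h' := rfl

theorem gamU_one : gamU 1 = 1 := rfl

theorem exists_log_fst (h : H) : ∃ P : ℂ → ℂ, IsPlus P (log h.1.1.loop) := by
  obtain ⟨-, -, F, G, hF, -, -, h1⟩ := h.2
  exact exists_isPlus_log hF (left_ne_zero_of_mul_eq_one h1)

theorem exists_log_snd (h : H) : ∃ P : ℂ → ℂ, IsMinus P (log h.1.2.loop) := by
  obtain ⟨-, -, F, G, -, hG, h0, -⟩ := h.2
  exact exists_isMinus_log hG h0

theorem kFun_mul (h h' : H) : kFun (h * h') = kFun h * kFun h' := by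
  obtain ⟨-, -, F, G, hF, -, -, -⟩ := h.2
  obtain ⟨-, -, F', G', hF', -, -, -⟩ := h'.2
  have e : IsPlus _ ((h * h').1.1.loop : Loopˣ) :=
    (hF.rescale h'.1.1.Gam⁻¹).mul (hF'.rescale h.1.1.Gam)
  rw [kFun, kFun, kFun, e.coeff_zero, hF.coeff_zero, hF'.coeff_zero]
  simp

theorem kFun_one : kFun 1 = 1 := by
  change coeff 0 (1 : Loop) = 1
  rw [coeff_one, if_pos rfl]

/-- The cocycle vanishes on two loops that are holomorphic at 0, so the central extension splits
over `H`. -/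
theorem lamFun_mul (h h' : H) : lamFun (h * h') = lamFun h * lamFun h' := by
  obtain ⟨-, -, F, G, hF, -, -, e⟩ := h.2
  obtain ⟨-, -, F', G', hF', -, -, e'⟩ := h'.2
  have e1 : IsPlus _ ((rescaleL0 h'.1.1.Gam⁻¹ h.1.1.loop : L0) : Loopˣ) :=
    hF.rescale h'.1.1.Gam⁻¹
  have e2 : IsPlus _ ((rescaleL0 h.1.1.Gam h'.1.1.loop : L0) : Loopˣ) := hF'.rescale h.1.1.Gam
  have n1 : F 0 ≠ 0 := left_ne_zero_of_mul_eq_one e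
  have n2 : F' 0 ≠ 0 := left_ne_zero_of_mul_eq_one e'
  refine (Ghat.mul_Lam _ _).trans ?_
  rw [cocycle_plus e1 (by simpa using n1) e2 (by simpa using n2), Complex.exp_zero, mul_one]
  rfl

theorem lamFun_one : lamFun 1 = 1 := rfl

theorem lamFun_ne_zero (h : H) : lamFun h ≠ 0 := Units.ne_zero _

theorem kFun_ne_zero (h : H) : kFun h ≠ 0 := by
  intro e
  have := kFun_mul h h⁻¹
  rw [mul_inv_cancel, kFun_one, e, zero_mul] at this
  exact one_ne_zero this

/-- Two logarithms of the same loop have equal derivatives, so the choice affects only the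
coefficient of index 0. -/
theorem coeff_log {u : L0} {f : Loop} (h : exp f = u) {m : ℤ} (hm : m ≠ 0) :
    coeff m (log u) = coeff m f := coeff_eq_of_D_eq (D_log h) hm

theorem hFun_eq_of_pos (m : {m : ℤ // m ≠ 0}) (hm : 0 < m.1) (h : H) :
    hFun m h = coeff m (log h.1.1.loop) := if_pos hm

theorem hFun_eq_of_neg (m : {m : ℤ // m ≠ 0}) (hm : m.1 < 0) (h : H) :
    hFun m h = coeff m (log h.1.2.loop) := if_neg hm.not_gt

theorem coeff_log_mul (x y : Ghat) {m : ℤ} (hm : m ≠ 0) : coeff m (log (x * y).loop) =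
    ((y.Gam⁻¹ ^ m : ℂˣ) : ℂ) * coeff m (log x.loop) +
      ((x.Gam ^ m : ℂˣ) : ℂ) * coeff m (log y.loop) := by
  rw [coeff_log (f := rescale y.Gam⁻¹ (log x.loop) + rescale x.Gam (log y.loop)) _ hm, map_add,
    coeff_rescale, coeff_rescale]
  rw [exp_add, exp_rescale_log, exp_rescale_log]
  rfl

/-- Rescaling by γ multiplies the coefficient of z^m by γ^m. For m < 0 the logarithm in the second
component is used, where Γ is replaced by its inverse; this turns the exponents ∓m into ∓|m|. -/
theorem hFun_mul (m : {m : ℤ // m ≠ 0}) (h h' : H) : hFun m (h * h') =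
    ((gamU h' ^ (-|m.1|) : ℂˣ) : ℂ) * hFun m h + ((gamU h ^ |m.1| : ℂˣ) : ℂ) * hFun m h' := by
  rcases lt_or_gt_of_ne m.2 with hm | hm
  · rw [hFun_eq_of_neg m hm, hFun_eq_of_neg m hm, hFun_eq_of_neg m hm, abs_of_neg hm]
    refine (coeff_log_mul _ _ m.2).trans ?_
    rw [gam_snd, gam_snd, inv_inv, inv_zpow', neg_neg]
  · rw [hFun_eq_of_pos m hm, hFun_eq_of_pos m hm, hFun_eq_of_pos m hm, abs_of_pos hm]
    refine (coeff_log_mul _ _ m.2).trans ?_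
    rw [inv_zpow']
    rfl

theorem hFun_one (m : {m : ℤ // m ≠ 0}) : hFun m 1 = 0 := by
  have := hFun_mul m 1 1
  simpa only [mul_one, gamU_one, one_zpow, Units.val_one, one_mul, left_eq_add] using this

/-- The coordinates of an element of the Lie algebra of `H`. -/
def hCoeff (m : {m : ℤ // m ≠ 0}) : ghat × ghat →ₗ[ℂ] ℂ :=
  if 0 < m.1 then coeff m ∘ₗ LinearMap.fst ℂ Loop (ℂ × ℂ) ∘ₗ LinearMap.fst ℂ ghat ghat
  else coeff m ∘ₗ LinearMap.fst ℂ Loop (ℂ × ℂ) ∘ₗ LinearMap.snd ℂ ghat ghat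

theorem hCoeff_of_pos {m : {m : ℤ // m ≠ 0}} (hm : 0 < m.1) (ξ : ghat × ghat) :
    hCoeff m ξ = coeff m ξ.1.1 := by
  rw [hCoeff, if_pos hm]
  rfl

theorem hCoeff_of_neg {m : {m : ℤ // m ≠ 0}} (hm : m.1 < 0) (ξ : ghat × ghat) :
    hCoeff m ξ = coeff m ξ.2.1 := by
  rw [hCoeff, if_neg hm.not_gt]
  rfl

theorem gamU_pathH (ξ : hLie) (t : ℂ) : (gamU (pathH ξ t) : ℂ) = Complex.exp (t * ξ.1.1.2.2) := rfl

theorem lamFun_pathH (ξ : hLie) (t : ℂ) : lamFun (pathH ξ t) = Complex.exp (t * ξ.1.1.2.1) := rfl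

theorem kFun_pathH (ξ : hLie) (t : ℂ) :
    kFun (pathH ξ t) = Complex.exp (t * coeff 0 ξ.1.1.1) := by
  obtain ⟨-, F, G, hF, -, -⟩ := ξ.2
  rw [hF.coeff_zero]
  exact ((hF.smul t).exp).coeff_zero

theorem hFun_pathH (m : {m : ℤ // m ≠ 0}) (ξ : hLie) (t : ℂ) :
    hFun m (pathH ξ t) = t * hCoeff m ξ.1 := by
  rcases lt_or_gt_of_ne m.2 with hm | hm
  · rw [hFun_eq_of_neg m hm, hCoeff_of_neg hm]
    exact (coeff_log rfl m.2).trans (map_smul _ _ _)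
  · rw [hFun_eq_of_pos m hm, hCoeff_of_pos hm]
    exact (coeff_log rfl m.2).trans (map_smul _ _ _)

/-- The element `z ^ m` of the Lie algebra of `H`. -/
def hVec (m : {m : ℤ // m ≠ 0}) : ghat × ghat :=
  if 0 < m.1 then ((zp m, 0, 0), 0) else (0, (zp m, 0, 0))

theorem hVec_of_pos {m : {m : ℤ // m ≠ 0}} (hm : 0 < m.1) : hVec m = ((zp m, 0, 0), 0) := if_pos hm

theorem hVec_of_neg {m : {m : ℤ // m ≠ 0}} (hm : m.1 < 0) : hVec m = (0, (zp m, 0, 0)) :=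
  if_neg hm.not_gt

theorem isPlus_zero : IsPlus (fun _ => 0) 0 := ⟨analyticAt_const, rfl⟩

theorem isMinus_zero : IsMinus (fun _ => 0) 0 := ⟨differentiable_const _, rfl⟩

theorem isPlus_zp_of_pos {m : ℤ} (hm : 0 < m) : ∃ F : ℂ → ℂ, IsPlus F (zp m) ∧ F 0 = 0 := by
  obtain ⟨k, rfl⟩ := Int.eq_ofNat_of_zero_le hm.le
  exact ⟨_, isPlus_zp k, zero_pow (by omega)⟩

theorem isMinus_zp_of_neg {m : ℤ} (hm : m < 0) : ∃ F : ℂ → ℂ, IsMinus F (zp m) ∧ F 0 = 0 := by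
  obtain ⟨k, hk⟩ := Int.eq_ofNat_of_zero_le (show 0 ≤ -m by omega)
  obtain rfl : m = -k := by omega
  exact ⟨_, isMinus_zp k, zero_pow (by omega)⟩

theorem hVec_mem (m : {m : ℤ // m ≠ 0}) : hVec m ∈ hLie := by
  rcases lt_or_gt_of_ne m.2 with hm | hm
  · rw [hVec_of_neg hm]
    obtain ⟨F, hF, h0⟩ := isMinus_zp_of_neg hm
    exact ⟨neg_zero.symm, _, F, isPlus_zero, hF, by rw [h0, neg_zero]⟩
  · rw [hVec_of_pos hm]
    obtain ⟨F, hF, h0⟩ := isPlus_zp_of_pos hm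
    exact ⟨neg_zero.symm, F, _, hF, isMinus_zero, by rw [h0, neg_zero]⟩

/-- The element of the Lie algebra of `H` with the coordinates `a`, `l`, `g` for `k`, `Λ`, `Γ`. -/
def cVec (a l g : ℂ) : ghat × ghat := ((a • 1, l, g), (-a • 1, -l, -g))

theorem cVec_mem (a l g : ℂ) : cVec a l g ∈ hLie :=
  ⟨rfl, _, _, IsPlus.const a, IsMinus.const (-a), (neg_neg a).symm⟩

theorem hCoeff_hVec (m n : {m : ℤ // m ≠ 0}) : hCoeff m (hVec n) = if m = n then 1 else 0 := by
  have hmn : (m = n) = (m.1 = n.1) := propext Subtype.ext_iff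
  rcases lt_or_gt_of_ne m.2 with hm | hm <;> rcases lt_or_gt_of_ne n.2 with hn | hn
  · simp only [hCoeff_of_neg hm, hVec_of_neg hn, coeff_zp, hmn]
  · rw [hCoeff_of_neg hm, hVec_of_pos hn, if_neg (by rw [hmn]; omega)]
    exact map_zero _
  · rw [hCoeff_of_pos hm, hVec_of_neg hn, if_neg (by rw [hmn]; omega)]
    exact map_zero _
  · simp only [hCoeff_of_pos hm, hVec_of_pos hn, coeff_zp, hmn]

theorem hCoeff_cVec (m : {m : ℤ // m ≠ 0}) (a l g : ℂ) : hCoeff m (cVec a l g) = 0 := by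
  rcases lt_or_gt_of_ne m.2 with hm | hm
  · rw [hCoeff_of_neg hm]
    exact (map_smul _ _ _).trans (by rw [coeff_one, if_neg m.2, smul_zero])
  · rw [hCoeff_of_pos hm]
    exact (map_smul _ _ _).trans (by rw [coeff_one, if_neg m.2, smul_zero])

theorem coeff_zero_hVec (m : {m : ℤ // m ≠ 0}) : coeff 0 (hVec m).1.1 = 0 := by
  rcases lt_or_gt_of_ne m.2 with hm | hm
  · rw [hVec_of_neg hm]
    exact map_zero _
  · rw [hVec_of_pos hm, coeff_zp, if_neg m.2.symm]

theorem hVec_fst_snd (m : {m : ℤ // m ≠ 0}) : (hVec m).1.2 = 0 := by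
  rcases lt_or_gt_of_ne m.2 with hm | hm
  · rw [hVec_of_neg hm]
    rfl
  · rw [hVec_of_pos hm]
    rfl

theorem coeff_zero_cVec (a l g : ℂ) : coeff 0 (cVec a l g).1.1 = a :=
  (map_smul _ _ _).trans (by rw [coeff_one, if_pos rfl, smul_eq_mul, mul_one])

/-- There are points of `H` with given coordinates, finitely many of the `h_m` being nonzero. -/
theorem exists_point (k l g : ℂˣ) (c : {m : ℤ // m ≠ 0} →₀ ℂ) :
    ∃ h : H, kFun h = k ∧ lamFun h = l ∧ gamFun h = g ∧ ∀ m, hFun m h = c m := by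
  have hs : c.sum (fun m x => x • hVec m) ∈ hLie :=
    hLie.sum_mem fun m _ => hLie.smul_mem _ (hVec_mem m)
  have h0 : coeff 0 (c.sum (fun m x => x • hVec m)).1.1 = 0 := by
    have : (coeff 0 ∘ₗ LinearMap.fst ℂ Loop (ℂ × ℂ) ∘ₗ LinearMap.fst ℂ ghat ghat)
        (c.sum (fun m x => x • hVec m)) = 0 := by
      rw [map_finsuppSum]
      refine Finset.sum_eq_zero fun m _ => ?_
      refine (map_smul _ _ _).trans ?_
      exact (congrArg (c m • ·) (coeff_zero_hVec m)).trans (smul_zero _)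
    exact this
  have h1 : (c.sum (fun m x => x • hVec m)).1.2 = 0 := by
    have : (LinearMap.snd ℂ Loop (ℂ × ℂ) ∘ₗ LinearMap.fst ℂ ghat ghat)
        (c.sum (fun m x => x • hVec m)) = 0 := by
      rw [map_finsuppSum]
      refine Finset.sum_eq_zero fun m _ => ?_
      refine (map_smul _ _ _).trans ?_
      exact (congrArg (c m • ·) (hVec_fst_snd m)).trans (smul_zero _)
    exact this
  -- The required point is the exponential of this element: logarithms of k, Λ, Γ as central
  -- coordinates and the prescribed h_m as Laurent coefficients.
  let ξ : hLie := ⟨cVec (Complex.log k) (Complex.log l) (Complex.log g) +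
    c.sum (fun m x => x • hVec m), hLie.add_mem (cVec_mem _ _ _) hs⟩
  refine ⟨pathH ξ 1, ?_, ?_, ?_, fun m => ?_⟩
  · rw [kFun_pathH, one_mul]
    have : coeff 0 ξ.1.1.1 = Complex.log k := by
      refine (map_add _ _ _).trans ?_
      rw [h0, add_zero, coeff_zero_cVec]
    rw [this, Complex.exp_log k.ne_zero]
  · rw [lamFun_pathH, one_mul]
    have : ξ.1.1.2.1 = Complex.log l := by
      refine (congrArg (fun x : ℂ × ℂ => Complex.log l + x.1) h1).trans ?_
      simp
    rw [this, Complex.exp_log l.ne_zero]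
  · rw [gamFun_eq, gamU_pathH, one_mul]
    have : ξ.1.1.2.2 = Complex.log g := by
      refine (congrArg (fun x : ℂ × ℂ => Complex.log g + x.2) h1).trans ?_
      simp
    rw [this, Complex.exp_log g.ne_zero]
  · rw [hFun_pathH, one_mul]
    refine (map_add _ _ _).trans ?_
    rw [hCoeff_cVec, zero_add, map_finsuppSum]
    simp only [map_smul, hCoeff_hVec, smul_eq_mul, mul_ite, mul_one, mul_zero]
    exact c.sum_ite_self_eq m

end GL1Loop

/-! ### Separation of polynomials by points -/

/-- A polynomial involves finitely many variables, so any point can be cut off to a finitely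
supported one with the same value. Such points are the ones that `exists_point` provides. -/
theorem MvPolynomial.eq_zero_of_eval_finsupp {σ : Type*} {p : MvPolynomial σ ℂ}
    (h : ∀ c : σ →₀ ℂ, eval c p = 0) : p = 0 := by
  classical
  refine MvPolynomial.funext fun x => ?_
  rw [map_zero, ← h (Finsupp.onFinset p.vars (fun i => if i ∈ p.vars then x i else 0)
    fun i hi => by by_contra hn; exact hi (if_neg hn))]
  refine eval₂Hom_congr' rfl (fun i hi _ => ?_) rfl
  rw [Finsupp.onFinset_apply, if_pos hi]

namespace Heisenberg

/-- Distinct Laurent monomials are distinct characters of the torus, as powers of 2 tell the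
exponents apart, and distinct characters are linearly independent. -/
theorem Lau.eq_zero {s : Lau ℂ} (h : ∀ l g k : ℂˣ, lauLift l g k s = 0) : s = 0 := by
  let χ : ℤ × ℤ × ℤ → (ℂˣ × ℂˣ × ℂˣ →* ℂ) := fun e =>
    { toFun := fun x => ((x.1 ^ e.1 * x.2.1 ^ e.2.1 * x.2.2 ^ e.2.2 : ℂˣ) : ℂ)
      map_one' := by simp
      map_mul' := fun x y => by
        rw [← Units.val_mul]
        congr 1
        simp only [Prod.fst_mul, Prod.snd_mul, mul_zpow]
        simp only [mul_assoc, mul_left_comm] }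
  have two : ∀ a b : ℤ, (2 : ℂ) ^ a = 2 ^ b → a = b := by
    intro a b hab
    have := congrArg norm hab
    rw [norm_zpow, norm_zpow, Complex.norm_ofNat] at this
    exact zpow_right_injective₀ (by norm_num) (by norm_num) this
  let t : ℂˣ := Units.mk0 2 two_ne_zero
  have hχ : Function.Injective χ := by
    intro e e' he
    have h1 := DFunLike.congr_fun he (t, 1, 1)
    have h2 := DFunLike.congr_fun he (1, t, 1)
    have h3 := DFunLike.congr_fun he (1, 1, t)
    simp only [χ, t, MonoidHom.coe_mk, OneHom.coe_mk, one_zpow, mul_one, one_mul,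
      Units.val_zpow_eq_zpow_val, Units.val_mk0] at h1 h2 h3
    exact Prod.ext (two _ _ h1) (Prod.ext (two _ _ h2) (two _ _ h3))
  have li := (linearIndependent_monoidHom (ℂˣ × ℂˣ × ℂˣ) ℂ).comp χ hχ
  have e : s.coeff = 0 := by
    refine linearIndependent_iff.1 li s.coeff (funext fun x => ?_)
    rw [Finsupp.linearCombination_apply, Finsupp.sum, Finset.sum_apply]
    have := h x.1 x.2.1 x.2.2
    rw [lauLift, AddMonoidAlgebra.lift_apply] at this
    exact this
  exact AddMonoidAlgebra.coeff_injective e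

theorem map_polLift {B B' : Type*} [CommRing B] [Algebra ℂ B] [CommRing B'] [Algebra ℂ B']
    (φ : B →ₐ[ℂ] B') {l g k : Bˣ} {h : Idx → B} {l' g' k' : B'ˣ} {h' : Idx → B'} (hl : φ l = l')
    (hg : φ g = g') (hk : φ k = k') (hh : ∀ m, φ (h m) = h' m) (p : Pol ℂ) :
    φ (polLift l g k h p) = polLift l' g' k' h' p := by
  have e : ∀ s, φ (lauLift l g k s) = lauLift l' g' k' s := by
    intro s
    induction s using AddMonoidAlgebra.induction_linear with
    | zero => rw [map_zero, map_zero, map_zero]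
    | add s t hs ht => rw [map_add, map_add, hs, ht, map_add]
    | single x c =>
      rw [lauLift_single, lauLift_single, map_smul, Units.val_mul, Units.val_mul, Units.val_mul,
        Units.val_mul, map_mul, map_mul, map_zpow_unit φ hl, map_zpow_unit φ hg,
        map_zpow_unit φ hk]
  induction p using MvPolynomial.induction_on with
  | C a => rw [polLift_C, polLift_C, e]
  | add p q hp hq => rw [map_add, map_add, hp, hq, map_add]
  | mul_X p m hp => rw [map_mul, map_mul, hp, map_mul, polLift_X, polLift_X, hh]

/-- The evaluation of a polynomial at a point. -/
theorem polLift_eq_eval (l g k : ℂˣ) (c : Idx → ℂ) (p : Pol ℂ) :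
    polLift l g k c p = MvPolynomial.eval c (MvPolynomial.map (lauLift l g k : Lau ℂ →+* ℂ) p) :=
  (MvPolynomial.eval_map _ _ _).symm

theorem Pol.eq_zero {p : Pol ℂ} (h : ∀ (l g k : ℂˣ) (c : Idx →₀ ℂ), polLift l g k c p = 0) :
    p = 0 := by
  refine MvPolynomial.ext _ _ fun e => Lau.eq_zero fun l g k => ?_
  have : MvPolynomial.map (lauLift l g k : Lau ℂ →+* ℂ) p = 0 :=
    MvPolynomial.eq_zero_of_eval_finsupp fun c => (polLift_eq_eval l g k c p).symm.trans (h l g k c)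
  have := congrArg (MvPolynomial.coeff e) this
  rwa [MvPolynomial.coeff_map] at this

end Heisenberg

/-! ### The isomorphism between ℂ[H] and `Z1` -/

namespace GL1Loop
open Heisenberg

attribute [local instance] semiringZ commSemiringZ ringZ addCommMonoidZ addCommGroupZ algebraZ moduleZ
  semiringZZ commRingZZ addCommMonoidZZ addCommGroupZZ algebraZZ moduleZZ

/-- `Λ` as a unit of `ℂ[H]`. -/
def lamC : CHˣ where
  val := ⟨lamFun, lamFun_mem⟩
  inv := ⟨lamFun⁻¹, Algebra.subset_adjoin (by simp)⟩
  val_inv := Subtype.ext (funext fun h => mul_inv_cancel₀ (lamFun_ne_zero h))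
  inv_val := Subtype.ext (funext fun h => inv_mul_cancel₀ (lamFun_ne_zero h))

/-- `Γ` as a unit of `ℂ[H]`. -/
def gamC : CHˣ where
  val := ⟨gamFun, gamFun_mem⟩
  inv := ⟨gamFun⁻¹, Algebra.subset_adjoin (by simp)⟩
  val_inv := Subtype.ext (funext fun h => mul_inv_cancel₀ (gamU h).ne_zero)
  inv_val := Subtype.ext (funext fun h => inv_mul_cancel₀ (gamU h).ne_zero)

/-- `k` as a unit of `ℂ[H]`. -/
def kC : CHˣ where
  val := ⟨kFun, kFun_mem⟩
  inv := ⟨kFun⁻¹, Algebra.subset_adjoin (by simp)⟩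
  val_inv := Subtype.ext (funext fun h => mul_inv_cancel₀ (kFun_ne_zero h))
  inv_val := Subtype.ext (funext fun h => inv_mul_cancel₀ (kFun_ne_zero h))

/-- `h_m` as an element of `ℂ[H]`. -/
def hC (m : {m : ℤ // m ≠ 0}) : CH := ⟨hFun m, hFun_mem m⟩

theorem ev_eq (h : H) (F : CH) : ev h F = F.1 h := rfl

/-- The map from `Z₁` to the functions on `H`. -/
def ofZ1 : Z1 →ₐ[ℂ] CH := Z1lift lamC gamC kC hC

/-- A polynomial that vanishes as a function on `H` vanishes at all invertible Λ, Γ, k and all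
finitely supported h_m. -/
theorem polLift_injective : Function.Injective (polLift lamC gamC kC hC) := by
  refine (injective_iff_map_eq_zero _).2 fun p hp => Pol.eq_zero fun l g k c => ?_
  obtain ⟨h, h1, h2, h3, h4⟩ := exists_point k l g c
  rw [← map_polLift (ev h) (l := lamC) (g := gamC) (k := kC) (h := hC) h2 h3 h1 h4, hp, map_zero]

theorem ofZ1_injective : Function.Injective ofZ1 := polLift_injective.comp symbol_injective

theorem ofZ1_surjective : Function.Surjective ofZ1 := by
  have inv : ∀ (v : Z1ˣ) (w : CHˣ), ofZ1 v = w → ofZ1 (v⁻¹ : Z1ˣ) = (w⁻¹ : CHˣ) := by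
    intro v w e
    have := map_zpow_unit ofZ1 e (-1)
    rwa [zpow_neg_one, zpow_neg_one] at this
  have hl : ofZ1 zLam = lamC := Z1lift_zLam _ _ _ _
  have hg : ofZ1 zGam = gamC := Z1lift_zGam _ _ _ _
  have hk : ofZ1 zk = kC := Z1lift_zk _ _ _ _
  have key : CH ≤ ofZ1.range.map CH.val := by
    refine Algebra.adjoin_le ?_
    rintro _ ((rfl | rfl | rfl | rfl | rfl | rfl) | ⟨m, rfl⟩)
    · exact ⟨_, ⟨_, hk⟩, rfl⟩
    · exact ⟨_, ⟨_, inv zkU kC hk⟩, rfl⟩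
    · exact ⟨_, ⟨_, hl⟩, rfl⟩
    · exact ⟨_, ⟨_, inv zLamU lamC hl⟩, rfl⟩
    · exact ⟨_, ⟨_, hg⟩, rfl⟩
    · exact ⟨_, ⟨_, inv zGamU gamC hg⟩, rfl⟩
    · exact ⟨_, ⟨_, Z1lift_zh _ _ _ _ m⟩, rfl⟩
  intro F
  obtain ⟨G, ⟨x, hx⟩, hG⟩ := key F.2
  exact ⟨x, hx.trans (Subtype.ext hG)⟩

/-- The isomorphism from the functions on `H` to `Z₁`. -/
def Phi : CH ≃ₐ[ℂ] Z1 := (AlgEquiv.ofBijective ofZ1 ⟨ofZ1_injective, ofZ1_surjective⟩).symm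

theorem Phi_ofZ1 (x : Z1) : Phi (ofZ1 x) = x := Phi.apply_symm_apply x

theorem ofZ1_zLam : ofZ1 zLam = lamC := Z1lift_zLam _ _ _ _

theorem ofZ1_zGam : ofZ1 zGam = gamC := Z1lift_zGam _ _ _ _

theorem ofZ1_zk : ofZ1 zk = kC := Z1lift_zk _ _ _ _

theorem ofZ1_zh (m : {m : ℤ // m ≠ 0}) : ofZ1 (zh m) = hC m := Z1lift_zh _ _ _ _ m

theorem ofZ1_zGamU_zpow (n : ℤ) (h : H) :
    (ofZ1 ((zGamU ^ n : Z1ˣ) : Z1)).1 h = ((gamU h ^ n : ℂˣ) : ℂ) := by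
  refine (congrArg (ev h) (Z1lift_zGamU_zpow lamC gamC kC hC n)).trans ?_
  exact map_zpow_unit (ev h) rfl n

theorem Phi_lamC : Phi lamC = zLam := by rw [← ofZ1_zLam, Phi_ofZ1]

theorem Phi_gamC : Phi gamC = zGam := by rw [← ofZ1_zGam, Phi_ofZ1]

theorem Phi_kC : Phi kC = zk := by rw [← ofZ1_zk, Phi_ofZ1]

theorem Phi_hC (m : {m : ℤ // m ≠ 0}) : Phi (hC m) = zh m := by rw [← ofZ1_zh, Phi_ofZ1]

theorem algebraicIndependent_coordinates : AlgebraicIndependent ℂ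
    (Sum.elim ![lamFun, gamFun, kFun] hFun : Fin 3 ⊕ {m : ℤ // m ≠ 0} → H → ℂ) := by
  refine algebraicIndependent_iff.2 fun p hp => ?_
  set x : Fin 3 ⊕ {m : ℤ // m ≠ 0} → H → ℂ := Sum.elim ![lamFun, gamFun, kFun] hFun
  have hev : ∀ h : H, MvPolynomial.eval (fun i => x i h) p = 0 := by
    intro h
    have := congrArg (Pi.evalAlgHom ℂ (fun _ : H => ℂ) h) hp
    rw [map_zero, ← AlgHom.comp_apply, MvPolynomial.comp_aeval] at this
    exact this
  -- No point of `H` has a zero value of Λ, Γ or k. The factor ΛΓk makes the product vanish at such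
  -- arguments too, so that all finitely supported points are covered.
  have key : p * (MvPolynomial.X (Sum.inl 0) * MvPolynomial.X (Sum.inl 1) *
      MvPolynomial.X (Sum.inl 2)) = 0 := by
    refine MvPolynomial.eq_zero_of_eval_finsupp fun c => ?_
    simp only [map_mul, MvPolynomial.eval_X]
    by_cases h0 : c (Sum.inl 0) = 0
    · rw [h0]; ring
    by_cases h1 : c (Sum.inl 1) = 0
    · rw [h1]; ring
    by_cases h2 : c (Sum.inl 2) = 0
    · rw [h2]; ring
    obtain ⟨h, e1, e2, e3, e4⟩ := exists_point (Units.mk0 _ h2) (Units.mk0 _ h0) (Units.mk0 _ h1)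
      (c.comapDomain Sum.inr Sum.inr_injective.injOn)
    have : (fun i => x i h) = c := by
      funext i
      rcases i with i | m
      · fin_cases i
        · exact e2
        · exact e3
        · exact e1
      · exact e4 m
    rw [← this, hev h, zero_mul]
  exact (mul_eq_zero.1 key).resolve_right (mul_ne_zero (mul_ne_zero (MvPolynomial.X_ne_zero _)
    (MvPolynomial.X_ne_zero _)) (MvPolynomial.X_ne_zero _))

end GL1Loop

/-! ### Velocities and the adjoint action -/

/-- At t = 0 the difference quotient of t φ(t) is φ(t) itself, so continuity of φ suffices. The
cocycle terms of a conjugated path have this shape. -/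
theorem hasDerivAt_id_mul {φ : ℂ → ℂ} (h : ContinuousAt φ 0) :
    HasDerivAt (fun t => t * φ t) (φ 0) 0 := by
  rw [hasDerivAt_iff_tendsto_slope]
  refine (h.tendsto.mono_left nhdsWithin_le_nhds).congr' ?_
  filter_upwards [self_mem_nhdsWithin] with t ht
  rw [slope_def_field, sub_zero, zero_mul, sub_zero, mul_div_cancel_left₀ _ ht]

namespace GL1Loop

/-- Two lifts to the exponential chart have equal coefficients of nonzero index, and their constant
terms differ by a function c with e^c = 1. Since c is differentiable at 0 with c(0) = 0,
differentiating this relation at 0 gives c'(0) = 0. -/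
theorem HasVelocity.unique {p : ℂ → Ghat} {X Y : ghat} (hX : HasVelocity p X)
    (hY : HasVelocity p Y) : X = Y := by
  obtain ⟨-, ⟨f, f0, hf, f'⟩, hL, hG⟩ := hX
  obtain ⟨-, ⟨g, g0, hg, g'⟩, kL, kG⟩ := hY
  refine Prod.ext (ext_coeff fun n => ?_) (Prod.ext (hL.unique kL) (hG.unique kG))
  have hD : ∀ t, D (f t) = D (g t) := fun t => D_eq_of_exp_eq ((hf t).trans (hg t).symm)
  by_cases hn : n = 0
  · subst hn
    set c : ℂ → ℂ := fun t => coeff 0 (f t) - coeff 0 (g t)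
    have hc : HasDerivAt c (coeff 0 X.1 - coeff 0 Y.1) 0 := (f' 0).sub (g' 0)
    have c0 : c 0 = 0 := by simp only [c, f0, g0, sub_self]
    have he : ∀ t, Complex.exp (c t) = 1 := by
      intro t
      have e1 : exp (c t • (1 : Loop)) = 1 := by
        have := (hf t).trans (hg t).symm
        rw [eq_add_of_D_eq (hD t), exp_add] at this
        exact mul_eq_left.1 this
      have e2 := ((IsPlus.const (c t)).exp).coeff_zero
      rw [e1, Units.val_one, coeff_one, if_pos rfl] at e2
      exact e2.symm
    have h1 := hc.cexp
    rw [c0, Complex.exp_zero, one_mul] at h1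
    have h2 : HasDerivAt (fun t => Complex.exp (c t)) 0 0 := by
      rw [funext he]
      exact hasDerivAt_const _ _
    exact sub_eq_zero.1 (h1.unique h2)
  · refine (f' n).unique ?_
    have : (fun t => coeff n (f t)) = fun t => coeff n (g t) :=
      funext fun t => coeff_eq_of_D_eq (hD t) hn
    rw [this]
    exact g' n

/-- The unit `e ^ t`. -/
def expU (t : ℂ) : ℂˣ := Units.mk0 (Complex.exp t) (Complex.exp_ne_zero t)

theorem expU_zpow (t : ℂ) (n : ℤ) : ((expU t ^ n : ℂˣ) : ℂ) = Complex.exp (n * t) := by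
  rw [Units.val_zpow_eq_zpow_val, Complex.exp_int_mul]
  rfl

theorem om_smul_right (c : ℂ) (f g : Loop) : om f (c • g) = c * om f g := by
  rw [om, mul_smul_comm, map_smul, smul_eq_mul, om]

theorem om_neg_right (f g : Loop) : om f (-g) = -om f g := by
  have := om_smul_right (-1) f g
  rwa [neg_one_smul, neg_one_mul] at this

theorem om_smul_left (c : ℂ) (f g : Loop) : om (c • f) g = c * om f g := by
  rw [om_antisymm, om_smul_right, om_antisymm f]
  ring

theorem om_neg_left (f g : Loop) : om (-f) g = -om f g := by
  rw [om_antisymm, om_neg_right, om_antisymm f]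

theorem exp_rescale_eq (γ : ℂˣ) {f : Loop} {u : L0} (h : exp f = u) :
    exp (rescale γ f) = rescaleL0 γ u := by
  refine Units.ext ((rescale_exp γ f).symm.trans ?_)
  rw [h]
  rfl

theorem exp_add_eq {f g : Loop} {u v : L0} (hf : exp f = u) (hg : exp g = v) :
    exp (f + g) = (u * v : L0) := by
  rw [exp_add, hf, hg]
  rfl

theorem exp_path (X : ghat) (t : ℂ) : exp (t • X.1) = (path X t).loop := rfl

theorem gam_path (X : ghat) (t : ℂ) : (path X t).Gam = expU (t * X.2.2) := rfl

theorem exp_mul_loop {x y : Ghat} {f g : Loop} (hf : exp f = x.loop) (hg : exp g = y.loop) :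
    exp (rescale y.Gam⁻¹ f + rescale x.Gam g) = (x * y).loop :=
  exp_add_eq (exp_rescale_eq _ hf) (exp_rescale_eq _ hg)

theorem exp_inv_loop {x : Ghat} {f : Loop} (hf : exp f = x.loop) : exp (-f) = x⁻¹.loop := by
  rw [exp_neg, hf]
  rfl

theorem mul_Lam_eq {x y : Ghat} {f g : Loop} (hf : exp f = x.loop) (hg : exp g = y.loop) :
    ((x * y).Lam : ℂ) =
      x.Lam * y.Lam * Complex.exp (om (rescale y.Gam⁻¹ f) (rescale x.Gam g)) := by
  rw [Ghat.mul_Lam, cocycle_eq (exp_rescale_eq _ hf) (exp_rescale_eq _ hg)]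

theorem conj_path_loop {x : Ghat} {f : Loop} (hf : exp f = x.loop) (X : ghat) (t : ℂ) :
    exp (rescale (expU (t * X.2.2))⁻¹ (rescale x.Gam f) + t • rescale (x.Gam * x.Gam) X.1 -
      rescale (expU (t * X.2.2)) (rescale x.Gam f)) = (x * path X t * x⁻¹).loop := by
  rw [← exp_mul_loop (exp_mul_loop hf (exp_path X t)) (exp_inv_loop hf), Ghat.inv_Gam, inv_inv,
    Ghat.mul_Gam, gam_path, map_add, rescale_rescale, rescale_rescale, rescale_rescale,
    rescale_rescale, map_neg, map_smul, mul_comm x.Gam (expU _)⁻¹, sub_eq_add_neg]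

/-- Invariance of `om` under a common rescaling brings the cocycles of the two products to this
form. The last summand, which pairs the loop of `x` with a rescaling of itself, is the only one
without the factor t. -/
theorem conj_path_Lam {x : Ghat} {f : Loop} (hf : exp f = x.loop) (X : ghat) (t : ℂ) :
    ((x * path X t * x⁻¹).Lam : ℂ) = Complex.exp (t * X.2.1 +
      t * om (rescale (expU (t * X.2.2))⁻¹ f) (rescale x.Gam X.1) +
      t * om (rescale (expU (t * X.2.2)) f) (rescale x.Gam X.1) -
      om (rescale (expU (t * X.2.2))⁻¹ f) (rescale (expU (t * X.2.2)) f)) := by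
  have e : rescale (x.Gam * expU (t * X.2.2)) f = rescale x.Gam (rescale (expU (t * X.2.2)) f) := by
    rw [rescale_rescale, mul_comm]
  have hl : ((path X t).Lam : ℂ) = Complex.exp (t * X.2.1) := rfl
  rw [mul_Lam_eq (exp_mul_loop hf (exp_path X t)) (exp_inv_loop hf), mul_Lam_eq hf (exp_path X t),
    Ghat.inv_Gam, inv_inv, Ghat.mul_Gam, gam_path, map_neg, om_neg_right, e, om_rescale,
    om_add_left, map_smul, om_smul_right, om_smul_left, om_antisymm (rescale x.Gam X.1),
    Ghat.inv_Lam, Units.val_inv_eq_inv_val, hl]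
  have hx : (x.Lam : ℂ) ≠ 0 := x.Lam.ne_zero
  rw [sub_eq_add_neg, Complex.exp_add, Complex.exp_add, Complex.exp_add, neg_add, Complex.exp_add,
    mul_neg, neg_neg]
  field_simp

theorem conj_path_Gam (x : Ghat) (X : ghat) (t : ℂ) :
    ((x * path X t * x⁻¹).Gam : ℂ) = Complex.exp (t * X.2.2) := by
  have : (x * path X t * x⁻¹).Gam = (path X t).Gam := by
    rw [Ghat.mul_Gam, Ghat.mul_Gam, Ghat.inv_Gam, mul_comm, inv_mul_cancel_left]
  rw [this]
  rfl

/-- The operator `f ↦ z f'`. -/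
def zD : Loop →ₗ[ℂ] Loop := LinearMap.mulLeft ℂ (zp 1) ∘ₗ D

theorem coeff_zD (n : ℤ) (f : Loop) : coeff n (zD f) = n * coeff n f := by
  refine (coeff_zp_mul n 1 (D f)).trans ?_
  rw [coeff_D, sub_add_cancel]
  push_cast
  ring

/-- The adjoint action of an element with loop `e ^ f` and third component `γ`. -/
def adMap (f : Loop) (γ : ℂˣ) : ghat →ₗ[ℂ] ghat where
  toFun X := (rescale (γ * γ) X.1 - (2 * X.2.2) • zD (rescale γ f),
    X.2.1 + 2 * om f (rescale γ X.1), X.2.2)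
  map_add' X Y := by
    refine Prod.ext ?_ (Prod.ext ?_ rfl)
    · change rescale (γ * γ) (X.1 + Y.1) - (2 * (X.2.2 + Y.2.2)) • zD (rescale γ f) =
        rescale (γ * γ) X.1 - (2 * X.2.2) • zD (rescale γ f) +
          (rescale (γ * γ) Y.1 - (2 * Y.2.2) • zD (rescale γ f))
      rw [map_add, mul_add, add_smul]
      abel
    · change X.2.1 + Y.2.1 + 2 * om f (rescale γ (X.1 + Y.1)) =
        X.2.1 + 2 * om f (rescale γ X.1) + (Y.2.1 + 2 * om f (rescale γ Y.1))
      rw [map_add, om_add_right]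
      ring
  map_smul' c X := by
    refine Prod.ext ?_ (Prod.ext ?_ rfl)
    · change rescale (γ * γ) (c • X.1) - (2 * (c * X.2.2)) • zD (rescale γ f) =
        c • (rescale (γ * γ) X.1 - (2 * X.2.2) • zD (rescale γ f))
      rw [map_smul, smul_sub, smul_smul]
      congr 2
      ring
    · change c * X.2.1 + 2 * om f (rescale γ (c • X.1)) =
        c * (X.2.1 + 2 * om f (rescale γ X.1))
      rw [map_smul, om_smul_right]
      ring

/-- The explicit conjugated path is differentiated at t = 0. Hypothesis `h0` removes the cocycle
term that has no factor t; the other two cocycle terms have the factor t, so for them continuity at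
0 is enough. They have the same value at 0, whence the factor 2 in `adMap`. -/
theorem isAd_adMap {x : Ghat} {f : Loop} (hf : exp f = x.loop) (X : ghat)
    (h0 : ∀ t, om (rescale (expU (t * X.2.2))⁻¹ f) (rescale (expU (t * X.2.2)) f) = 0)
    (h1 : ContinuousAt (fun t => om (rescale (expU (t * X.2.2)) f) (rescale x.Gam X.1)) 0)
    (h2 : ContinuousAt (fun t => om (rescale (expU (t * X.2.2))⁻¹ f) (rescale x.Gam X.1)) 0) :
    IsAd x X (adMap f x.Gam X) := by
  have e0 : expU 0 = 1 := Units.ext (by simp [expU])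
  have hlin : ∀ c : ℂ, HasDerivAt (fun t => Complex.exp (t * c)) c 0 := by
    intro c
    have := ((hasDerivAt_id (0 : ℂ)).mul_const c).cexp
    simpa using this
  refine ⟨?_, ⟨_, ?_, conj_path_loop hf X, fun n => ?_⟩, ?_, ?_⟩
  · have : path X 0 = 1 := by
      refine Ghat.ext (Subtype.ext ?_) (Units.ext ?_) (Units.ext ?_)
      · change exp ((0 : ℂ) • X.1) = 1
        rw [zero_smul, exp_zero]
      · change Complex.exp (0 * X.2.1) = 1
        rw [zero_mul, Complex.exp_zero]
      · change Complex.exp (0 * X.2.2) = 1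
        rw [zero_mul, Complex.exp_zero]
    change x * path X 0 * x⁻¹ = 1
    rw [this, mul_one, mul_inv_cancel]
  · simp only [zero_mul, e0, inv_one, zero_smul, add_zero, sub_self]
  · have e : (fun t => coeff n (rescale (expU (t * X.2.2))⁻¹ (rescale x.Gam f) +
        t • rescale (x.Gam * x.Gam) X.1 - rescale (expU (t * X.2.2)) (rescale x.Gam f))) =
        fun t => Complex.exp (t * (-(n * X.2.2))) * coeff n (rescale x.Gam f) +
          t * coeff n (rescale (x.Gam * x.Gam) X.1) -
          Complex.exp (t * (n * X.2.2)) * coeff n (rescale x.Gam f) := by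
      funext t
      rw [map_sub, map_add, map_smul, coeff_rescale _ n (rescale x.Gam f),
        coeff_rescale _ n (rescale x.Gam f), inv_zpow', expU_zpow, expU_zpow, smul_eq_mul]
      rw [show (n : ℂ) * (t * X.2.2) = t * (n * X.2.2) by ring,
        show ((-n : ℤ) : ℂ) * (t * X.2.2) = t * (-(n * X.2.2)) by push_cast; ring]
    rw [e]
    refine ((((hlin _).mul_const _).add ((hasDerivAt_id (0 : ℂ)).mul_const _)).sub
      ((hlin _).mul_const _)).congr_deriv ?_
    change _ = coeff n (rescale (x.Gam * x.Gam) X.1 - (2 * X.2.2) • zD (rescale x.Gam f))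
    rw [map_sub, map_smul, coeff_zD, smul_eq_mul]
    ring
  · rw [funext (conj_path_Lam hf X)]
    simp only [h0, sub_zero]
    have := ((((hasDerivAt_id (0 : ℂ)).mul_const X.2.1).add (hasDerivAt_id_mul h2)).add
      (hasDerivAt_id_mul h1)).cexp
    refine this.congr_deriv ?_
    change _ = X.2.1 + 2 * om f (rescale x.Gam X.1)
    simp only [Pi.add_apply, id, e0, inv_one, rescale_one, zero_mul, add_zero, Complex.exp_zero]
    ring
  · rw [funext (conj_path_Gam x X)]
    exact hlin _

/-- Without a component along d the path does not rescale, so the cocycle functions are constant in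
t and no assumption on the loops is needed. -/
theorem isAd_of_snd_eq_zero {x : Ghat} {f : Loop} (hf : exp f = x.loop) {X : ghat}
    (h : X.2.2 = 0) : IsAd x X (adMap f x.Gam X) := by
  have e : ∀ t : ℂ, expU (t * X.2.2) = 1 := fun t => Units.ext (by simp [expU, h])
  refine isAd_adMap hf X (fun t => ?_) ?_ ?_
  · rw [e, inv_one]
    exact om_self _
  · simp only [e]
    exact continuousAt_const
  · simp only [e]
    exact continuousAt_const

/-- The Laurent polynomials. -/
def LauP : Submodule ℂ Loop := Submodule.span ℂ (Set.range zp)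

/-- Against a monomial only one Laurent coefficient of f enters, multiplied by an exponential in t;
linearity does the rest. This covers the differentials of functions in ℂ[H], whose loop components
are Laurent polynomials. -/
theorem continuous_om_rescale (f : Loop) (γ : ℂˣ) (c : ℂ) {a : Loop} (ha : a ∈ LauP) :
    Continuous fun t => om (rescale (expU (t * c)) f) (rescale γ a) := by
  induction ha using Submodule.span_induction with
  | mem a ha =>
    obtain ⟨k, rfl⟩ := ha
    simp only [rescale_zp, om_smul_right, om_zp, coeff_rescale, expU_zpow]
    fun_prop
  | zero =>
    simp only [map_zero, om, mul_zero]
    exact continuous_const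
  | add a b _ _ ha hb =>
    simp only [map_add, om_add_right]
    exact ha.add hb
  | smul r a _ ha =>
    simp only [map_smul, om_smul_right]
    exact continuous_const.mul ha

theorem isAd_of_mem_LauP {x : Ghat} {f : Loop} (hf : exp f = x.loop) {X : ghat} (h : X.1 ∈ LauP)
    (h0 : ∀ γ δ : ℂˣ, om (rescale γ f) (rescale δ f) = 0) : IsAd x X (adMap f x.Gam X) := by
  refine isAd_adMap hf X (fun t => h0 _ _) (continuous_om_rescale f _ _ h).continuousAt ?_
  have e : ∀ t : ℂ, (expU (t * X.2.2))⁻¹ = expU (t * (-X.2.2)) := fun t => Units.ext (by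
    rw [Units.val_inv_eq_inv_val]
    simp [expU, Complex.exp_neg])
  simp only [e]
  exact (continuous_om_rescale f _ _ h).continuousAt

end GL1Loop

/-! ### Differentials of functions on `H` and the Manin triple -/

namespace GL1Loop

/-- The generators of `ℂ[H]` that are not inverses. -/
def genC : Fin 3 ⊕ {m : ℤ // m ≠ 0} → CH := Sum.elim ![lamC, gamC, kC] hC

/-- Closure under inverses of units spares the separate treatment of Λ⁻¹, Γ⁻¹ and k⁻¹. -/
theorem CH_induction {p : CH → Prop} (hc : ∀ c : ℂ, p (algebraMap ℂ CH c))
    (ha : ∀ F G, p F → p G → p (F + G)) (hm : ∀ F G, p F → p G → p (F * G))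
    (hi : ∀ u : CHˣ, p u → p (u⁻¹ : CHˣ)) (hg : ∀ j, p (genC j)) (F : CH) : p F := by
  have key : ∀ F (hF : F ∈ CH), p ⟨F, hF⟩ := by
    intro F hF
    induction hF using Algebra.adjoin_induction with
    | mem F hF =>
      rcases hF with (rfl | rfl | rfl | rfl | rfl | rfl) | ⟨m, rfl⟩
      · exact hg (Sum.inl 2)
      · exact hi kC (hg (Sum.inl 2))
      · exact hg (Sum.inl 0)
      · exact hi lamC (hg (Sum.inl 0))
      · exact hg (Sum.inl 1)
      · exact hi gamC (hg (Sum.inl 1))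
      · exact hg (Sum.inr m)
    | algebraMap c => exact hc c
    | add F G _ _ h1 h2 => exact ha _ _ h1 h2
    | mul F G _ _ h1 h2 => exact hm _ _ h1 h2
  exact key F.1 F.2

theorem form_add_left (X X' Y : ghat) : form (X + X') Y = form X Y + form X' Y := by
  simp only [form, Prod.fst_add, Prod.snd_add, add_mul, map_add]
  ring

theorem form_smul_left (c : ℂ) (X Y : ghat) : form (c • X) Y = c * form X Y := by
  simp only [form, Prod.smul_fst, Prod.smul_snd, smul_mul_assoc, map_smul, smul_eq_mul]
  ring

theorem form_comm (X Y : ghat) : form X Y = form Y X := by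
  simp only [form]
  rw [mul_comm X.1]
  ring

theorem form_add_right (X Y Y' : ghat) : form X (Y + Y') = form X Y + form X Y' := by
  rw [form_comm, form_add_left, form_comm Y, form_comm Y']

theorem form_smul_right (c : ℂ) (X Y : ghat) : form X (c • Y) = c * form X Y := by
  rw [form_comm, form_smul_left, form_comm]

/-- The form `form₂` as a bilinear map. -/
def form₂L : ghat × ghat →ₗ[ℂ] ghat × ghat →ₗ[ℂ] ℂ :=
  LinearMap.mk₂ ℂ form₂
    (fun X X' Y => by
      simp only [form₂, Prod.fst_add, Prod.snd_add, form_add_left]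
      ring)
    (fun c X Y => by
      simp only [form₂, Prod.smul_fst, Prod.smul_snd, form_smul_left, smul_eq_mul]
      ring)
    (fun X Y Y' => by
      simp only [form₂, Prod.fst_add, Prod.snd_add, form_add_right]
      ring)
    (fun c X Y => by
      simp only [form₂, Prod.smul_fst, Prod.smul_snd, form_smul_right, smul_eq_mul]
      ring)

theorem form₂L_apply (X Y : ghat × ghat) : form₂L X Y = form₂ X Y := rfl

/-- The inclusion of the diagonal. -/
def diag : ghat →ₗ[ℂ] ghat × ghat := LinearMap.prod LinearMap.id LinearMap.id

theorem diag_mem (x : ghat) : diag x ∈ kLie := rfl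

theorem form₂_diag_left (x : ghat) (ξ : ghat × ghat) : form₂ (diag x) ξ =
    coeff 0 (x.1 * (ξ.1.1 - ξ.2.1)) + x.2.1 * (ξ.1.2.2 - ξ.2.2.2) +
      x.2.2 * (ξ.1.2.1 - ξ.2.2.1) := by
  rw [mul_sub, map_sub]
  change coeff 0 (x.1 * ξ.1.1) + x.2.1 * ξ.1.2.2 + x.2.2 * ξ.1.2.1 -
    (coeff 0 (x.1 * ξ.2.1) + x.2.1 * ξ.2.2.2 + x.2.2 * ξ.2.2.1) = _
  ring

theorem form₂_comm (X Y : ghat × ghat) : form₂ X Y = form₂ Y X := by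
  rw [form₂, form₂, form_comm, form_comm X.2]

section Diff

variable {F G : H → ℂ} {h : H} {X Y : ghat × ghat}

theorem pathH_zero (ξ : hLie) : pathH ξ 0 = 1 := by
  have : ∀ x : ghat, path x 0 = 1 := fun x => by
    refine Ghat.ext (Subtype.ext ?_) (Units.ext ?_) (Units.ext ?_)
    · change exp ((0 : ℂ) • x.1) = 1
      rw [zero_smul, exp_zero]
    · change Complex.exp (0 * x.2.1) = 1
      rw [zero_mul, Complex.exp_zero]
    · change Complex.exp (0 * x.2.2) = 1
      rw [zero_mul, Complex.exp_zero]
  exact Subtype.ext (Prod.ext (this _) (this _))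

theorem IsDiff.add (hX : IsDiff F h X) (hY : IsDiff G h Y) : IsDiff (F + G) h (X + Y) :=
  ⟨kLie.add_mem hX.1 hY.1, fun ξ => by
    rw [← form₂L_apply, map_add, LinearMap.add_apply]
    exact (hX.2 ξ).add (hY.2 ξ)⟩

theorem IsDiff.mul (hX : IsDiff F h X) (hY : IsDiff G h Y) :
    IsDiff (F * G) h (G h • X + F h • Y) :=
  ⟨kLie.add_mem (kLie.smul_mem _ hX.1) (kLie.smul_mem _ hY.1), fun ξ => by
    rw [← form₂L_apply, map_add, LinearMap.add_apply, map_smul, map_smul]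
    refine ((hX.2 ξ).mul (hY.2 ξ)).congr_deriv ?_
    simp only [pathH_zero, mul_one, LinearMap.smul_apply, form₂L_apply, smul_eq_mul]
    ring⟩

theorem IsDiff.const (c : ℂ) (h : H) : IsDiff (fun _ => c) h 0 :=
  ⟨kLie.zero_mem, fun ξ => by
    rw [← form₂L_apply, map_zero]
    exact hasDerivAt_const _ _⟩

theorem IsDiff.inv (hX : IsDiff F h X) (h0 : F h ≠ 0) :
    IsDiff (fun g => (F g)⁻¹) h (-(F h ^ 2)⁻¹ • X) :=
  ⟨kLie.smul_mem _ hX.1, fun ξ => by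
    rw [← form₂L_apply, map_smul]
    have := (hX.2 ξ).fun_inv (by rwa [pathH_zero, mul_one])
    refine this.congr_deriv ?_
    simp only [pathH_zero, mul_one, LinearMap.smul_apply, form₂L_apply, smul_eq_mul]
    ring⟩

theorem coeff_zero_hVec_sub (m : {m : ℤ // m ≠ 0}) (a : Loop) :
    coeff 0 (a * ((hVec m).1.1 - (hVec m).2.1)) = m.1.sign * coeff (-m.1) a := by
  rcases lt_or_gt_of_ne m.2 with hm | hm
  · rw [hVec_of_neg hm, Int.sign_eq_neg_one_of_neg hm]
    change coeff 0 (a * (0 - zp m)) = _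
    rw [mul_sub, mul_zero, map_sub, map_zero, zero_sub, mul_comm, coeff_zp_mul, zero_sub]
    push_cast
    ring
  · rw [hVec_of_pos hm, Int.sign_eq_one_of_pos hm]
    change coeff 0 (a * (zp m - 0)) = _
    rw [sub_zero, mul_comm, coeff_zp_mul, zero_sub]
    push_cast
    ring

theorem hVec_snd_snd (m : {m : ℤ // m ≠ 0}) : (hVec m).2.2 = 0 := by
  rw [(hVec_mem m).1, hVec_fst_snd, neg_zero]

theorem form₂_diag_hVec (x : ghat) (m : {m : ℤ // m ≠ 0}) :
    form₂ (diag x) (hVec m) = m.1.sign * coeff (-m.1) x.1 := by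
  rw [form₂_diag_left, coeff_zero_hVec_sub, hVec_fst_snd, hVec_snd_snd]
  simp

theorem form₂_diag_cVec (x : ghat) (a l g : ℂ) :
    form₂ (diag x) (cVec a l g) = 2 * (a * coeff 0 x.1 + g * x.2.1 + l * x.2.2) := by
  rw [form₂_diag_left]
  change coeff 0 (x.1 * (a • 1 - -a • 1)) + x.2.1 * (g - -g) + x.2.2 * (l - -l) = _
  rw [neg_smul, sub_neg_eq_add, ← two_smul ℂ (a • (1 : Loop)), mul_smul_comm, mul_smul_comm,
    mul_one, map_smul, map_smul, smul_eq_mul, smul_eq_mul]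
  ring

theorem eq_diag (hX : X ∈ kLie) : X = diag X.1 :=
  Prod.ext rfl (Eq.symm hX)

/-- Pairing a diagonal element with `hVec m` reads off its coefficient of index -m up to sign.
Pairing with `cVec` reads off twice the constant term and twice the components along c and d. -/
theorem eq_of_form₂_eq (hX : X ∈ kLie) (hY : Y ∈ kLie) (e : ∀ ξ : hLie, form₂ X ξ = form₂ Y ξ) :
    X = Y := by
  rw [eq_diag hX, eq_diag hY] at e ⊢
  have e1 := fun m => e ⟨_, hVec_mem m⟩
  have e2 := fun a l g => e ⟨_, cVec_mem a l g⟩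
  simp only [form₂_diag_hVec, form₂_diag_cVec] at e1 e2
  congr 1
  refine Prod.ext (ext_coeff fun n => ?_) (Prod.ext ?_ ?_)
  · by_cases hn : n = 0
    · subst hn
      linear_combination e2 1 0 0 / 2
    · have := e1 ⟨-n, neg_ne_zero.2 hn⟩
      rw [neg_neg] at this
      refine mul_left_cancel₀ ?_ this
      exact_mod_cast (Int.sign_eq_zero_iff_zero.not.2 (neg_ne_zero.2 hn))
  · linear_combination e2 0 0 1 / 2
  · linear_combination e2 0 1 0 / 2

theorem IsDiff.unique (hX : IsDiff F h X) (hY : IsDiff F h Y) : X = Y :=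
  eq_of_form₂_eq hX.1 hY.1 fun ξ => (hX.2 ξ).unique (hY.2 ξ)

end Diff

/-- A germ holomorphic both at 0 and on the projective line minus 0 has only a constant term, and on
the diagonal this term and the components along c and d equal their own negatives. Projections along
the diagonal are unique for this reason. -/
theorem eq_zero_of_mem_hLie_of_mem_kLie {Z : ghat × ghat} (hh : Z ∈ hLie) (hk : Z ∈ kLie) :
    Z = 0 := by
  obtain ⟨x, y⟩ := Z
  obtain rfl : x = y := hk
  obtain ⟨h1, F, G, hF, hG, h2⟩ := hh
  have e2 : x.2 = 0 := self_eq_neg.1 h1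
  have e1 : x.1 = 0 := by
    refine eq_zero_of_coeff _ fun n => ?_
    rcases lt_trichotomy n 0 with hn | rfl | hn
    · exact hF.coeff_neg hn
    · have := hF.coeff_zero
      rw [h2, ← hG.coeff_zero] at this
      exact self_eq_neg.1 this
    · exact hG.coeff_pos hn
  have : x = 0 := Prod.ext e1 e2
  rw [this]
  rfl

/-- Data attached to the differential of a function: if a property of the differential holds for
the generators of `ℂ[H]`, then it holds for all functions. -/
theorem exists_diff (h : H) {V ι : Type*} [AddCommGroup V] [Module ℂ V] (δ : V →ₗ[ℂ] ghat × ghat)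
    (ℓ : ι → V →ₗ[ℂ] ℂ) (D : ι → CH →ₗ[ℂ] ℂ)
    (hD : ∀ i F G, D i (F * G) = D i F * ev h G + ev h F * D i G)
    (hg : ∀ j, ∃ d, IsDiff (genC j).1 h (δ d) ∧ ∀ i, ℓ i d = D i (genC j)) (F : CH) :
    ∃ d, IsDiff F.1 h (δ d) ∧ ∀ i, ℓ i d = D i F := by
  have one : ∀ i, D i 1 = 0 := by
    intro i
    have := hD i 1 1
    rwa [map_one (ev h), mul_one, mul_one, one_mul, left_eq_add] at this
  induction F using CH_induction with
  | hc c =>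
    refine ⟨0, ?_, fun i => ?_⟩
    · rw [map_zero]
      exact IsDiff.const c h
    · rw [map_zero, Algebra.algebraMap_eq_smul_one, map_smul, one, smul_zero]
  | ha F G hF hG =>
    obtain ⟨d, h1, h2⟩ := hF
    obtain ⟨e, k1, k2⟩ := hG
    refine ⟨d + e, ?_, fun i => ?_⟩
    · rw [map_add]
      exact h1.add k1
    · rw [map_add, map_add, h2, k2]
  | hm F G hF hG =>
    obtain ⟨d, h1, h2⟩ := hF
    obtain ⟨e, k1, k2⟩ := hG
    refine ⟨ev h G • d + ev h F • e, ?_, fun i => ?_⟩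
    · rw [map_add, map_smul, map_smul]
      exact h1.mul k1
    · rw [map_add, map_smul, map_smul, h2, k2, hD, smul_eq_mul, smul_eq_mul, mul_comm (D i F)]
  | hi u hu =>
    obtain ⟨d, h1, h2⟩ := hu
    have e : ev h (u : CH) * ev h (u⁻¹ : CHˣ) = 1 := by rw [← map_mul, Units.mul_inv, map_one]
    have h0 : ev h (u : CH) ≠ 0 := left_ne_zero_of_mul_eq_one e
    have hu : ∀ g, (u⁻¹ : CHˣ).1.1 g = (u.1.1 g)⁻¹ := fun g => by
      refine eq_inv_of_mul_eq_one_right ?_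
      have : ev g (u : CH) * ev g (u⁻¹ : CHˣ) = 1 := by rw [← map_mul, Units.mul_inv, map_one]
      exact this
    -- The coefficient is that of the quotient rule, which the differential and the derivations `D
    -- i` both obey.
    refine ⟨-(ev h (u : CH) ^ 2)⁻¹ • d, ?_, fun i => ?_⟩
    · rw [map_smul, funext hu]
      exact h1.inv h0
    · have := hD i u (u⁻¹ : CHˣ)
      have e' : ev h (u⁻¹ : CHˣ) = (ev h (u : CH))⁻¹ := eq_inv_of_mul_eq_one_right e
      rw [Units.mul_inv, one, e'] at this
      rw [map_smul, h2, smul_eq_mul]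
      field_simp at this ⊢
      linear_combination this
  | hg j => exact hg j

end GL1Loop

/-! ### The bracket of the Manin triple on generators -/

namespace GL1Loop

open Heisenberg (Idx Idx.neg)

/-- The translated differentials of the generators of `ℂ[H]`, as elements of the diagonal. -/
def genX (h : H) : Fin 3 ⊕ {m : ℤ // m ≠ 0} → ghat :=
  Sum.elim ![(0, 0, lamFun h / 2), (0, gamFun h / 2, 0), ((kFun h / 2) • 1, 0, 0)]
    fun m => ((m.1.sign * ((gamU h ^ |m.1| : ℂˣ) : ℂ)) • zp (-m.1), -(|m.1| * hFun m h / 2), 0)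

theorem hLie_snd_snd (ξ : hLie) : ξ.1.2.2 = -ξ.1.1.2 := ξ.2.1

theorem coeff_zero_hLie_snd (ξ : hLie) : coeff 0 ξ.1.2.1 = -coeff 0 ξ.1.1.1 := by
  obtain ⟨-, F, G, hF, hG, h2⟩ := ξ.2
  rw [hF.coeff_zero, hG.coeff_zero, h2, neg_neg]

theorem coeff_hLie_sub (ξ : hLie) (m : {m : ℤ // m ≠ 0}) :
    coeff m (ξ.1.1.1 - ξ.1.2.1) = m.1.sign * hCoeff m ξ.1 := by
  obtain ⟨-, F, G, hF, hG, h2⟩ := ξ.2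
  rw [map_sub]
  rcases lt_or_gt_of_ne m.2 with hm | hm
  · rw [hCoeff_of_neg hm, hF.coeff_neg hm, Int.sign_eq_neg_one_of_neg hm]
    push_cast
    ring
  · rw [hCoeff_of_pos hm, hG.coeff_pos hm, Int.sign_eq_one_of_pos hm]
    push_cast
    ring

theorem form₂_diag_hLie (x : ghat) (ξ : hLie) : form₂ (diag x) ξ.1 =
    coeff 0 (x.1 * (ξ.1.1.1 - ξ.1.2.1)) + 2 * x.2.1 * ξ.1.1.2.2 + 2 * x.2.2 * ξ.1.1.2.1 := by
  rw [form₂_diag_left, hLie_snd_snd]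
  simp only [Prod.fst_neg, Prod.snd_neg]
  ring

theorem hasDerivAt_exp_mul (c : ℂ) : HasDerivAt (fun t => Complex.exp (t * c)) c 0 := by
  have := ((hasDerivAt_id (0 : ℂ)).mul_const c).cexp
  simpa using this

theorem sign_mul_sign {m : ℤ} (hm : m ≠ 0) : (m.sign : ℂ) * m.sign = 1 := by
  rw [← Int.cast_mul, ← Int.sign_mul, Int.sign_eq_one_of_pos (mul_self_pos.2 hm), Int.cast_one]

/-- The product formulas give the derivatives along h · `pathH`. On the Lie algebra of `H` the
second component carries the negatives of the constant term and of the components along c and d, so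
`form₂` counts these twice; this explains the halves in `genX`. A coefficient of nonzero index lives
in one component only and is counted once, with the sign of m. -/
theorem isDiff_gen (h : H) (j : Fin 3 ⊕ {m : ℤ // m ≠ 0}) :
    IsDiff (genC j).1 h (diag (genX h j)) := by
  refine ⟨diag_mem _, fun ξ => ?_⟩
  rw [form₂_diag_hLie]
  rcases j with j | m
  · fin_cases j
    · change HasDerivAt (fun t => lamFun (h * pathH ξ t)) (coeff 0 (0 * _) + 2 * 0 * _ +
        2 * (lamFun h / 2) * _) 0
      simp only [lamFun_mul, lamFun_pathH]
      refine ((hasDerivAt_exp_mul _).const_mul _).congr_deriv ?_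
      rw [zero_mul, map_zero]
      ring
    · change HasDerivAt (fun t => gamFun (h * pathH ξ t)) (coeff 0 (0 * _) +
        2 * (gamFun h / 2) * _ + 2 * 0 * _) 0
      simp only [gamFun_eq, gamU_mul, Units.val_mul, gamU_pathH]
      refine ((hasDerivAt_exp_mul _).const_mul _).congr_deriv ?_
      rw [zero_mul, map_zero]
      ring
    · change HasDerivAt (fun t => kFun (h * pathH ξ t)) (coeff 0 ((kFun h / 2) • 1 * _) +
        2 * 0 * _ + 2 * 0 * _) 0
      simp only [kFun_mul, kFun_pathH]
      refine ((hasDerivAt_exp_mul _).const_mul _).congr_deriv ?_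
      rw [smul_mul_assoc, one_mul, map_smul, map_sub, coeff_zero_hLie_snd, smul_eq_mul]
      ring
  · change HasDerivAt (fun t => hFun m (h * pathH ξ t))
      (coeff 0 ((m.1.sign * ((gamU h ^ |m.1| : ℂˣ) : ℂ)) • zp (-m.1) * _) +
        2 * -(|m.1| * hFun m h / 2) * _ + 2 * 0 * _) 0
    have e : ∀ t, ((gamU (pathH ξ t) ^ (-|m.1|) : ℂˣ) : ℂ) =
        Complex.exp (t * (-(|m.1| : ℤ) * ξ.1.1.2.2)) := by
      intro t
      rw [Units.val_zpow_eq_zpow_val, gamU_pathH, ← Complex.exp_int_mul]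
      congr 1
      push_cast
      ring
    simp only [hFun_mul, hFun_pathH, e]
    refine (((hasDerivAt_exp_mul _).mul_const _).add
      (((hasDerivAt_id (0 : ℂ)).mul_const _).const_mul _)).congr_deriv ?_
    rw [smul_mul_assoc, map_smul, coeff_zp_mul, zero_sub, neg_neg, coeff_hLie_sub, smul_eq_mul]
    linear_combination (-((gamU h ^ |m.1| : ℂˣ) : ℂ) * hCoeff m ξ.1) * sign_mul_sign m.2

/-- The adjoint action of a point of `H`. -/
def adH (h : H) : ghat × ghat →ₗ[ℂ] ghat × ghat :=
  (adMap (log h.1.1.loop) (gamU h)).prodMap (adMap (log h.1.2.loop) (gamU h)⁻¹)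

/-- The adjoint action of the inverse of a point of `H` on the elements of the Lie algebra of `H`
without component along `d`. -/
def adInvH (h : H) : ghat × ghat →ₗ[ℂ] ghat × ghat :=
  ((rescale ((gamU h)⁻¹ * (gamU h)⁻¹)).toLinearMap.prodMap LinearMap.id).prodMap
    ((rescale (gamU h * gamU h)).toLinearMap.prodMap LinearMap.id)

theorem om_rescale_log_fst (h : H) (γ δ : ℂˣ) :
    om (rescale γ (log h.1.1.loop)) (rescale δ (log h.1.1.loop)) = 0 := by
  obtain ⟨P, hP⟩ := exists_log_fst h
  exact om_eq_zero_of_plus (hP.rescale γ) (hP.rescale δ)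

theorem om_rescale_log_snd (h : H) (γ δ : ℂˣ) :
    om (rescale γ (log h.1.2.loop)) (rescale δ (log h.1.2.loop)) = 0 := by
  obtain ⟨P, hP⟩ := exists_log_snd h
  exact om_eq_zero_of_minus (hP.rescale γ) (hP.rescale δ)

theorem isAd₂_adH (h : H) {X : ghat × ghat} (hX : X ∈ kLie) (hl : X.1.1 ∈ LauP) :
    IsAd₂ h X (adH h X) := by
  refine ⟨isAd_of_mem_LauP (exp_log _) hl (om_rescale_log_fst h), ?_⟩
  have := isAd_of_mem_LauP (x := h.1.2) (exp_log _) (X := X.2) (by rwa [← show X.1 = X.2 from hX])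
    (om_rescale_log_snd h)
  rwa [gam_snd] at this

/-- For elements of the Lie algebra of `H` the cocycle correction pairs two germs of the same kind,
both holomorphic at 0 or both on the projective line minus 0, and vanishes. With no component along
d, only the rescaling of the loops remains. -/
theorem isAd₂_adInvH (h : H) {Z : ghat × ghat} (hZ : Z ∈ hLie) (h0 : Z.1.2.2 = 0) :
    IsAd₂ (h : Ghat × Ghat)⁻¹ Z (adInvH h Z) := by
  obtain ⟨h1, F, G, hF, hG, -⟩ := hZ
  have h0' : Z.2.2.2 = 0 := by
    rw [h1, Prod.snd_neg, h0, neg_zero]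
  obtain ⟨P, hP⟩ := exists_log_fst h
  obtain ⟨Q, hQ⟩ := exists_log_snd h
  have key : ∀ (f : Loop) (γ : ℂˣ) (X : ghat), X.2.2 = 0 → om f (rescale γ X.1) = 0 →
      adMap (-f) γ X = (rescale (γ * γ) X.1, X.2) := by
    intro f γ X hX hom
    refine Prod.ext ?_ (Prod.ext ?_ rfl)
    · change rescale (γ * γ) X.1 - (2 * X.2.2) • _ = _
      rw [hX, mul_zero, zero_smul, sub_zero]
    · change X.2.1 + 2 * om (-f) (rescale γ X.1) = _
      rw [om_neg_left, hom, neg_zero, mul_zero, add_zero]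
  constructor
  · have := isAd_of_snd_eq_zero (exp_inv_loop (exp_log h.1.1.loop)) h0
    rw [key _ _ _ h0 (om_eq_zero_of_plus hP (hF.rescale _))] at this
    exact this
  · have := isAd_of_snd_eq_zero (exp_inv_loop (exp_log h.1.2.loop)) h0'
    rw [key _ _ _ h0' (om_eq_zero_of_minus hQ (hG.rescale _)), Ghat.inv_Gam, gam_snd, inv_inv]
      at this
    exact this

/-- The pairs of a differential `X` and of the projection of `Ad(h) X` to the Lie algebra
of `H`. -/
def projPairs (h : H) : Submodule ℂ ((ghat × ghat) × (ghat × ghat)) where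
  carrier := {d | d.1.1.1 ∈ LauP ∧ d.2 ∈ hLie ∧ adH h d.1 - d.2 ∈ kLie ∧ d.2.1.2.2 = 0}
  add_mem' := by
    rintro d e ⟨h1, h2, h3, h4⟩ ⟨k1, k2, k3, k4⟩
    refine ⟨LauP.add_mem h1 k1, hLie.add_mem h2 k2, ?_, ?_⟩
    · have := kLie.add_mem h3 k3
      rwa [sub_add_sub_comm, ← map_add] at this
    · change d.2.1.2.2 + e.2.1.2.2 = 0
      rw [h4, k4, add_zero]
  zero_mem' := by
    refine ⟨LauP.zero_mem, hLie.zero_mem, ?_, rfl⟩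
    change adH h 0 - 0 ∈ kLie
    rw [map_zero, sub_zero]
    exact kLie.zero_mem
  smul_mem' := by
    rintro c d ⟨h1, h2, h3, h4⟩
    refine ⟨LauP.smul_mem c h1, hLie.smul_mem c h2, ?_, ?_⟩
    · have := kLie.smul_mem c h3
      rwa [smul_sub, ← map_smul] at this
    · change c * d.2.1.2.2 = 0
      rw [h4, mul_zero]

/-- The projections of `Ad(h) X` to the Lie algebra of `H`, for the differentials `X` of the
generators. -/
def genZ (h : H) : Fin 3 ⊕ {m : ℤ // m ≠ 0} → ghat × ghat :=
  Sum.elim ![(((-lamFun h) • zD (rescale (gamU h) (log h.1.1.loop)), 0, 0),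
      ((-lamFun h) • zD (rescale (gamU h)⁻¹ (log h.1.2.loop)), 0, 0)), 0, 0]
    fun m => (((gamU h ^ |m.1| : ℂˣ) : ℂ) *
      (((gamU h ^ (2 * m.1) : ℂˣ) : ℂ) - ((gamU h ^ (-(2 * m.1)) : ℂˣ) : ℂ))) • hVec (Idx.neg m) +
      cVec 0 (m.1 * hFun m h) 0

theorem coeff_log_fst (h : H) (m : {m : ℤ // m ≠ 0}) :
    coeff m (log h.1.1.loop) = if 0 < m.1 then hFun m h else 0 := by
  split_ifs with hm
  · exact (hFun_eq_of_pos m hm h).symm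
  · obtain ⟨P, hP⟩ := exists_log_fst h
    exact hP.coeff_neg (lt_of_le_of_ne (not_lt.1 hm) m.2)

theorem coeff_log_snd (h : H) (m : {m : ℤ // m ≠ 0}) :
    coeff m (log h.1.2.loop) = if 0 < m.1 then 0 else hFun m h := by
  split_ifs with hm
  · obtain ⟨P, hP⟩ := exists_log_snd h
    exact hP.coeff_pos hm
  · exact (hFun_eq_of_neg m (lt_of_le_of_ne (not_lt.1 hm) m.2) h).symm

theorem IsPlus.zD {F : ℂ → ℂ} {f : Loop} (hf : IsPlus F f) :
    ∃ G : ℂ → ℂ, IsPlus G (zD f) ∧ G 0 = 0 := by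
  have h1 : IsPlus (deriv F) (D f) := ⟨hf.1.deriv, by rw [hf.eq_mk]; rfl⟩
  exact ⟨_, (isPlus_zp 1).mul h1, by simp⟩

theorem IsMinus.zD {F : ℂ → ℂ} {f : Loop} (hf : IsMinus F f) :
    ∃ G : ℂ → ℂ, IsMinus G (zD f) ∧ G 0 = 0 := by
  obtain ⟨E, e, he, h⟩ := hf.exists_D_eq
  have e1 : GL1Loop.zD f = (-1 : ℂ) • (zp (-(1 : ℕ)) * e) := by
    change zp 1 * D f = _
    rw [h, mul_smul_comm, ← mul_assoc, zp_mul]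
    rfl
  rw [e1]
  exact ⟨_, ((isMinus_zp 1).mul he).smul (-1), by simp⟩

theorem adMap_const (f : Loop) (γ : ℂˣ) (c α : ℂ) :
    adMap f γ (c • 1, α, 0) = (c • 1, α, 0) := by
  refine Prod.ext ?_ (Prod.ext ?_ rfl)
  · change rescale (γ * γ) (c • 1) - (2 * 0 : ℂ) • _ = c • (1 : Loop)
    rw [map_smul, map_one, mul_zero, zero_smul, sub_zero]
  · change α + 2 * om f (rescale γ (c • 1)) = α
    rw [map_smul, map_one, om_smul_right, ← zp_zero, om_zp, Int.cast_zero, neg_zero, zero_mul,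
      mul_zero, mul_zero, add_zero]

theorem adMap_d (f : Loop) (γ : ℂˣ) (β : ℂ) :
    adMap f γ (0, 0, β) = ((-(2 * β)) • zD (rescale γ f), 0, β) := by
  refine Prod.ext ?_ (Prod.ext ?_ rfl)
  · change rescale (γ * γ) 0 - (2 * β) • zD (rescale γ f) = (-(2 * β)) • zD (rescale γ f)
    rw [map_zero, zero_sub, neg_smul]
  · change 0 + 2 * om f (rescale γ 0) = 0
    rw [map_zero, zero_add, om, mul_zero, map_zero, mul_zero]

theorem adMap_zp (f : Loop) (γ : ℂˣ) (c α : ℂ) (m : ℤ) :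
    adMap f γ (c • zp (-m), α, 0) = ((c * (((γ * γ) ^ (-m) : ℂˣ) : ℂ)) • zp (-m),
      α + 2 * (c * (((γ ^ (-m) : ℂˣ) : ℂ) * (m * coeff m f))), 0) := by
  refine Prod.ext ?_ (Prod.ext ?_ rfl)
  · change rescale (γ * γ) (c • zp (-m)) - (2 * 0 : ℂ) • _ = _
    rw [map_smul, rescale_zp, smul_smul, mul_zero, zero_smul, sub_zero]
  · change α + 2 * om f (rescale γ (c • zp (-m))) = _
    rw [map_smul, rescale_zp, om_smul_right, om_smul_right, om_zp, neg_neg, Int.cast_neg, neg_neg]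

theorem genZ_zero_mem (h : H) : genZ h (Sum.inl 0) ∈ hLie := by
  obtain ⟨P, hP⟩ := exists_log_fst h
  obtain ⟨Q, hQ⟩ := exists_log_snd h
  obtain ⟨F, hF, hF0⟩ := (hP.rescale (gamU h)).zD
  obtain ⟨G, hG, hG0⟩ := (hQ.rescale (gamU h)⁻¹).zD
  refine ⟨neg_zero.symm, _, _, hF.smul _, hG.smul _, ?_⟩
  simp [hF0, hG0]

theorem smul_hVec_add_cVec_of_pos {m : {m : ℤ // m ≠ 0}} (hm : 0 < m.1) (c l : ℂ) :
    c • hVec m + cVec 0 l 0 = ((c • zp m, l, 0), (0, -l, 0)) := by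
  rw [hVec_of_pos hm]
  simp [cVec]

theorem smul_hVec_add_cVec_of_neg {m : {m : ℤ // m ≠ 0}} (hm : m.1 < 0) (c l : ℂ) :
    c • hVec m + cVec 0 l 0 = ((0, l, 0), (c • zp m, -l, 0)) := by
  rw [hVec_of_neg hm]
  simp [cVec]

/-- Only the difference of the two components of Ad(h) X matters for the projection along the
diagonal. For h_m it consists of a multiple of z^{-m}, assigned to the component where this monomial
is allowed, and of 2 m h_m c, split evenly with opposite signs. -/
theorem gen_mem_projPairs (h : H) (j : Fin 3 ⊕ {m : ℤ // m ≠ 0}) :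
    (diag (genX h j), genZ h j) ∈ projPairs h := by
  have hconst : ∀ c α : ℂ, (diag (c • 1, α, 0), (0 : ghat × ghat)) ∈ projPairs h := by
    intro c α
    refine ⟨LauP.smul_mem c ?_, hLie.zero_mem, ?_, rfl⟩
    · rw [← zp_zero]
      exact Submodule.subset_span ⟨0, rfl⟩
    · change adH h (diag (c • 1, α, 0)) - 0 ∈ kLie
      rw [sub_zero]
      exact (adMap_const _ _ _ _).trans (adMap_const _ _ _ _).symm
  rcases j with j | m
  · fin_cases j
    · refine ⟨LauP.zero_mem, genZ_zero_mem h, ?_, rfl⟩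
      -- For Λ the differential is a multiple of d. Its image under Ad(h) acquires the two
      -- logarithmic derivatives, which already lie in the Lie algebra of `H`, their constant terms
      -- being zero; the multiple of d is left on the diagonal.
      have e : ∀ (f : Loop) (γ : ℂˣ), adMap f γ (0, 0, lamFun h / 2) -
          ((-lamFun h) • zD (rescale γ f), 0, 0) = (0, 0, lamFun h / 2) := by
        intro f γ
        rw [adMap_d, mul_div_cancel₀ _ two_ne_zero]
        refine Prod.ext (sub_self _) (Prod.ext (sub_zero _) (sub_zero _))
      exact (e _ _).trans (e _ _).symm
    -- The differentials of Γ and k are fixed by Ad(h), stay diagonal and project to zero.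
    · have := hconst 0 (gamFun h / 2)
      rwa [zero_smul] at this
    · exact hconst (kFun h / 2) 0
  · have hx : genX h (Sum.inr m) = ((m.1.sign * ((gamU h ^ |m.1| : ℂˣ) : ℂ)) • zp (-m.1),
      -(|m.1| * hFun m h / 2), 0) := rfl
    refine ⟨LauP.smul_mem _ (Submodule.subset_span ⟨_, rfl⟩),
      hLie.add_mem (hLie.smul_mem _ (hVec_mem _)) (cVec_mem _ _ _), ?_, ?_⟩
    · change adMap _ _ (genX h (Sum.inr m)) - _ = adMap _ _ (genX h (Sum.inr m)) - _
      rw [hx, adMap_zp, adMap_zp, coeff_log_fst, coeff_log_snd]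
      have hγ := (gamU h).ne_zero
      change _ - (_ • hVec (Idx.neg m) + cVec 0 (m.1 * hFun m h) 0).1 =
        _ - (_ • hVec (Idx.neg m) + cVec 0 (m.1 * hFun m h) 0).2
      rcases lt_or_gt_of_ne m.2 with hm | hm
      · rw [smul_hVec_add_cVec_of_pos (neg_pos.2 hm), if_neg hm.not_gt, if_neg hm.not_gt,
          abs_of_neg hm, Int.sign_eq_neg_one_of_neg hm]
        refine Prod.ext ?_ (Prod.ext ?_ rfl)
        · change _ • zp (-m.1) - _ • zp (-m.1) = _ • zp (-m.1) - 0
          rw [← sub_smul, sub_zero]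
          congr 1
          simp only [Units.val_zpow_eq_zpow_val, Units.val_mul, two_mul,
            neg_add, zpow_add₀ hγ, mul_zpow, inv_zpow', neg_neg]
          push_cast
          ring
        · simp only [Prod.snd_sub, Prod.fst_sub, Units.val_zpow_eq_zpow_val,
            inv_zpow', neg_neg]
          have := zpow_neg_mul_zpow_self m.1 hγ
          push_cast
          linear_combination (2 * m.1 * hFun m h) * this
      · rw [smul_hVec_add_cVec_of_neg (neg_neg_iff_pos.2 hm), if_pos hm, if_pos hm,
          abs_of_pos hm, Int.sign_eq_one_of_pos hm]
        refine Prod.ext ?_ (Prod.ext ?_ rfl)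
        · change _ • zp (-m.1) - 0 = _ • zp (-m.1) - _ • zp (-m.1)
          rw [← sub_smul, sub_zero]
          congr 1
          simp only [Units.val_zpow_eq_zpow_val, Units.val_mul, two_mul,
            neg_add, zpow_add₀ hγ, mul_zpow, inv_zpow', neg_neg]
          push_cast
          ring
        · simp only [Prod.snd_sub, Prod.fst_sub, Units.val_zpow_eq_zpow_val,
            inv_zpow', neg_neg]
          have := zpow_neg_mul_zpow_self m.1 hγ
          push_cast
          linear_combination (2 * m.1 * hFun m h) * this
    · change _ * (hVec (Idx.neg m)).1.2.2 + (0 : ℂ) = 0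
      rw [hVec_fst_snd]
      simp

theorem adInvH_hVec (h : H) (m : {m : ℤ // m ≠ 0}) :
    adInvH h (hVec m) = ((gamU h ^ (-(2 * |m.1|)) : ℂˣ) : ℂ) • hVec m := by
  rcases lt_or_gt_of_ne m.2 with hm | hm
  · rw [hVec_of_neg hm, abs_of_neg hm]
    have e : (gamU h * gamU h) ^ m.1 = gamU h ^ (-(2 * -m.1)) := by
      rw [mul_zpow, ← zpow_add]
      congr 1
      ring
    have : adInvH h (0, zp m, 0, 0) = ((rescale _ 0, 0), (rescale (gamU h * gamU h) (zp m), 0, 0)) :=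
      rfl
    rw [this, rescale_zp, map_zero, e]
    simp
  · rw [hVec_of_pos hm, abs_of_pos hm]
    have e : ((gamU h)⁻¹ * (gamU h)⁻¹) ^ m.1 = gamU h ^ (-(2 * m.1)) := by
      rw [mul_zpow, inv_zpow', ← zpow_add]
      congr 1
      ring
    have : adInvH h ((zp m, 0, 0), 0) =
      ((rescale ((gamU h)⁻¹ * (gamU h)⁻¹) (zp m), 0, 0), (rescale _ 0, 0)) := rfl
    rw [this, rescale_zp, map_zero, e]
    simp

theorem adInvH_cVec (h : H) (a l g : ℂ) : adInvH h (cVec a l g) = cVec a l g := by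
  have : adInvH h (cVec a l g) = ((rescale _ (a • 1), l, g), (rescale _ (-a • 1), -l, -g)) := rfl
  rw [this, map_smul, map_smul, map_one, map_one]
  rfl

theorem form₂_genZ_inr (h : H) (m : {m : ℤ // m ≠ 0}) (x : ghat) :
    form₂ (adInvH h (genZ h (Sum.inr m))) (diag x) =
      -((gamU h ^ (-|m.1|) : ℂˣ) : ℂ) * (((gamU h ^ (2 * m.1) : ℂˣ) : ℂ) -
        ((gamU h ^ (-(2 * m.1)) : ℂˣ) : ℂ)) * (m.1.sign * coeff m.1 x.1) +
        2 * (m.1 * hFun m h * x.2.2) := by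
  change form₂ (adInvH h (_ • hVec (Idx.neg m) + cVec 0 (m.1 * hFun m h) 0)) _ = _
  rw [form₂_comm, ← form₂L_apply, map_add, map_smul, adInvH_hVec, adInvH_cVec, map_add, map_smul,
    map_smul, form₂L_apply, form₂L_apply, form₂_diag_hVec, form₂_diag_cVec, smul_eq_mul,
    smul_eq_mul]
  have e1 : (Idx.neg m).1 = -m.1 := rfl
  have e2 : ((gamU h ^ |m.1| : ℂˣ) : ℂ) * ((gamU h ^ (-(2 * |m.1|)) : ℂˣ) : ℂ) =
      ((gamU h ^ (-|m.1|) : ℂˣ) : ℂ) := by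
    rw [← Units.val_mul, ← zpow_add]
    congr 2
    ring
  rw [e1, neg_neg, abs_neg, Int.sign_neg, ← e2]
  push_cast
  ring

theorem form₂_genZ_lam (h : H) (x : ghat) :
    form₂ (adInvH h (genZ h (Sum.inl 0))) (diag x) = -lamFun h *
      coeff 0 (x.1 * (rescale ((gamU h)⁻¹ * (gamU h)⁻¹) (zD (rescale (gamU h) (log h.1.1.loop))) -
        rescale (gamU h * gamU h) (zD (rescale (gamU h)⁻¹ (log h.1.2.loop))))) := by
  rw [form₂_comm, form₂_diag_left]
  change coeff 0 (x.1 * (rescale _ ((-lamFun h) • _) - rescale _ ((-lamFun h) • _))) +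
    x.2.1 * (0 - 0) + x.2.2 * (0 - 0) = _
  rw [map_smul, map_smul, ← smul_sub, mul_smul_comm, map_smul, smul_eq_mul]
  ring

/-- After both rescalings the coefficient of index m of the relevant logarithmic derivative is m
Γ^{-|m|} h_m, and the power of Γ cancels the factor Γ^{|m|} of the differential of h_m. -/
theorem form₂_genZ_lam_genX (h : H) (m : {m : ℤ // m ≠ 0}) :
    form₂ (adInvH h (genZ h (Sum.inl 0))) (diag (genX h (Sum.inr m))) =
      -(m.1 * (lamFun h * hFun m h)) := by
  rw [form₂_genZ_lam]
  change -lamFun h * coeff 0 ((m.1.sign * ((gamU h ^ |m.1| : ℂˣ) : ℂ)) • zp (-m.1) * _) = _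
  rw [smul_mul_assoc, map_smul, coeff_zp_mul, map_sub, zero_sub, neg_neg]
  simp only [coeff_rescale, coeff_zD]
  rw [coeff_log_fst, coeff_log_snd]
  have hγ := (gamU h).ne_zero
  have := zpow_neg_mul_zpow_self m.1 hγ
  simp only [Units.val_zpow_eq_zpow_val, Units.val_mul, mul_zpow, inv_zpow',
    smul_eq_mul]
  have h1 := zpow_ne_zero m.1 hγ
  rcases lt_or_gt_of_ne m.2 with hm | hm
  · rw [if_neg hm.not_gt, if_neg hm.not_gt, abs_of_neg hm, Int.sign_eq_neg_one_of_neg hm, zpow_neg]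
    push_cast
    field_simp
    ring
  · rw [if_pos hm, if_pos hm, abs_of_pos hm, Int.sign_eq_one_of_pos hm, zpow_neg]
    push_cast
    field_simp
    ring

end GL1Loop

/-! ### ℂ[H] as the Poisson Hopf algebra of the group `H` -/

namespace GL1Loop

open Heisenberg

attribute [local instance] semiringZ commSemiringZ ringZ addCommMonoidZ addCommGroupZ algebraZ moduleZ
  semiringZZ commRingZZ addCommMonoidZZ addCommGroupZZ algebraZZ moduleZZ

/-- The Poisson Hopf algebra of functions on `H`. -/
def hopfH : PoissonHopf CH := hopfZ.transport Phi

theorem hopfH_bracket (F G : CH) : hopfH.bracket F G = ofZ1 (bracket (Phi F) (Phi G)) := rfl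

theorem hopfH_bracket_swap (F G : CH) : hopfH.bracket F G = -hopfH.bracket G F := by
  rw [hopfH_bracket, bracket_swap, map_neg, hopfH_bracket]

theorem hopfH_leibniz_left (F G K : CH) :
    hopfH.bracket (F * G) K = hopfH.bracket F K * G + F * hopfH.bracket G K := by
  rw [hopfH_bracket_swap, hopfH.leibniz, hopfH_bracket_swap K, hopfH_bracket_swap K]
  ring

theorem hopfH_gamC (F : CH) : hopfH.bracket gamC F = 0 := by
  rw [hopfH_bracket, Phi_gamC, bracket_zGam, map_zero]

theorem hopfH_kC (F : CH) : hopfH.bracket kC F = 0 := by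
  rw [hopfH_bracket, Phi_kC, bracket_zk, map_zero]

theorem ev_hopfH_hC_hC (h : H) (m n : Idx) : ev h (hopfH.bracket (hC m) (hC n)) =
    if m.1 = -n.1 then
      ((gamU h ^ (2 * m.1) : ℂˣ) : ℂ) - ((gamU h ^ (-(2 * m.1)) : ℂˣ) : ℂ) else 0 := by
  rw [hopfH_bracket, Phi_hC, Phi_hC, bracket_zh_zh]
  split_ifs
  · rw [map_sub, map_sub, ev_eq, ev_eq, ofZ1_zGamU_zpow, ofZ1_zGamU_zpow]
  · rw [map_zero, map_zero]

theorem ev_hopfH_hC_lamC (h : H) (m : Idx) :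
    ev h (hopfH.bracket (hC m) lamC) = m.1 * (lamFun h * hFun m h) := by
  rw [hopfH_bracket, Phi_hC, Phi_lamC, bracket_zh_zLam, map_smul, map_smul, map_mul, map_mul,
    ofZ1_zLam, ofZ1_zh, smul_eq_mul]
  rfl

/-- This is the comparison of the two brackets: the left side is the value given by the Manin triple
on a pair of generators, the right side is the semiclassical bracket carried over from `Z1`. -/
theorem form₂_gen (h : H) (i j : Fin 3 ⊕ Idx) :
    form₂ (adInvH h (genZ h i)) (diag (genX h j)) = ev h (hopfH.bracket (genC i) (genC j)) := by
  have left : ∀ G : CH, (∀ F, hopfH.bracket G F = 0) → ev h (hopfH.bracket (genC i) G) = 0 :=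
    fun G hG => by rw [hopfH_bracket_swap, hG, neg_zero, map_zero]
  have zero : ∀ X : ghat × ghat, form₂ (adInvH h 0) X = 0 := fun X => by
    rw [map_zero, ← form₂L_apply, map_zero, LinearMap.zero_apply]
  rcases i with i | m
  · fin_cases i
    · rcases j with j | n
      · fin_cases j
        · refine (form₂_genZ_lam h _).trans ?_
          change -lamFun h * coeff 0 (0 * _) = ev h (hopfH.bracket lamC lamC)
          rw [zero_mul, map_zero, mul_zero, hopfH.bracket_self, map_zero]
        · refine (form₂_genZ_lam h _).trans ((?_ : _ = (0 : ℂ)).trans (left _ hopfH_gamC).symm)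
          change -lamFun h * coeff 0 (0 * _) = 0
          rw [zero_mul, map_zero, mul_zero]
        · refine (form₂_genZ_lam h _).trans ((?_ : _ = (0 : ℂ)).trans (left _ hopfH_kC).symm)
          change -lamFun h * coeff 0 ((kFun h / 2) • 1 * _) = 0
          rw [smul_mul_assoc, one_mul, map_smul, map_sub, coeff_rescale, coeff_rescale, coeff_zD,
            coeff_zD]
          simp
      · refine (form₂_genZ_lam_genX h n).trans ?_
        change _ = ev h (hopfH.bracket lamC (hC n))
        rw [hopfH_bracket_swap, map_neg, ev_hopfH_hC_lamC]
    · exact (zero _).trans ((congrArg (ev h) (hopfH_gamC _)).trans (map_zero _)).symm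
    · exact (zero _).trans ((congrArg (ev h) (hopfH_kC _)).trans (map_zero _)).symm
  · refine (form₂_genZ_inr h m _).trans ?_
    rcases j with j | n
    · fin_cases j
      · change _ * (_ * coeff m.1 0) + 2 * (m.1 * hFun m h * (lamFun h / 2)) =
          ev h (hopfH.bracket (hC m) lamC)
        rw [ev_hopfH_hC_lamC, map_zero]
        ring
      · refine Eq.trans ?_ (left _ hopfH_gamC).symm
        change _ * (_ * coeff m.1 0) + 2 * (m.1 * hFun m h * 0) = 0
        rw [map_zero]
        ring
      · refine Eq.trans ?_ (left _ hopfH_kC).symm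
        change _ * (_ * coeff m.1 ((kFun h / 2) • 1)) + 2 * (m.1 * hFun m h * 0) = 0
        rw [map_smul, coeff_one, if_neg m.2, smul_zero]
        ring
    · change _ * (_ * coeff m.1 ((n.1.sign * ((gamU h ^ |n.1| : ℂˣ) : ℂ)) • zp (-n.1))) +
        2 * (m.1 * hFun m h * 0) = ev h (hopfH.bracket (hC m) (hC n))
      rw [ev_hopfH_hC_hC, map_smul, coeff_zp, smul_eq_mul]
      split_ifs with e
      · have e2 : ((gamU h ^ (-|n.1|) : ℂˣ) : ℂ) * ((gamU h ^ |n.1| : ℂˣ) : ℂ) = 1 := by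
          rw [← Units.val_mul, ← zpow_add, neg_add_cancel, zpow_zero, Units.val_one]
        rw [e, abs_neg, Int.sign_neg, Int.cast_neg]
        linear_combination (((gamU h ^ (2 * -n.1) : ℂˣ) : ℂ) -
          ((gamU h ^ (-(2 * -n.1)) : ℂˣ) : ℂ)) *
          (((n.1.sign : ℂ) * n.1.sign) * e2 + sign_mul_sign n.2)
      · ring

/-- The differentials of a function and of its brackets. -/
theorem exists_projPairs (h : H) (F : CH) : ∃ d ∈ projPairs h, IsDiff F.1 h d.1 ∧
    ∀ j, form₂ (adInvH h d.2) (diag (genX h j)) = ev h (hopfH.bracket F (genC j)) := by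
  -- For a fixed second generator both sides are derivations at h in `F`. Working in the linear
  -- space of pairs (differential, projection) keeps track of the differential and of its projected
  -- image at once.
  obtain ⟨d, h1, h2⟩ := exists_diff h (V := projPairs h)
    (LinearMap.fst ℂ (ghat × ghat) (ghat × ghat) ∘ₗ (projPairs h).subtype)
    (fun j => form₂L.flip (diag (genX h j)) ∘ₗ adInvH h ∘ₗ
      LinearMap.snd ℂ (ghat × ghat) (ghat × ghat) ∘ₗ (projPairs h).subtype)
    (fun j => (ev h).toLinearMap ∘ₗ hopfH.bracket.flip (genC j))
    (fun j F G => by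
      change ev h (hopfH.bracket (F * G) (genC j)) = ev h (hopfH.bracket F (genC j)) * ev h G +
        ev h F * ev h (hopfH.bracket G (genC j))
      rw [hopfH_leibniz_left, map_add, map_mul, map_mul])
    (fun i => ⟨⟨_, gen_mem_projPairs h i⟩, isDiff_gen h i, fun j => by
      change form₂ (adInvH h (genZ h i)) (diag (genX h j)) = ev h (hopfH.bracket (genC i) (genC j))
      exact form₂_gen h i j⟩) F
  exact ⟨d.1, d.2, h1, h2⟩

/-- For fixed `W` and `F` both sides are derivations at h in `G`, so the agreement on generators
propagates. -/
theorem exists_diff_form₂ (h : H) {W : ghat × ghat} {F : CH}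
    (hW : ∀ j, form₂ W (diag (genX h j)) = ev h (hopfH.bracket F (genC j))) (G : CH) :
    ∃ X, IsDiff G.1 h X ∧ form₂ W X = ev h (hopfH.bracket F G) := by
  obtain ⟨d, h1, h2⟩ := exists_diff h (V := ghat × ghat) LinearMap.id
    (fun _ : Unit => form₂L W) (fun _ => (ev h).toLinearMap ∘ₗ hopfH.bracket F)
    (fun _ G K => by
      change ev h (hopfH.bracket F (G * K)) = ev h (hopfH.bracket F G) * ev h K +
        ev h G * ev h (hopfH.bracket F K)
      rw [hopfH.leibniz, map_add, map_mul, map_mul])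
    (fun i => ⟨_, isDiff_gen h i, fun _ => hW i⟩) G
  exact ⟨d, h1, h2 ()⟩

/-- The bracket of the Manin triple. -/
theorem isBracketAt_iff (F G : CH) (h : H) (v : ℂ) :
    IsBracketAt F.1 G.1 h v ↔ v = (hopfH.bracket F G).1 h := by
  obtain ⟨d, ⟨hl, hZ, hk, h0⟩, hX, hW⟩ := exists_projPairs h F
  obtain ⟨X', hX', e⟩ := exists_diff_form₂ h hW G
  have hA := isAd₂_adH h hX.1 hl
  have hB := isAd₂_adInvH h hZ h0
  refine ⟨?_, fun hv => ⟨d.1, X', _, d.2, _, hX, hX', hA, hZ, hk, hB, hv.trans e.symm⟩⟩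
  -- Conversely, any data as in the definition coincide with the constructed ones: the differentials
  -- by nondegeneracy, `Y` and `W` by uniqueness of velocities, `Z` by transversality of the Lie
  -- algebra of `H` and the diagonal.
  rintro ⟨X₁, X₂, Y, Z, W, k1, k2, k3, k4, k5, k6, rfl⟩
  obtain rfl := k1.unique hX
  obtain rfl := k2.unique hX'
  obtain rfl : Y = adH h d.1 := Prod.ext (k3.1.unique hA.1) (k3.2.unique hA.2)
  obtain rfl : Z = d.2 := by
    refine sub_eq_zero.1 (eq_zero_of_mem_hLie_of_mem_kLie (hLie.sub_mem k4 hZ) ?_)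
    have := kLie.sub_mem hk k5
    rwa [sub_sub_sub_cancel_left] at this
  obtain rfl : W = adInvH h d.2 := Prod.ext (k6.1.unique hB.1) (k6.2.unique hB.2)
  exact e

/-- The evaluation at a pair of points. -/
def ev₂ (h h' : H) : CH ⊗[ℂ] CH →ₐ[ℂ] ℂ :=
  Algebra.TensorProduct.lift (ev h) (ev h') (fun _ _ => Commute.all _ _)

theorem ev₂_symm₂ (h h' : H) (x y : Z1) :
    ev₂ h h' (PoissonHopf.symm₂ Phi (x ⊗ₜ y)) = ev h (ofZ1 x) * ev h' (ofZ1 y) := rfl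

theorem ev_ofZ1_zG (h : H) (n : ℤ) : ev h (ofZ1 (zG n)) = ((gamU h ^ n : ℂˣ) : ℂ) :=
  ofZ1_zGamU_zpow n h

/-- Both sides, as functions of an element of `Z1`, are algebra homomorphisms; on generators the
equality is the product formula of the corresponding coordinate. -/
theorem hopfH_comul (F : CH) (h h' : H) : ev₂ h h' (hopfH.comul F) = F.1 (h * h') := by
  have : (ev₂ h h').comp ((Algebra.TensorProduct.map (Phi.symm : Z1 →ₐ[ℂ] CH)
      (Phi.symm : Z1 →ₐ[ℂ] CH)).comp comulZ) = (ev (h * h')).comp ofZ1 := by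
    refine Z1_algHom_ext ?_ ?_ ?_ fun m => ?_
    · change ev₂ h h' (PoissonHopf.symm₂ Phi (comulZ zLam)) = ev (h * h') (ofZ1 zLam)
      rw [comulZ_zLam, ev₂_symm₂, ofZ1_zLam]
      exact (lamFun_mul h h').symm
    · change ev₂ h h' (PoissonHopf.symm₂ Phi (comulZ zGam)) = ev (h * h') (ofZ1 zGam)
      rw [comulZ_zGam, ev₂_symm₂, ofZ1_zGam]
      rfl
    · change ev₂ h h' (PoissonHopf.symm₂ Phi (comulZ zk)) = ev (h * h') (ofZ1 zk)
      rw [comulZ_zk, ev₂_symm₂, ofZ1_zk]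
      exact (kFun_mul h h').symm
    · change ev₂ h h' (PoissonHopf.symm₂ Phi (comulZ (zh m))) = ev (h * h') (ofZ1 (zh m))
      rw [comulZ_zh, map_add, map_add, ev₂_symm₂, ev₂_symm₂, ofZ1_zh, ev_ofZ1_zG, ev_ofZ1_zG]
      refine Eq.trans ?_ (hFun_mul m h h').symm
      rw [mul_comm]
      rfl
  have := DFunLike.congr_fun this (Phi F)
  have e : ofZ1 (Phi F) = F := Phi.symm_apply_apply F
  rw [AlgHom.comp_apply (ev (h * h')), e] at this
  exact this

theorem hopfH_counit (F : CH) : hopfH.counit F = F.1 1 := by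
  have : counitZ = (ev 1).comp ofZ1 := by
    refine Z1_algHom_ext ?_ ?_ ?_ fun m => ?_
    · rw [counitZ_zLam, AlgHom.comp_apply, ofZ1_zLam]
      exact lamFun_one.symm
    · rw [counitZ_zGam, AlgHom.comp_apply, ofZ1_zGam]
      rfl
    · rw [counitZ_zk, AlgHom.comp_apply, ofZ1_zk]
      exact kFun_one.symm
    · rw [counitZ_zh, AlgHom.comp_apply, ofZ1_zh]
      exact (hFun_one m).symm
  have := DFunLike.congr_fun this (Phi F)
  have e : ofZ1 (Phi F) = F := Phi.symm_apply_apply F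
  rw [AlgHom.comp_apply, e] at this
  exact this

theorem gamU_inv (h : H) : gamU h⁻¹ = (gamU h)⁻¹ := rfl

theorem lamFun_inv (h : H) : lamFun h⁻¹ = (lamFun h)⁻¹ := by
  refine eq_inv_of_mul_eq_one_left ?_
  rw [← lamFun_mul, inv_mul_cancel, lamFun_one]

theorem kFun_inv (h : H) : kFun h⁻¹ = (kFun h)⁻¹ := by
  refine eq_inv_of_mul_eq_one_left ?_
  rw [← kFun_mul, inv_mul_cancel, kFun_one]

/-- In the product formula for h⁻¹ h both terms carry the same power Γ^{-|m|}, which can be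
cancelled. -/
theorem hFun_inv (m : Idx) (h : H) : hFun m h⁻¹ = -hFun m h := by
  have e := hFun_mul m h⁻¹ h
  rw [inv_mul_cancel, hFun_one, gamU_inv, inv_zpow', ← mul_add] at e
  exact eq_neg_of_add_eq_zero_left ((mul_eq_zero.1 e.symm).resolve_left (Units.ne_zero _))

theorem hopfH_antipode (F : CH) (h : H) : (hopfH.antipode F).1 h = F.1 h⁻¹ := by
  have inv : ∀ x y : Z1, x * y = 1 → ev h (ofZ1 x) = (ev h (ofZ1 y))⁻¹ := fun x y e => by
    refine eq_inv_of_mul_eq_one_left ?_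
    rw [← map_mul, ← map_mul, e, map_one, map_one]
  have : ((ev h).comp ofZ1).comp antipodeZ = (ev h⁻¹).comp ofZ1 := by
    refine Z1_algHom_ext ?_ ?_ ?_ fun m => ?_
    · rw [AlgHom.comp_apply, AlgHom.comp_apply, AlgHom.comp_apply, antipodeZ_zLam, ofZ1_zLam]
      refine (inv _ _ zLamInv_mul).trans ?_
      rw [ofZ1_zLam]
      exact (lamFun_inv h).symm
    · rw [AlgHom.comp_apply, AlgHom.comp_apply, AlgHom.comp_apply, antipodeZ_zGam, ofZ1_zGam]
      refine (inv _ _ zGamInv_mul).trans ?_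
      rw [ofZ1_zGam]
      exact (Units.val_inv_eq_inv_val (gamU h)).symm
    · rw [AlgHom.comp_apply, AlgHom.comp_apply, AlgHom.comp_apply, antipodeZ_zk, ofZ1_zk]
      refine (inv _ _ zkInv_mul).trans ?_
      rw [ofZ1_zk]
      exact (kFun_inv h).symm
    · rw [AlgHom.comp_apply, AlgHom.comp_apply, AlgHom.comp_apply, antipodeZ_zh, map_neg, map_neg,
        ofZ1_zh]
      exact (hFun_inv m h).symm
  have := DFunLike.congr_fun this (Phi F)
  have e : ofZ1 (Phi F) = F := Phi.symm_apply_apply F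
  rw [AlgHom.comp_apply (ev h⁻¹), e] at this
  exact this

theorem isPoissonGroup_hopfH : IsPoissonGroup hopfH where
  comul := hopfH_comul
  counit := hopfH_counit
  antipode := hopfH_antipode
  bracket := isBracketAt_iff

end GL1Loop

end

open GL1Loop Heisenberg in
theorem mainTheorem4 :
    (∀ F ∈ CH, ∀ G ∈ CH, ∃ B ∈ CH, ∀ (h : H) (v : ℂ), IsBracketAt F G h v ↔ v = B h) ∧
    AlgebraicIndependent ℂ
      (Sum.elim ![lamFun, gamFun, kFun] hFun : Fin 3 ⊕ {m : ℤ // m ≠ 0} → H → ℂ) ∧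
    ∃ (P : PoissonHopf CH) (Q : PoissonHopf Z1),
      IsPoissonGroup P ∧ IsSemiclassical Q ∧
      ∃ Φ : CH ≃ₐ[ℂ] Z1,
        Φ ⟨lamFun, lamFun_mem⟩ = zLam ∧ Φ ⟨gamFun, gamFun_mem⟩ = zGam ∧
        Φ ⟨kFun, kFun_mem⟩ = zk ∧ (∀ m, Φ ⟨hFun m, hFun_mem m⟩ = zh m) ∧
        P.IsIso Q Φ :=
  ⟨fun F hF G hG => ⟨_, (hopfH.bracket ⟨F, hF⟩ ⟨G, hG⟩).2, isBracketAt_iff ⟨F, hF⟩ ⟨G, hG⟩⟩,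
    algebraicIndependent_coordinates, hopfH, hopfZ, isPoissonGroup_hopfH, isSemiclassical_hopfZ,
    Phi, Phi_lamC, Phi_gamC, Phi_kC, Phi_hC, PoissonHopf.transport_isIso hopfZ Phi⟩
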